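/- **Notation.** Let $n\ge 2$, $m\ge 0$ be integers, and let $S^m$ be the space of complex symmetric tensors $u=(u_{i_1\dots i_m})$ of rank $m$ on $\mathbb R^n$ (components in the standard basis; repeated indices are summed). Let $\mathcal S(\mathbb R^n;S^m)$ be the symmetric tensor fields with components in the Schwartz space, $\sigma$ the symmetrization in all indices, and $\delta$ the Kronecker tensor. On smooth symmetric tensor fields put $$(du)_{i_1\dots i_{s+1}}=\sigma\,\partial_{i_{s+1}}u_{i_1\dots i_s},\qquad (\mathrm{div}\,u)_{i_1\dots i_{s}}=\partial_{j}u_{i_1\dots i_sj},\qquad i\,u=\sigma(\delta\otimes u),$$ $$(j\,u)_{i_1\dots i_s}=u_{i_1\dots i_s pp},\qquad (j_xu)_{i_1\dots i_s}(x)=x_p\,u_{i_1\dots i_sp}(x).$$ For $0\le k\le m$, the momentum ray transform of $f\in\mathcal S(\mathbb R^n;S^m)$ is $$I_m^kf(x,\xi)=\int_{\mathbb R}t^k f_{i_1\dots i_m}(x+t\xi)\,\xi_{i_1}\cdots\xi_{i_m}\,dt\qquad(|\xi|=1,\ \langle x,\xi\rangle=0).$$ Its formal adjoint with respect to the $L^2$-products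 on $\mathbb R^n$ and on $T\mathbb S^{n-1}=\{(x,\xi):|\xi|=1,\langle x,\xi\rangle=0\}$ (Lebesgue measure $dx$ on $\xi^\perp$, surface measure $d\xi$ on $\mathbb S^{n-1}$) is $$\big((I_m^k)^*\varphi\big)_{i_1\dots i_m}(x)=\int_{\mathbb S^{n-1}}\langle x,\xi\rangle^k\,\xi_{i_1}\cdots\xi_{i_m}\,\varphi(x-\langle x,\xi\rangle\xi,\xi)\,d\xi ,$$ and $N_m^k=(I_m^k)^*I_m^k$ is the normal operator, which maps $\mathcal S(\mathbb R^n;S^m)$ to $C^\infty(\mathbb R^n;S^m)$. Let $\widehat u(y)=(2\pi)^{-n/2}\int e^{-\mathrm i\langle y,x\rangle}u(x)\,dx$, extended to tempered distributions, and let $(-\Delta)^{1/2}u=\mathcal F^{-1}(|y|\,\widehat u)$, componentwise, for tempered $u$ such that $\widehat u$ is a function with $|y|\,\widehat u(y)$ integrable. Finally $(-1)!!=0!!=1$ and $l!!=l\,(l-2)!!$ for $l\ge1$. **Theorem.** Let $m\ge0$ and $n\ge2$ be integers. For $0\le k\le m$ define $$D_{m,n}^k=c_{m,n}^k\sum_{p=k}^m(n+2m-2p-3)!!\sum_{q=0}^{\min(p,m-p,p-k)}\frac{(-1)^q}{2^q\,q!\,(m-p-q)!\,(p-k-q)!}\;d^{\,p-q}\,i^q\,j^q\,j_x^{\,p-k-q}\,\mathrm{div}^k,$$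 $$c_{m,n}^k=\frac{(-1)^k}{(k!)^2}\;\frac{2^{m-2}\,\Gamma\big(\tfrac{2m+n-1}{2}\big)}{\pi^{(n+1)/2}\,(n+2m-3)!!}.$$ Then $D_{m,n}^k:C^\infty(\mathbb R^n;S^m)\to C^\infty(\mathbb R^n;S^m)$ is a linear differential operator of order $m+k$, and every $f\in\mathcal S(\mathbb R^n;S^m)$ is recovered from $(N_m^0f,\dots,N_m^mf)$ by $$f(x)=(-\Delta)^{1/2}\sum_{k=0}^m D_{m,n}^k\big(N_m^kf\big)(x)\qquad(x\in\mathbb R^n);$$ in particular $(-\Delta)^{1/2}$ of the sum on the right-hand side is well defined in the above sense. -/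

import Mathlib

open MeasureTheory
open scoped SchwartzMap ContDiff Nat ComplexConjugate

noncomputable section

namespace MomentumRay

/-! ### Tensor algebra -/

/-- The Euclidean space `ℝⁿ`. -/
abbrev Rn (n : ℕ) : Type := EuclideanSpace ℝ (Fin n)

/-- The standard basis vector `e_j`. -/
def basisVec {n : ℕ} (j : Fin n) : Rn n := EuclideanSpace.single j 1

/-- Complex tensors of rank `m` on `ℝⁿ`, given by their components `u_{i₁…i_m}`. -/
abbrev Tensor (n m : ℕ) : Type := (Fin m → Fin n) → ℂ

/-- The space `S^m` of symmetric tensors of rank `m`. -/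
def SymTensor (n m : ℕ) : Submodule ℂ (Tensor n m) where
  carrier := {u | ∀ (π : Equiv.Perm (Fin m)) (I : Fin m → Fin n), u (I ∘ π) = u I}
  add_mem' := by
    intro u v hu hv π I
    simp [hu π I, hv π I]
  zero_mem' := by
    intro π I
    rfl
  smul_mem' := by
    intro c u hu π I
    simp [hu π I]

/-- The symmetrization `σ` in all indices. -/
def symmetrize {n m : ℕ} (u : Tensor n m) : Tensor n m := fun I =>
  ((m ! : ℕ) : ℂ)⁻¹ * ∑ π : Equiv.Perm (Fin m), u (I ∘ π)

/-- The tensor product `u ⊗ v`. -/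
def tensorProd {n a b : ℕ} (u : Tensor n a) (v : Tensor n b) : Tensor n (a + b) := fun I =>
  u (I ∘ Fin.castAdd b) * v (I ∘ Fin.natAdd a)

/-- The operator `i_u` of symmetric multiplication by `u`. The symmetric product is commutative;
the factor `u` is put in the last indices, so that the rank reads `s + a`. -/
def symMul {n a s : ℕ} (u : Tensor n a) (v : Tensor n s) : Tensor n (s + a) :=
  symmetrize (tensorProd v u)

/-- The operator `j_u` of contraction with `u` in the last indices. -/
def contract {n a s : ℕ} (u : Tensor n a) (v : Tensor n (s + a)) : Tensor n s := fun I =>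
  ∑ J : Fin a → Fin n, v (Fin.append I J) * u J

/-- The Kronecker tensor `δ`. -/
def kronecker (n : ℕ) : Tensor n 2 := fun I => if I 0 = I 1 then 1 else 0

/-- A vector of `ℝⁿ` as a tensor of rank one. -/
def vecTensor {n : ℕ} (x : Rn n) : Tensor n 1 := fun I => (x (I 0) : ℂ)

/-- The component `ξ_{i₁} ⋯ ξ_{i_m}` of the power `ξ^m`. -/
def vecPow {n m : ℕ} (ξ : Rn n) : Tensor n m := fun I => ∏ a, (ξ (I a) : ℂ)

/-! ### Operators on tensor fields -/

/-- Tensor fields of rank `m` on `ℝⁿ`. -/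
abbrev Field (n m : ℕ) : Type := Rn n → Tensor n m

/-- Smooth symmetric tensor fields, i.e. the space `C^∞(ℝⁿ; S^m)`. -/
def IsSmoothSym {n m : ℕ} (g : Field n m) : Prop :=
  ContDiff ℝ ∞ g ∧ ∀ x, g x ∈ SymTensor n m

/-- The partial derivative `∂_j g_I`. -/
def pderiv {n m : ℕ} (j : Fin n) (g : Field n m) : Field n m := fun x I =>
  fderiv ℝ (fun y => g y I) x (basisVec j)

/-- The inner derivative `(dg)_{i₁…i_{m+1}} = σ(i₁…i_{m+1}) ∂g_{i₁…i_m}/∂x^{i_{m+1}}`. -/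
def innerDeriv {n m : ℕ} (g : Field n m) : Field n (m + 1) := fun x =>
  symmetrize (fun I => pderiv (I (Fin.last m)) g x (Fin.init I))

/-- The divergence `(div g)_{i₁…i_m} = ∑_j ∂g_{i₁…i_m j}/∂x^j`. -/
def divergence {n m : ℕ} (g : Field n (m + 1)) : Field n m := fun x I =>
  ∑ j, pderiv j g x (Fin.snoc I j)

/-- The operator `i = i_δ`. -/
def opI {n m : ℕ} (g : Field n m) : Field n (m + 2) := fun x => symMul (kronecker n) (g x)

/-- The operator `j = j_δ`. -/
def opJ {n m : ℕ} (g : Field n (m + 2)) : Field n m := fun x => contract (kronecker n) (g x)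

/-- The operator `j_x` of contraction with the position vector. -/
def opJx {n m : ℕ} (g : Field n (m + 1)) : Field n m := fun x => contract (vecTensor x) (g x)

/-- `d^r`. -/
def innerDerivPow {n m : ℕ} : (r : ℕ) → Field n m → Field n (m + r)
  | 0, g => g
  | r + 1, g => innerDeriv (innerDerivPow r g)

/-- `i^r`. -/
def opIPow {n m : ℕ} : (r : ℕ) → Field n m → Field n (m + 2 * r)
  | 0, g => g
  | r + 1, g => opI (opIPow r g)

/-- `div^r`. -/
def divergencePow {n m : ℕ} : (r : ℕ) → Field n (m + r) → Field n m
  | 0, g => g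
  | r + 1, g => divergencePow r (divergence g)

/-- `j^r`. -/
def opJPow {n m : ℕ} : (r : ℕ) → Field n (m + 2 * r) → Field n m
  | 0, g => g
  | r + 1, g => opJPow r (opJ g)

/-- `j_x^r`. -/
def opJxPow {n m : ℕ} : (r : ℕ) → Field n (m + r) → Field n m
  | 0, g => g
  | r + 1, g => opJxPow r (opJx g)

/-- Transport of a tensor field along an equality of ranks `a = b`. It is used only for ranks that
are equal; the value `0` for different ranks is never met. -/
def castRank {n a : ℕ} (b : ℕ) (g : Field n a) : Field n b := fun x I =>
  if h : a = b then g x (I ∘ Fin.cast h) else 0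

/-! ### Ray transforms and normal operators -/

/-- The momentum ray transform `I_m^k f(x, ξ) = ∫ t^k ⟨f(x + tξ), ξ^m⟩ dt`. -/
def rayTransform {n m : ℕ} (k : ℕ) (f : Field n m) (x ξ : Rn n) : ℂ :=
  ∫ t : ℝ, (t : ℂ) ^ k * ∑ I : Fin m → Fin n, f (x + t • ξ) I * vecPow ξ I

/-- The operator `(I_m^k)^*`:
`((I_m^k)^* χ)_{i₁…i_m}(x) = ∫_{S^{n-1}} ⟨x,ξ⟩^k ξ_{i₁} ⋯ ξ_{i_m} χ(x - ⟨x,ξ⟩ξ, ξ) dξ`. -/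
def rayAdjoint {n : ℕ} (m k : ℕ) (χ : Rn n → Rn n → ℂ) : Field n m := fun x I =>
  ∫ ξ : Metric.sphere (0 : Rn n) 1,
    ((inner ℝ x (ξ : Rn n) : ℝ) : ℂ) ^ k * vecPow (ξ : Rn n) I *
      χ (x - (inner ℝ x (ξ : Rn n) : ℝ) • (ξ : Rn n)) ξ
    ∂(volume : Measure (Rn n)).toSphere

/-- The `L²`-product of tensor fields on `ℝⁿ`. -/
def l2Field {n m : ℕ} (f g : Field n m) : ℂ :=
  ∫ x, ∑ I : Fin m → Fin n, f x I * conj (g x I)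

/-- The `L²`-product on `TS^{n-1} = {(x, ξ) : |ξ| = 1, ⟨x, ξ⟩ = 0}`; the inner integral is
over the hyperplane `ξ^⊥` with its Lebesgue measure as a Euclidean space. -/
def l2TangentSphere {n : ℕ} (χ ψ : Rn n → Rn n → ℂ) : ℂ :=
  ∫ ξ : Metric.sphere (0 : Rn n) 1,
    (∫ x : (Submodule.span ℝ {(ξ : Rn n)})ᗮ, χ x ξ * conj (ψ x ξ))
    ∂(volume : Measure (Rn n)).toSphere

/-- A symmetric Schwartz tensor field as a tensor field. -/
def toField {n m : ℕ} (f : 𝓢(Rn n, SymTensor n m)) : Field n m := fun x => (f x : Tensor n m)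

/-- `rayAdjoint m k` is the formal adjoint of `I_m^k` with respect to the two `L²`-products. The
Schwartz functions on `TS^{n-1}` are the restrictions of Schwartz functions on `ℝⁿ × ℝⁿ`. -/
def IsFormalAdjoint (n m k : ℕ) : Prop :=
  ∀ (f : 𝓢(Rn n, SymTensor n m)) (χ : 𝓢(Rn n × Rn n, ℂ)),
    l2TangentSphere (rayTransform k (toField f)) (fun x ξ => χ (x, ξ)) =
      l2Field (toField f) (rayAdjoint m k (fun x ξ => χ (x, ξ)))

/-- The normal operator `N_m^k = (I_m^k)^* I_m^k`. -/
def normalOp {n m : ℕ} (k : ℕ) (f : Field n m) : Field n m :=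
  rayAdjoint m k (rayTransform k f)

/-! ### The differential operators `D_{m,n}^k` -/

/-- The coefficient `c_{m,n}^k`. The truncated difference in `(n + 2m - 3)‼` accounts for the
convention `(-1)!! = 1`. -/
def coeffC (m n k : ℕ) : ℝ :=
  (-1) ^ k / (k ! : ℝ) ^ 2 *
    ((2 : ℝ) ^ ((m : ℤ) - 2) * Real.Gamma ((2 * (m : ℝ) + n - 1) / 2) /
      (Real.pi ^ (((n : ℝ) + 1) / 2) * ((n + 2 * m - 3)‼ : ℕ)))

/-- The operator `d^{p-q} i^q j^q j_x^{p-k-q} div^k` on fields of rank `m`, where `k + q ≤ p` and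
`p + q ≤ m`. The ranks are `m`, `m - k`, `m - p + q`, `m - p - q`, `m - p + q`, `m`. -/
def termD {n m : ℕ} (k p q : ℕ) (g : Field n m) : Field n m :=
  castRank m
    (innerDerivPow (p - q) (opIPow q (opJPow q (opJxPow (p - k - q) (divergencePow k
      (castRank ((m - p - q) + 2 * q + (p - k - q) + k) g))))))

/-- The operator `D_{m,n}^k`, for `k ≤ m` and `2 ≤ n`. For `p ≤ m` the number `n + 2m - 2p - 3` is at
least `-1`, and the truncated difference accounts for the convention `(-1)!! = 1`. -/
def opD (m n k : ℕ) (g : Field n m) : Field n m := fun x I =>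
  (coeffC m n k : ℂ) * ∑ p ∈ Finset.Icc k m, (((n + 2 * m - 2 * p - 3)‼ : ℕ) : ℂ) *
    ∑ q ∈ Finset.range (min p (min (m - p) (p - k)) + 1),
      (-1 : ℂ) ^ q / (2 ^ q * (q ! : ℂ) * ((m - p - q)! : ℂ) * ((p - k - q)! : ℂ)) *
        termD k p q g x I

/-- `P` agrees on smooth symmetric tensor fields with a linear differential operator
`∑_{s ≤ r} ∑_{|α| = s} ∑_J c_{α,J,I}(x) ∂_α g_J(x)` of order at most `r` with smooth coefficients,
and takes smooth symmetric tensor fields to such fields. -/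
def IsDiffOpOfOrderLE {n a b : ℕ} (P : Field n a → Field n b) (r : ℕ) : Prop :=
  (∀ g, IsSmoothSym g → IsSmoothSym (P g)) ∧
  ∃ c : (s : ℕ) → (Fin s → Fin n) → (Fin a → Fin n) → (Fin b → Fin n) → Rn n → ℂ,
    (∀ s α J I, ContDiff ℝ ∞ (c s α J I)) ∧
    ∀ g, IsSmoothSym g → ∀ x I,
      P g x I = ∑ s ∈ Finset.range (r + 1), ∑ α : Fin s → Fin n, ∑ J : Fin a → Fin n,
        c s α J I x * iteratedFDeriv ℝ s (fun y => g y J) x (fun l => basisVec (α l))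

/-- `P` is a linear differential operator of order `r`, and not of smaller order. -/
def IsDiffOpOfOrder {n a b : ℕ} (P : Field n a → Field n b) (r : ℕ) : Prop :=
  IsDiffOpOfOrderLE P r ∧ ∀ r' < r, ¬ IsDiffOpOfOrderLE P r'

/-! ### The operator `(-Δ)^{1/2}` -/

/-- The Fourier transform `(2π)^{-n/2} ∫ e^{-i⟨y,x⟩} χ(x) dx`. -/
def fourierT {n : ℕ} (χ : Rn n → ℂ) (y : Rn n) : ℂ :=
  (((2 * Real.pi) ^ (-(n : ℝ) / 2) : ℝ) : ℂ) *
    ∫ x, Complex.exp (-Complex.I * ((inner ℝ y x : ℝ) : ℂ)) * χ x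

/-- The inverse Fourier transform `(2π)^{-n/2} ∫ e^{i⟨x,y⟩} h(y) dy`. -/
def fourierTInv {n : ℕ} (h : Rn n → ℂ) (x : Rn n) : ℂ :=
  (((2 * Real.pi) ^ (-(n : ℝ) / 2) : ℝ) : ℂ) *
    ∫ y, Complex.exp (Complex.I * ((inner ℝ x y : ℝ) : ℂ)) * h y

/-- Functions `u` with `∫ |u(x)| (1 + |x|)^{-N} dx < ∞` for some `N`; such a function is the
tempered distribution `χ ↦ ∫ u χ`. -/
def IsTempered {n : ℕ} (u : Rn n → ℂ) : Prop :=
  ∃ N : ℕ, Integrable (fun x => (((1 + ‖x‖) ^ N)⁻¹ : ℝ) • u x)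

/-- The Fourier transform of the tempered distribution `u` is the function `h`. -/
def HasFourier {n : ℕ} (u h : Rn n → ℂ) : Prop :=
  IsTempered u ∧ IsTempered h ∧ ∀ χ : 𝓢(Rn n, ℂ), ∫ x, u x * fourierT χ x = ∫ y, h y * χ y

/-- `(-Δ)^{1/2} u` is defined and equals `v` at every point: the Fourier transform of the tempered
distribution `u` is a function `h` (unique almost everywhere) such that `|y| h(y)` is integrable,
and `v` is the inverse Fourier transform of `|y| h(y)`. -/
def HasSqrtNegLaplacian {n : ℕ} (u v : Rn n → ℂ) : Prop :=
  ∃ h : Rn n → ℂ, HasFourier u h ∧ Integrable (fun y => (‖y‖ : ℂ) * h y) ∧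
    ∀ x, v x = fourierTInv (fun y => (‖y‖ : ℂ) * h y) x

end MomentumRay

end

noncomputable section

namespace MomentumRay

/-! ### Symmetric tensors as polynomials -/

lemma vecPow_append {n a b : ℕ} (ξ : Rn n) (I : Fin a → Fin n) (J : Fin b → Fin n) :
    vecPow ξ (Fin.append I J) = vecPow ξ I * vecPow ξ J := by
  simp [vecPow, Fin.prod_univ_add]

lemma vecPow_snoc {n a : ℕ} (ξ : Rn n) (I : Fin a → Fin n) (j : Fin n) :
    vecPow ξ (Fin.snoc I j : Fin (a + 1) → Fin n) = vecPow ξ I * (ξ j : ℂ) := by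
  simp [vecPow, Fin.prod_univ_castSucc]

lemma vecPow_perm {n m : ℕ} (ξ : Rn n) (π : Equiv.Perm (Fin m)) (I : Fin m → Fin n) :
    vecPow ξ (I ∘ π) = vecPow ξ I :=
  Equiv.prod_comp π (fun a => (ξ (I a) : ℂ))

lemma vecPow_smul {n m : ℕ} (t : ℝ) (ξ : Rn n) (I : Fin m → Fin n) :
    vecPow (t • ξ) I = (t : ℂ) ^ m * vecPow ξ I := by
  simp [vecPow, Finset.prod_mul_distrib]

lemma norm_vecPow_le {n m : ℕ} (ξ : Rn n) (I : Fin m → Fin n) :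
    ‖vecPow ξ I‖ ≤ ‖ξ‖ ^ m := by
  rw [vecPow, norm_prod]
  calc ∏ a, ‖(ξ (I a) : ℂ)‖ ≤ ∏ _a : Fin m, ‖ξ‖ := by
        refine Finset.prod_le_prod (fun _ _ => norm_nonneg _) fun a _ => ?_
        rw [Complex.norm_real]; exact PiLp.norm_apply_le ξ (I a)
    _ = ‖ξ‖ ^ m := by simp

lemma continuous_vecPow {n m : ℕ} (I : Fin m → Fin n) :
    Continuous (fun ξ : Rn n => vecPow ξ I) := by
  unfold vecPow; fun_prop

/-- The polynomial `u(η) = ∑_I u_I η_I` of a tensor `u`. -/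
def tensorEval {n m : ℕ} (u : Tensor n m) (η : Rn n) : ℂ := ∑ I, u I * vecPow η I

lemma symmetrize_mem {n m : ℕ} (u : Tensor n m) : symmetrize u ∈ SymTensor n m := by
  intro π I
  unfold symmetrize
  congr 1
  exact Equiv.sum_comp (Equiv.mulLeft π) (fun ρ : Equiv.Perm (Fin m) => u (I ∘ ρ))

lemma tensorEval_symmetrize {n m : ℕ} (u : Tensor n m) (η : Rn n) :
    tensorEval (symmetrize u) η = tensorEval u η := by
  have h : ∀ π : Equiv.Perm (Fin m), ∑ I : Fin m → Fin n, u (I ∘ π) * vecPow η I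
      = ∑ I, u I * vecPow η I := fun π => by
    rw [← (Equiv.arrowCongr π (Equiv.refl (Fin n))).sum_comp]
    refine Finset.sum_congr rfl fun I _ => ?_
    have h1 : (Equiv.arrowCongr π (Equiv.refl (Fin n))) I = I ∘ (π.symm : Equiv.Perm (Fin m)) := rfl
    rw [h1, vecPow_perm]
    congr 2
    ext a; simp
  unfold tensorEval symmetrize
  simp only [mul_assoc, Finset.sum_mul, ← Finset.mul_sum]
  rw [Finset.sum_comm]
  simp only [h, Finset.sum_const, Finset.card_univ, Fintype.card_perm, Fintype.card_fin,
    nsmul_eq_mul]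
  rw [← mul_assoc, inv_mul_cancel₀ (by exact_mod_cast (Nat.factorial_pos m).ne'), one_mul]

lemma tensorEval_tensorProd {n a b : ℕ} (u : Tensor n a) (v : Tensor n b) (η : Rn n) :
    tensorEval (tensorProd u v) η = tensorEval u η * tensorEval v η := by
  unfold tensorEval
  rw [Finset.sum_mul_sum, ← Finset.sum_product', ← (Fin.appendEquiv a b).sum_comp]
  refine Finset.sum_congr rfl fun p _ => ?_
  have h1 : (Fin.appendEquiv a b) p = Fin.append p.1 p.2 := rfl
  have h2 : (Fin.append p.1 p.2) ∘ Fin.castAdd b = p.1 := by ext; simp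
  have h3 : (Fin.append p.1 p.2) ∘ Fin.natAdd a = p.2 := by ext; simp
  rw [h1, vecPow_append, tensorProd, h2, h3]
  ring

lemma sum_kronecker {n : ℕ} (ξ : Rn n) :
    ∑ J : Fin 2 → Fin n, vecPow ξ J * kronecker n J = ((‖ξ‖ ^ 2 : ℝ) : ℂ) := by
  rw [← (finTwoArrowEquiv (Fin n)).symm.sum_comp, Fintype.sum_prod_type]
  simp [kronecker, vecPow, EuclideanSpace.norm_sq_eq, ← pow_two]

lemma sum_vecTensor {n : ℕ} (x ξ : Rn n) :
    ∑ J : Fin 1 → Fin n, vecPow ξ J * vecTensor x J = ((inner ℝ x ξ : ℝ) : ℂ) := by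
  rw [← (Equiv.funUnique (Fin 1) (Fin n)).symm.sum_comp]
  simp [vecTensor, vecPow, PiLp.inner_apply]

lemma sum_vecPow_mul_vecPow {n r : ℕ} (ξ η : Rn n) :
    ∑ I : Fin r → Fin n, vecPow ξ I * vecPow η I = ((inner ℝ ξ η : ℝ) : ℂ) ^ r := by
  simp only [vecPow, ← Finset.prod_mul_distrib]
  rw [← Fintype.piFinset_univ, Finset.sum_prod_piFinset (Finset.univ : Finset (Fin n))
    (fun (_ : Fin r) (j : Fin n) => (ξ j : ℂ) * (η j : ℂ))]
  simp [PiLp.inner_apply, mul_comm]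

/-- A symmetric tensor is determined by its polynomial. -/
lemma eq_zero_of_tensorEval_eq_zero {n m : ℕ} {u : Tensor n m} (hu : u ∈ SymTensor n m)
    (h : ∀ η, tensorEval u η = 0) : u = 0 := by
  classical
  let P : MvPolynomial (Fin n) ℂ := ∑ I, MvPolynomial.C (u I) * ∏ a, MvPolynomial.X (I a)
  have hP : P = 0 := by
    refine MvPolynomial.funext_set (fun _ => Set.range ((↑) : ℝ → ℂ))
      (fun _ => Set.infinite_range_of_injective Complex.ofReal_injective) fun x hx => ?_
    choose y hy using fun i => hx i (Set.mem_univ i)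
    have := h (WithLp.toLp 2 y)
    simp only [tensorEval, vecPow] at this
    simp only [P, map_sum, map_mul, MvPolynomial.eval_C, map_prod, MvPolynomial.eval_X, map_zero]
    rw [← this]
    simp [hy]
  funext I₀
  let d : (Fin m → Fin n) → (Fin n →₀ ℕ) := fun I => ∑ a, Finsupp.single (I a) 1
  have hmon : ∀ I : Fin m → Fin n, (∏ a, MvPolynomial.X (R := ℂ) (I a))
      = MvPolynomial.monomial (d I) 1 := fun I => by
    simp only [MvPolynomial.X, d]
    rw [MvPolynomial.monomial_sum_one]
  have hperm : ∀ I, d I = d I₀ → ∃ π : Equiv.Perm (Fin m), I = I₀ ∘ π := fun I hI => by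
    have hcard : ∀ (K : Fin m → Fin n) j, d K j = Fintype.card {a // K a = j} := fun K j => by
      simp [d, Finsupp.single_apply, Fintype.card_subtype, Finset.sum_boole]
    have e : ∀ j, Nonempty ({a // I a = j} ≃ {a // I₀ a = j}) := fun j => by
      rw [← Fintype.card_eq, ← hcard, ← hcard, hI]
    replace e := fun j => (e j).some
    refine ⟨(Equiv.sigmaFiberEquiv I).symm.trans ((Equiv.sigmaCongrRight e).trans
      (Equiv.sigmaFiberEquiv I₀)), ?_⟩
    ext a
    simp only [Function.comp_apply, Equiv.trans_apply]
    have := (e (I a) ⟨a, rfl⟩).2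
    exact congrArg _ this.symm
  have hc := congrArg (MvPolynomial.coeff (d I₀)) hP
  simp only [P, MvPolynomial.coeff_sum, hmon, MvPolynomial.coeff_C_mul,
    MvPolynomial.coeff_monomial, MvPolynomial.coeff_zero] at hc
  have h2 : ∀ I, u I * (if d I = d I₀ then (1 : ℂ) else 0)
      = (if d I = d I₀ then (1 : ℂ) else 0) * u I₀ := fun I => by
    split_ifs with hI
    · obtain ⟨π, rfl⟩ := hperm I hI
      rw [hu π I₀, mul_comm]
    · simp
  simp only [h2, ← Finset.sum_mul, Finset.sum_boole] at hc
  rcases mul_eq_zero.1 hc with h0 | h0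
  · exfalso
    have : I₀ ∈ Finset.univ.filter (fun I => d I = d I₀) := by simp
    have h3 := Finset.card_pos.2 ⟨_, this⟩
    exact h3.ne' (by exact_mod_cast h0)
  · simpa using h0

/-! ### Weighted integrals over rays -/

/-- The unit sphere of `ℝⁿ`. -/
abbrev Sph (n : ℕ) : Type := Metric.sphere (0 : Rn n) 1

/-- The measure `dξ dt` on `S^{n-1} × ℝ`. -/
def rayMeasure (n : ℕ) : Measure (Sph n × ℝ) :=
  (volume : Measure (Rn n)).toSphere.prod volume

/-- Continuous functions of `(ξ, t)` of polynomial growth in `t`. -/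
def IsRayWeight {n : ℕ} (c : Sph n × ℝ → ℂ) : Prop :=
  Continuous c ∧ ∃ (C : ℝ) (N : ℕ), 0 ≤ C ∧ ∀ p, ‖c p‖ ≤ C * (1 + |p.2|) ^ N

lemma IsRayWeight.mul {n : ℕ} {c d : Sph n × ℝ → ℂ} (hc : IsRayWeight c) (hd : IsRayWeight d) :
    IsRayWeight (fun p => c p * d p) := by
  obtain ⟨hc, C, N, hC, h⟩ := hc
  obtain ⟨hd, D, M, hD, h'⟩ := hd
  refine ⟨hc.mul hd, C * D, N + M, by positivity, fun p => ?_⟩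
  rw [norm_mul, pow_add, mul_mul_mul_comm]
  exact mul_le_mul (h p) (h' p) (norm_nonneg _) (by positivity)

lemma isRayWeight_of_sphere {n : ℕ} {c : Rn n → ℂ} (hc : Continuous c) :
    IsRayWeight (fun p : Sph n × ℝ => c p.1) := by
  refine ⟨by fun_prop, ?_⟩
  obtain ⟨C, hC⟩ := (isCompact_sphere (0 : Rn n) 1).exists_bound_of_continuousOn hc.continuousOn
  refine ⟨max C 0, 0, le_max_right _ _, fun p => ?_⟩
  simpa using Or.inl (hC _ p.1.2)

lemma isRayWeight_pow {n : ℕ} (a : ℕ) :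
    IsRayWeight (fun p : Sph n × ℝ => (-(p.2 : ℂ)) ^ a) := by
  refine ⟨by fun_prop, 1, a, zero_le_one, fun p => ?_⟩
  rw [norm_pow, norm_neg, Complex.norm_real, Real.norm_eq_abs, one_mul]
  gcongr
  linarith

lemma integrable_rayMeasure_decay (n : ℕ) :
    Integrable (fun p : Sph n × ℝ => ((1 + |p.2|) ^ 2)⁻¹) (rayMeasure n) := by
  have h : Integrable (fun t : ℝ => ((1 + |t|) ^ 2)⁻¹) := by
    have := integrable_one_add_norm (E := ℝ) (μ := volume) (r := 2) (by simp)
    refine this.congr (Filter.Eventually.of_forall fun t => ?_)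
    simp only [Real.norm_eq_abs]
    rw [Real.rpow_neg (by positivity)]
    norm_cast
  exact h.comp_snd _

lemma exists_schwartz_ray_bound {n : ℕ} {F : Type*} [NormedAddCommGroup F] [NormedSpace ℝ F]
    (ψ : 𝓢(Rn n, F)) (N : ℕ) (R : ℝ) :
    ∃ C : ℝ, 0 ≤ C ∧ ∀ x : Rn n, ‖x‖ ≤ R → ∀ p : Sph n × ℝ,
      (1 + |p.2|) ^ N * ‖ψ (x + p.2 • (p.1 : Rn n))‖ ≤ C := by
  rcases lt_or_ge R 0 with hR | hR
  · exact ⟨0, le_rfl, fun x hx => absurd (norm_nonneg x) (by linarith)⟩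
  let C := 2 ^ N * ((Finset.Iic (N, 0)).sup fun m => SchwartzMap.seminorm ℝ m.1 m.2) ψ
  have hC : ∀ y, (1 + ‖y‖) ^ N * ‖ψ y‖ ≤ C := fun y => by
    simpa using SchwartzMap.one_add_le_sup_seminorm_apply (𝕜 := ℝ) (m := (N, 0)) le_rfl le_rfl ψ y
  refine ⟨(1 + R) ^ N * C, mul_nonneg (by positivity)
    (le_trans (by positivity) (hC 0)), fun x hx p => ?_⟩
  have h1 : 1 + |p.2| ≤ (1 + R) * (1 + ‖x + p.2 • (p.1 : Rn n)‖) := by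
    have h2 : |p.2| ≤ ‖x + p.2 • (p.1 : Rn n)‖ + ‖x‖ := by
      have : p.2 • (p.1 : Rn n) = (x + p.2 • (p.1 : Rn n)) - x := by abel
      have h3 : |p.2| = ‖p.2 • (p.1 : Rn n)‖ := by
        rw [norm_smul, Real.norm_eq_abs]; simp
      rw [h3]
      conv_lhs => rw [this]
      exact norm_sub_le _ _
    nlinarith [norm_nonneg (x + p.2 • (p.1 : Rn n))]
  calc (1 + |p.2|) ^ N * ‖ψ (x + p.2 • (p.1 : Rn n))‖
      ≤ ((1 + R) * (1 + ‖x + p.2 • (p.1 : Rn n)‖)) ^ N * ‖ψ (x + p.2 • (p.1 : Rn n))‖ := by gcongr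
    _ = (1 + R) ^ N * ((1 + ‖x + p.2 • (p.1 : Rn n)‖) ^ N * ‖ψ (x + p.2 • (p.1 : Rn n))‖) := by
        rw [mul_pow]; ring
    _ ≤ (1 + R) ^ N * C := by gcongr; exact hC _

/-- The weight `⟨x,ξ⟩^a (t + ⟨x,ξ⟩)^b c(ξ,t)`. -/
def rayWeight {n : ℕ} (a b : ℕ) (c : Sph n × ℝ → ℂ) (x : Rn n) (p : Sph n × ℝ) : ℂ :=
  ((inner ℝ x (p.1 : Rn n) : ℝ) : ℂ) ^ a * ((p.2 : ℂ) + ((inner ℝ x (p.1 : Rn n) : ℝ) : ℂ)) ^ b * c p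

lemma continuous_rayWeight {n : ℕ} (a b : ℕ) {c : Sph n × ℝ → ℂ} (hc : IsRayWeight c) (x : Rn n) :
    Continuous (rayWeight a b c x) := by
  have := hc.1
  unfold rayWeight
  fun_prop

lemma exists_rayWeight_bound {n : ℕ} (a b : ℕ) {c : Sph n × ℝ → ℂ} (hc : IsRayWeight c) {R : ℝ}
    (hR : 0 ≤ R) :
    ∃ (C : ℝ) (N : ℕ), 0 ≤ C ∧ ∀ x : Rn n, ‖x‖ ≤ R → ∀ p, ‖rayWeight a b c x p‖ ≤
      C * (1 + |p.2|) ^ N := by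
  obtain ⟨-, C, N, hC, h⟩ := hc
  refine ⟨R ^ a * (1 + R) ^ b * C, b + N, by positivity, fun x hx p => ?_⟩
  have h1 : |inner ℝ x (p.1 : Rn n)| ≤ R := by
    refine (abs_real_inner_le_norm _ _).trans ?_
    simpa using hx
  have h2 : ‖(p.2 : ℂ) + ((inner ℝ x (p.1 : Rn n) : ℝ) : ℂ)‖ ≤ (1 + R) * (1 + |p.2|) := by
    rw [← Complex.ofReal_add, Complex.norm_real, Real.norm_eq_abs]
    refine (abs_add_le _ _).trans ?_
    nlinarith [abs_nonneg p.2]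
  rw [rayWeight, norm_mul, norm_mul, norm_pow, norm_pow, Complex.norm_real, Real.norm_eq_abs]
  calc _ ≤ R ^ a * ((1 + R) * (1 + |p.2|)) ^ b * (C * (1 + |p.2|) ^ N) := by
        gcongr
        exact h p
    _ = _ := by rw [mul_pow, pow_add]; ring

lemma exists_ray_bound {n : ℕ} {F : Type*} [NormedAddCommGroup F] [NormedSpace ℝ F]
    (a b : ℕ) {c : Sph n × ℝ → ℂ} (hc : IsRayWeight c) (ψ : 𝓢(Rn n, F)) (R : ℝ) :
    ∃ C : ℝ, 0 ≤ C ∧ ∀ x : Rn n, ‖x‖ ≤ R → ∀ p : Sph n × ℝ,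
      ‖rayWeight a b c x p‖ * ‖ψ (x + p.2 • (p.1 : Rn n))‖ ≤ C * ((1 + |p.2|) ^ 2)⁻¹ := by
  rcases lt_or_ge R 0 with hR | hR
  · exact ⟨0, le_rfl, fun x hx => absurd (norm_nonneg x) (by linarith)⟩
  obtain ⟨C, N, hC, h⟩ := exists_rayWeight_bound a b hc hR
  obtain ⟨D, hD, h'⟩ := exists_schwartz_ray_bound ψ (N + 2) R
  refine ⟨C * D, by positivity, fun x hx p => ?_⟩
  have hp : 0 < (1 + |p.2|) ^ 2 := by positivity
  rw [← div_eq_mul_inv, le_div_iff₀ hp]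
  calc _ ≤ C * (1 + |p.2|) ^ N * ‖ψ (x + p.2 • (p.1 : Rn n))‖ * (1 + |p.2|) ^ 2 := by
        gcongr; exact h x hx p
    _ = C * ((1 + |p.2|) ^ (N + 2) * ‖ψ (x + p.2 • (p.1 : Rn n))‖) := by ring
    _ ≤ C * D := by gcongr; exact h' x hx p

/-- The integral `∫∫ ⟨x,ξ⟩^a (t + ⟨x,ξ⟩)^b c(ξ,t) ψ(x + tξ) dt dξ`. -/
def rayIntegral {n : ℕ} (a b : ℕ) (c : Sph n × ℝ → ℂ) (ψ : 𝓢(Rn n, ℂ)) (x : Rn n) : ℂ :=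
  ∫ p, rayWeight a b c x p * ψ (x + p.2 • (p.1 : Rn n)) ∂(rayMeasure n)

lemma integrable_ray {n : ℕ} (a b : ℕ) {c : Sph n × ℝ → ℂ} (hc : IsRayWeight c)
    (ψ : 𝓢(Rn n, ℂ)) (x : Rn n) :
    Integrable (fun p => rayWeight a b c x p * ψ (x + p.2 • (p.1 : Rn n))) (rayMeasure n) := by
  obtain ⟨C, -, h⟩ := exists_ray_bound a b hc ψ ‖x‖
  refine ((integrable_rayMeasure_decay n).const_mul C).mono' ?_
    (Filter.Eventually.of_forall fun p => ?_)
  · have := continuous_rayWeight a b hc x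
    have := ψ.continuous
    exact Continuous.aestronglyMeasurable (by fun_prop)
  · rw [norm_mul]; exact h x le_rfl p

/-- The real-linear functional `x ↦ ⟨x,ξ⟩` with complex values. -/
def innerCLM {n : ℕ} (ξ : Rn n) : Rn n →L[ℝ] ℂ := Complex.ofRealCLM.comp (innerSL ℝ ξ)

lemma innerCLM_apply {n : ℕ} (ξ x : Rn n) : innerCLM ξ x = ((inner ℝ x ξ : ℝ) : ℂ) := by
  simp [innerCLM, real_inner_comm]

lemma norm_innerCLM_le {n : ℕ} (ξ : Sph n) : ‖innerCLM (ξ : Rn n)‖ ≤ 1 := by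
  refine ContinuousLinearMap.opNorm_le_bound _ zero_le_one fun x => ?_
  rw [innerCLM_apply, Complex.norm_real, Real.norm_eq_abs, one_mul]
  refine (abs_real_inner_le_norm _ _).trans ?_
  simp

lemma continuous_innerCLM {n : ℕ} : Continuous (fun ξ : Rn n => innerCLM ξ) :=
  ((ContinuousLinearMap.compL ℝ (Rn n) ℝ ℂ Complex.ofRealCLM).continuous).comp
    (innerSL ℝ).continuous

/-- The derivative of the integrand of `rayIntegral`. -/
def rayIntegrandDeriv {n : ℕ} (a b : ℕ) (c : Sph n × ℝ → ℂ) (ψ : 𝓢(Rn n, ℂ)) (x : Rn n)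
    (p : Sph n × ℝ) : Rn n →L[ℝ] ℂ :=
  ((a * rayWeight (a - 1) b c x p + b * rayWeight a (b - 1) c x p) * ψ (x + p.2 • (p.1 : Rn n))) •
    innerCLM (p.1 : Rn n) +
  rayWeight a b c x p • SchwartzMap.fderivCLM ℝ (Rn n) ℂ ψ (x + p.2 • (p.1 : Rn n))

lemma hasFDerivAt_rayIntegrand {n : ℕ} (a b : ℕ) (c : Sph n × ℝ → ℂ) (ψ : 𝓢(Rn n, ℂ)) (x : Rn n)
    (p : Sph n × ℝ) :
    HasFDerivAt (fun y => rayWeight a b c y p * ψ (y + p.2 • (p.1 : Rn n)))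
      (rayIntegrandDeriv a b c ψ x p) x := by
  have h1 : HasFDerivAt (fun y : Rn n => ((inner ℝ y (p.1 : Rn n) : ℝ) : ℂ))
      (innerCLM (p.1 : Rn n)) x := by
    simpa only [← innerCLM_apply] using (innerCLM (p.1 : Rn n)).hasFDerivAt
  have h2 : HasFDerivAt (fun y : Rn n => ψ (y + p.2 • (p.1 : Rn n)))
      (fderiv ℝ ψ (x + p.2 • (p.1 : Rn n))) x :=
    (ψ.hasFDerivAt _).comp x ((hasFDerivAt_id x).add_const _)
  have h3 := (((h1.pow a).mul ((h1.const_add (p.2 : ℂ)).pow b)).mul_const (c p)).mul h2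
  convert! h3 using 1
  ext v
  simp [rayIntegrandDeriv, rayWeight, SchwartzMap.fderivCLM_apply]
  ring

lemma hasFDerivAt_rayIntegral {n : ℕ} (a b : ℕ) {c : Sph n × ℝ → ℂ} (hc : IsRayWeight c)
    (ψ : 𝓢(Rn n, ℂ)) (x : Rn n) :
    HasFDerivAt (rayIntegral a b c ψ) (∫ p, rayIntegrandDeriv a b c ψ x p ∂(rayMeasure n)) x ∧
      Integrable (rayIntegrandDeriv a b c ψ x) (rayMeasure n) := by
  obtain ⟨C₁, -, h₁⟩ := exists_ray_bound (a - 1) b hc ψ (‖x‖ + 1)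
  obtain ⟨C₂, -, h₂⟩ := exists_ray_bound a (b - 1) hc ψ (‖x‖ + 1)
  obtain ⟨C₃, -, h₃⟩ := exists_ray_bound a b hc (SchwartzMap.fderivCLM ℝ (Rn n) ℂ ψ) (‖x‖ + 1)
  have hmeas : AEStronglyMeasurable (rayIntegrandDeriv a b c ψ x) (rayMeasure n) := by
    have e1 := continuous_rayWeight a b hc x
    have e2 := continuous_rayWeight (a - 1) b hc x
    have e3 := continuous_rayWeight a (b - 1) hc x
    have e4 := ψ.continuous
    have e5 := (SchwartzMap.fderivCLM ℝ (Rn n) ℂ ψ).continuous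
    have e6 := continuous_innerCLM (n := n)
    have e7 : Continuous (rayIntegrandDeriv a b c ψ x) := by
      unfold rayIntegrandDeriv
      fun_prop
    exact e7.aestronglyMeasurable
  have hbound : ∀ p, ∀ y ∈ Metric.ball x 1, ‖rayIntegrandDeriv a b c ψ y p‖ ≤
      (a * C₁ + b * C₂ + C₃) * ((1 + |p.2|) ^ 2)⁻¹ := fun p y hy => by
    have hy' : ‖y‖ ≤ ‖x‖ + 1 := by
      have h1 := norm_sub_norm_le y x
      rw [Metric.mem_ball, dist_eq_norm] at hy
      linarith
    unfold rayIntegrandDeriv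
    refine (norm_add_le _ _).trans ?_
    rw [norm_smul, norm_smul, norm_mul]
    have g1 : ‖(a * rayWeight (a - 1) b c y p + b * rayWeight a (b - 1) c y p : ℂ)‖ ≤
        a * ‖rayWeight (a - 1) b c y p‖ + b * ‖rayWeight a (b - 1) c y p‖ := by
      refine (norm_add_le _ _).trans ?_
      simp
    have g2 := h₁ y hy' p
    have g3 := h₂ y hy' p
    have g4 := h₃ y hy' p
    calc _ ≤ (a * ‖rayWeight (a - 1) b c y p‖ + b * ‖rayWeight a (b - 1) c y p‖) *
          ‖ψ (y + p.2 • (p.1 : Rn n))‖ * 1 + ‖rayWeight a b c y p‖ *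
          ‖SchwartzMap.fderivCLM ℝ (Rn n) ℂ ψ (y + p.2 • (p.1 : Rn n))‖ := by
          gcongr
          exact norm_innerCLM_le p.1
      _ = a * (‖rayWeight (a - 1) b c y p‖ * ‖ψ (y + p.2 • (p.1 : Rn n))‖) +
          b * (‖rayWeight a (b - 1) c y p‖ * ‖ψ (y + p.2 • (p.1 : Rn n))‖) +
          ‖rayWeight a b c y p‖ *
          ‖SchwartzMap.fderivCLM ℝ (Rn n) ℂ ψ (y + p.2 • (p.1 : Rn n))‖ := by ring
      _ ≤ a * (C₁ * ((1 + |p.2|) ^ 2)⁻¹) + b * (C₂ * ((1 + |p.2|) ^ 2)⁻¹) +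
          C₃ * ((1 + |p.2|) ^ 2)⁻¹ := by gcongr
      _ = _ := by ring
  have h_int := (integrable_rayMeasure_decay n).const_mul (a * C₁ + b * C₂ + C₃)
  refine ⟨?_, h_int.mono' hmeas (Filter.Eventually.of_forall fun p =>
    hbound p x (Metric.mem_ball_self one_pos))⟩
  refine hasFDerivAt_integral_of_dominated_of_fderiv_le (Metric.ball_mem_nhds x one_pos)
    (Filter.Eventually.of_forall fun y => (integrable_ray a b hc ψ y).aestronglyMeasurable)
    (integrable_ray a b hc ψ x) hmeas (Filter.Eventually.of_forall hbound) h_int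
    (Filter.Eventually.of_forall fun p y _ => hasFDerivAt_rayIntegrand a b c ψ y p)

open LineDeriv in
lemma fderiv_rayIntegral {n : ℕ} (a b : ℕ) {c : Sph n × ℝ → ℂ} (hc : IsRayWeight c)
    (ψ : 𝓢(Rn n, ℂ)) (x v : Rn n) :
    fderiv ℝ (rayIntegral a b c ψ) x v =
      a * rayIntegral (a - 1) b (fun p => c p * ((inner ℝ v (p.1 : Rn n) : ℝ) : ℂ)) ψ x +
      b * rayIntegral a (b - 1) (fun p => c p * ((inner ℝ v (p.1 : Rn n) : ℝ) : ℂ)) ψ x +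
      rayIntegral a b c (∂_{v} ψ) x := by
  obtain ⟨h, hi⟩ := hasFDerivAt_rayIntegral a b hc ψ x
  have hc' : IsRayWeight (fun p : Sph n × ℝ => c p * ((inner ℝ v (p.1 : Rn n) : ℝ) : ℂ)) :=
    hc.mul (isRayWeight_of_sphere (c := fun ξ => ((inner ℝ v ξ : ℝ) : ℂ)) (by fun_prop))
  rw [h.fderiv, ContinuousLinearMap.integral_apply hi]
  unfold rayIntegral
  rw [← integral_const_mul, ← integral_const_mul,
    ← integral_add ((integrable_ray _ _ hc' _ _).const_mul _)
      ((integrable_ray _ _ hc' _ _).const_mul _)]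
  refine Eq.trans ?_ (integral_add (((integrable_ray (a - 1) b hc' ψ x).const_mul (a : ℂ)).add
    ((integrable_ray a (b - 1) hc' ψ x).const_mul (b : ℂ))) (integrable_ray a b hc (∂_{v} ψ) x))
  refine integral_congr_ae (Filter.Eventually.of_forall fun p => ?_)
  simp only [rayIntegrandDeriv, _root_.add_apply, _root_.smul_apply,
    innerCLM_apply, smul_eq_mul, SchwartzMap.fderivCLM_apply,
    SchwartzMap.lineDerivOp_apply_eq_fderiv, rayWeight]
  ring

lemma contDiff_rayIntegral {n : ℕ} (a b : ℕ) {c : Sph n × ℝ → ℂ} (hc : IsRayWeight c)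
    (ψ : 𝓢(Rn n, ℂ)) : ContDiff ℝ ∞ (rayIntegral a b c ψ) := by
  rw [contDiff_infty]
  intro k
  induction k generalizing a b c ψ with
  | zero =>
    rw [Nat.cast_zero, contDiff_zero]
    exact continuous_iff_continuousAt.2 fun x =>
      (hasFDerivAt_rayIntegral a b hc ψ x).1.continuousAt
  | succ k ih =>
    rw [Nat.cast_succ, contDiff_succ_iff_fderiv_apply]
    refine ⟨fun x => (hasFDerivAt_rayIntegral a b hc ψ x).1.differentiableAt, by simp, fun v => ?_⟩
    simp only [fderiv_rayIntegral a b hc ψ _ v]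
    have hc' : IsRayWeight (fun p : Sph n × ℝ => c p * ((inner ℝ v (p.1 : Rn n) : ℝ) : ℂ)) :=
      hc.mul (isRayWeight_of_sphere (c := fun ξ => ((inner ℝ v ξ : ℝ) : ℂ)) (by fun_prop))
    exact ((contDiff_const.mul (ih _ _ hc' _)).add (contDiff_const.mul (ih _ _ hc' _))).add
      (ih _ _ hc _)

/-! ### Moment fields and the normal operators -/

/-- The component `f_J` of a symmetric Schwartz tensor field. -/
def schwartzComp {n m : ℕ} (f : 𝓢(Rn n, SymTensor n m)) (J : Fin m → Fin n) : 𝓢(Rn n, ℂ) :=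
  SchwartzMap.postcompCLM ((ContinuousLinearMap.proj J : Tensor n m →L[ℂ] ℂ).comp
    (SymTensor n m).subtypeL) f

@[simp]
lemma schwartzComp_apply {n m : ℕ} (f : 𝓢(Rn n, SymTensor n m)) (J : Fin m → Fin n) (x : Rn n) :
    schwartzComp f J x = toField f x J := rfl

lemma isRayWeight_vecPow {n r : ℕ} (I : Fin r → Fin n) :
    IsRayWeight (fun p : Sph n × ℝ => vecPow (p.1 : Rn n) I) :=
  isRayWeight_of_sphere (continuous_vecPow I)

lemma isRayWeight_vecPow_mul {n r m : ℕ} (I : Fin r → Fin n) (J : Fin m → Fin n) :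
    IsRayWeight (fun p : Sph n × ℝ => vecPow (p.1 : Rn n) I * vecPow (p.1 : Rn n) J) :=
  (isRayWeight_vecPow I).mul (isRayWeight_vecPow J)

lemma sum_rayIntegral {n : ℕ} {ι : Type*} (s : Finset ι) (a b : ℕ) {c : ι → Sph n × ℝ → ℂ}
    (hc : ∀ i ∈ s, IsRayWeight (c i)) (ψ : 𝓢(Rn n, ℂ)) (x : Rn n) :
    ∑ i ∈ s, rayIntegral a b (c i) ψ x = rayIntegral a b (fun p => ∑ i ∈ s, c i p) ψ x := by
  unfold rayIntegral
  rw [← integral_finsetSum s fun i hi => integrable_ray a b (hc i hi) ψ x]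
  refine integral_congr_ae (Filter.Eventually.of_forall fun p => ?_)
  simp only [rayWeight, Finset.mul_sum, Finset.sum_mul]

lemma basisVec_apply {n : ℕ} (i j : Fin n) : basisVec i j = if j = i then 1 else 0 := by
  simp [basisVec]

lemma inner_basisVec_left {n : ℕ} (j : Fin n) (ξ : Rn n) : inner ℝ (basisVec j) ξ = ξ j := by
  simp [basisVec, EuclideanSpace.inner_single_left]

lemma sum_smul_basisVec {n : ℕ} (ξ : Rn n) : ∑ j, ξ j • basisVec j = ξ := by
  ext i
  simp [basisVec_apply]

lemma sum_sphere_sq {n : ℕ} (ξ : Sph n) :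
    ∑ j, (((ξ : Rn n) j : ℝ) : ℂ) * (((ξ : Rn n) j : ℝ) : ℂ) = 1 := by
  have h : ‖(ξ : Rn n)‖ ^ 2 = 1 := by simp
  rw [EuclideanSpace.norm_sq_eq] at h
  simp only [Real.norm_eq_abs, sq_abs] at h
  exact_mod_cast (by simpa [pow_two] using h)

open LineDeriv in
/-- Integration by parts along the rays. -/
lemma sum_rayIntegral_lineDeriv {n : ℕ} (a b : ℕ) {c : Rn n → ℂ} (hc : Continuous c)
    (ψ : 𝓢(Rn n, ℂ)) (x : Rn n) :
    ∑ j, rayIntegral a b (fun p => c p.1 * ((p.1 : Rn n) j : ℂ)) (∂_{basisVec j} ψ) x =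
      -(b * rayIntegral a (b - 1) (fun p => c p.1) ψ x) := by
  have hw := isRayWeight_of_sphere hc
  have hw' : ∀ j : Fin n, IsRayWeight (fun p : Sph n × ℝ => c p.1 * ((p.1 : Rn n) j : ℂ)) :=
    fun j => isRayWeight_of_sphere (c := fun ξ => c ξ * (ξ j : ℂ)) (by fun_prop)
  have hL : ∀ p : Sph n × ℝ, ∑ j, rayWeight a b (fun p => c p.1 * ((p.1 : Rn n) j : ℂ)) x p *
      (∂_{basisVec j} ψ) (x + p.2 • (p.1 : Rn n)) =
      rayWeight a b (fun p => c p.1) x p * fderiv ℝ ψ (x + p.2 • (p.1 : Rn n)) p.1 := fun p => by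
    conv_rhs => rw [← sum_smul_basisVec (p.1 : Rn n)]
    rw [map_sum, Finset.mul_sum]
    refine Finset.sum_congr rfl fun j _ => ?_
    rw [SchwartzMap.lineDerivOp_apply_eq_fderiv, sum_smul_basisVec, map_smul, Complex.real_smul]
    simp only [rayWeight]
    ring
  have hi1 : Integrable (fun p : Sph n × ℝ => rayWeight a b (fun p => c p.1) x p *
      fderiv ℝ ψ (x + p.2 • (p.1 : Rn n)) p.1) (rayMeasure n) := by
    simp only [← hL]
    exact integrable_finsetSum _ fun j _ => integrable_ray a b (hw' j) _ x
  have hi2 := (integrable_ray a (b - 1) hw ψ x).const_mul (b : ℂ)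
  have hi3 := integrable_ray a b hw ψ x
  unfold rayIntegral
  rw [← integral_finsetSum _ fun j _ => integrable_ray a b (hw' j) _ x]
  simp only [hL]
  rw [← integral_const_mul]
  unfold rayMeasure at *
  rw [integral_prod _ hi1, integral_prod _ hi2, ← integral_neg]
  refine integral_congr_ae ?_
  filter_upwards [hi1.prod_right_ae, hi2.prod_right_ae, hi3.prod_right_ae] with ξ h1 h2 h3
  have hd1 : ∀ t : ℝ, HasDerivAt (fun t : ℝ => rayWeight a b (fun p => c p.1) x (ξ, t))
      (b * rayWeight a (b - 1) (fun p => c p.1) x (ξ, t)) t := fun t => by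
    have e1 : HasDerivAt (fun t : ℝ => (t : ℂ) + ((inner ℝ x (ξ : Rn n) : ℝ) : ℂ)) 1 t :=
      Complex.ofRealCLM.hasDerivAt.add_const _
    have e2 := ((e1.pow b).const_mul (((inner ℝ x (ξ : Rn n) : ℝ) : ℂ) ^ a)).mul_const (c ξ)
    convert! e2 using 1
    simp only [rayWeight]
    ring
  have hd2 : ∀ t : ℝ, HasDerivAt (fun t : ℝ => ψ (x + t • (ξ : Rn n)))
      (fderiv ℝ ψ (x + t • (ξ : Rn n)) ξ) t := fun t => by
    have e1 : HasDerivAt (fun t : ℝ => x + t • (ξ : Rn n)) (ξ : Rn n) t := by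
      simpa using ((hasDerivAt_id t).smul_const (ξ : Rn n)).const_add x
    exact (ψ.hasFDerivAt _).comp_hasDerivAt t e1
  have := integral_mul_deriv_eq_deriv_mul_of_integrable
    (fun t _ => hd1 t) (fun t _ => hd2 t) h1 (h2.congr (Filter.Eventually.of_forall fun t => by
      simp only [Pi.mul_apply]; ring)) h3
  rw [this]
  congr 1
  refine integral_congr_ae (Filter.Eventually.of_forall fun t => ?_)
  simp only
  ring

/-- The tensor field `∫∫ ⟨x,ξ⟩^a (t + ⟨x,ξ⟩)^b ξ_I ⟨f(x + tξ), ξ^m⟩ dt dξ` of rank `r`. -/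
def momentField {n m : ℕ} (f : 𝓢(Rn n, SymTensor n m)) (a b r : ℕ) : Field n r := fun x I =>
  ∑ J, rayIntegral a b (fun p => vecPow (p.1 : Rn n) I * vecPow (p.1 : Rn n) J)
    (schwartzComp f J) x

lemma contDiff_momentField {n m : ℕ} (f : 𝓢(Rn n, SymTensor n m)) (a b r : ℕ) :
    ContDiff ℝ ∞ (momentField f a b r) :=
  contDiff_pi.2 fun I => ContDiff.sum fun J _ =>
    contDiff_rayIntegral a b (isRayWeight_vecPow_mul I J) _

lemma momentField_mem {n m : ℕ} (f : 𝓢(Rn n, SymTensor n m)) (a b r : ℕ) (x : Rn n) :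
    momentField f a b r x ∈ SymTensor n r := fun π I => by
  simp only [momentField, vecPow_perm]

lemma normalOp_eq_momentField {n m : ℕ} (f : 𝓢(Rn n, SymTensor n m)) (k : ℕ) :
    normalOp k (toField f) = momentField f k k m := by
  funext x I
  unfold momentField rayIntegral
  rw [← integral_finsetSum _ fun J _ => integrable_ray k k (isRayWeight_vecPow_mul I J) _ x]
  have hi := integrable_finsetSum (Finset.univ : Finset (Fin m → Fin n))
    fun J _ => integrable_ray k k (isRayWeight_vecPow_mul I J) (schwartzComp f J) x
  unfold rayMeasure at *
  rw [integral_prod _ hi]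
  unfold normalOp rayAdjoint
  refine integral_congr_ae (Filter.Eventually.of_forall fun ξ => ?_)
  simp only [rayTransform]
  rw [← integral_add_right_eq_self _ (inner ℝ x (ξ : Rn n)), ← integral_const_mul]
  refine integral_congr_ae (Filter.Eventually.of_forall fun t => ?_)
  simp only [Finset.mul_sum]
  refine Finset.sum_congr rfl fun J _ => ?_
  have : x - inner ℝ x (ξ : Rn n) • (ξ : Rn n) + (t + inner ℝ x (ξ : Rn n)) • (ξ : Rn n) =
      x + t • (ξ : Rn n) := by rw [add_smul]; abel
  rw [this]
  simp only [rayWeight, schwartzComp_apply]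
  push_cast
  ring

lemma isSmoothSym_normalOp {n m : ℕ} (f : 𝓢(Rn n, SymTensor n m)) (k : ℕ) :
    IsSmoothSym (normalOp k (toField f)) := by
  rw [normalOp_eq_momentField]
  exact ⟨contDiff_momentField f k k m, momentField_mem f k k m⟩

lemma opJx_momentField {n m : ℕ} (f : 𝓢(Rn n, SymTensor n m)) (a b r : ℕ) :
    opJx (momentField f a b (r + 1)) = momentField f (a + 1) b r := by
  funext x I
  simp only [opJx, contract, momentField, Finset.sum_mul]
  rw [Finset.sum_comm]
  refine Finset.sum_congr rfl fun J _ => ?_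
  unfold rayIntegral
  simp only [← integral_mul_const]
  rw [← integral_finsetSum _ fun K _ =>
    (integrable_ray a b (isRayWeight_vecPow_mul _ J) _ x).mul_const _]
  refine integral_congr_ae (Filter.Eventually.of_forall fun p => ?_)
  simp only [rayWeight, vecPow_append]
  rw [pow_succ, ← sum_vecTensor]
  simp only [Finset.mul_sum, Finset.sum_mul]
  exact Finset.sum_congr rfl fun K _ => by ring

lemma opJ_momentField {n m : ℕ} (f : 𝓢(Rn n, SymTensor n m)) (a b r : ℕ) :
    opJ (momentField f a b (r + 2)) = momentField f a b r := by
  funext x I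
  simp only [opJ, contract, momentField, Finset.sum_mul]
  rw [Finset.sum_comm]
  refine Finset.sum_congr rfl fun J _ => ?_
  unfold rayIntegral
  simp only [← integral_mul_const]
  rw [← integral_finsetSum _ fun K _ =>
    (integrable_ray a b (isRayWeight_vecPow_mul _ J) _ x).mul_const _]
  refine integral_congr_ae (Filter.Eventually.of_forall fun p => ?_)
  have h := sum_kronecker (p.1 : Rn n)
  simp only [norm_eq_of_mem_sphere, one_pow, Complex.ofReal_one] at h
  simp only [rayWeight, vecPow_append]
  trans ((inner ℝ x (p.1 : Rn n) : ℝ) : ℂ) ^ a *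
    ((p.2 : ℂ) + ((inner ℝ x (p.1 : Rn n) : ℝ) : ℂ)) ^ b * (vecPow (p.1 : Rn n) I *
    (∑ K : Fin 2 → Fin n, vecPow (p.1 : Rn n) K * kronecker n K) * vecPow (p.1 : Rn n) J) *
    schwartzComp f J (x + p.2 • (p.1 : Rn n))
  · simp only [Finset.mul_sum, Finset.sum_mul]
    exact Finset.sum_congr rfl fun K _ => by ring
  · rw [h, mul_one]

lemma divergence_momentField {n m : ℕ} (f : 𝓢(Rn n, SymTensor n m)) (a b r : ℕ) :
    divergence (momentField f (a + 1) b (r + 1)) =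
      fun x I => ((a + 1 : ℕ) : ℂ) * momentField f a b r x I := by
  funext x I
  have hd : ∀ j J, DifferentiableAt ℝ (rayIntegral (a + 1) b (fun p => vecPow (p.1 : Rn n)
      (Fin.snoc I j : Fin (r + 1) → Fin n) * vecPow (p.1 : Rn n) J) (schwartzComp f J)) x :=
    fun j J => (hasFDerivAt_rayIntegral _ _ (isRayWeight_vecPow_mul _ J) _ x).1.differentiableAt
  simp only [divergence, pderiv, momentField]
  have h1 : ∀ j, fderiv ℝ (fun y => ∑ J, rayIntegral (a + 1) b (fun p => vecPow (p.1 : Rn n)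
      (Fin.snoc I j : Fin (r + 1) → Fin n) * vecPow (p.1 : Rn n) J) (schwartzComp f J) y) x
      (basisVec j) = ∑ J, fderiv ℝ (rayIntegral (a + 1) b (fun p => vecPow (p.1 : Rn n)
      (Fin.snoc I j : Fin (r + 1) → Fin n) * vecPow (p.1 : Rn n) J) (schwartzComp f J)) x
      (basisVec j) := fun j => by
    rw [fderiv_fun_sum fun J _ => hd j J]
    simp
  simp only [h1]
  rw [Finset.sum_comm, Finset.mul_sum]
  refine Finset.sum_congr rfl fun J _ => ?_
  simp only [fderiv_rayIntegral _ _ (isRayWeight_vecPow_mul _ J)]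
  simp only [inner_basisVec_left, vecPow_snoc, Finset.sum_add_distrib, ← Finset.mul_sum,
    Nat.add_sub_cancel]
  have hc : Continuous (fun ξ : Rn n => vecPow ξ I * vecPow ξ J) :=
    (continuous_vecPow I).mul (continuous_vecPow J)
  have h2 : ∀ a b, ∑ j, rayIntegral a b (fun p => vecPow (p.1 : Rn n) I * ((p.1 : Rn n) j : ℂ) *
      vecPow (p.1 : Rn n) J * ((p.1 : Rn n) j : ℂ)) (schwartzComp f J) x =
      rayIntegral a b (fun p => vecPow (p.1 : Rn n) I * vecPow (p.1 : Rn n) J)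
        (schwartzComp f J) x := fun a b => by
    have hI := continuous_vecPow (n := n) I
    have hJ := continuous_vecPow (n := n) J
    rw [sum_rayIntegral _ _ _ fun j _ => isRayWeight_of_sphere (c := fun ξ : Rn n =>
      vecPow ξ I * (ξ j : ℂ) * vecPow ξ J * (ξ j : ℂ)) (by fun_prop)]
    congr 1
    funext p
    rw [← mul_one (vecPow (p.1 : Rn n) I * vecPow (p.1 : Rn n) J), ← sum_sphere_sq p.1,
      Finset.mul_sum]
    exact Finset.sum_congr rfl fun j _ => by ring
  have h3 := sum_rayIntegral_lineDeriv (a + 1) b hc (schwartzComp f J) x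
  have h4 : ∀ (p : Sph n × ℝ) j, vecPow (p.1 : Rn n) I * ((p.1 : Rn n) j : ℂ) *
      vecPow (p.1 : Rn n) J =
      vecPow (p.1 : Rn n) I * vecPow (p.1 : Rn n) J * ((p.1 : Rn n) j : ℂ) := fun p j => by ring
  rw [h2, h2]
  simp only [h4, h3]
  ring

/-! ### The operators `D_{m,n}^k` on the normal operators -/

lemma divergence_const_mul {n m : ℕ} {g : Field n (m + 1)} (hg : ContDiff ℝ ∞ g) (c : ℂ) :
    divergence (fun x I => c * g x I) = fun x I => c * divergence g x I := by
  funext x I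
  simp only [divergence, pderiv, Finset.mul_sum]
  refine Finset.sum_congr rfl fun j _ => ?_
  rw [fderiv_const_mul ((contDiff_pi.1 hg _).differentiable (by simp) x)]
  simp

lemma opJx_const_mul {n m : ℕ} (g : Field n (m + 1)) (c : ℂ) :
    opJx (fun x I => c * g x I) = fun x I => c * opJx g x I := by
  funext x I
  simp only [opJx, contract, Finset.mul_sum, mul_assoc]

lemma opJ_const_mul {n m : ℕ} (g : Field n (m + 2)) (c : ℂ) :
    opJ (fun x I => c * g x I) = fun x I => c * opJ g x I := by
  funext x I
  simp only [opJ, contract, Finset.mul_sum, mul_assoc]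

lemma divergencePow_momentField {n m : ℕ} (f : 𝓢(Rn n, SymTensor n m)) (b r k : ℕ) (c : ℂ) :
    divergencePow k (fun x I => c * momentField f k b (r + k) x I) =
      fun x I => c * (k ! : ℂ) * momentField f 0 b r x I := by
  induction k generalizing c with
  | zero => simp [divergencePow]
  | succ k ih =>
    have h1 : divergence (fun x I => c * momentField f (k + 1) b (r + k + 1) x I) =
        fun x I => (c * ((k + 1 : ℕ) : ℂ)) * momentField f k b (r + k) x I := by
      rw [divergence_const_mul (contDiff_momentField f _ _ _), divergence_momentField]
      simp only [mul_assoc]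
    change divergencePow k (divergence (fun x I => c * momentField f (k + 1) b (r + k + 1) x I)) = _
    rw [h1, ih]
    simp only [Nat.factorial_succ, Nat.cast_mul, mul_assoc]

lemma opJxPow_momentField {n m : ℕ} (f : 𝓢(Rn n, SymTensor n m)) (a b r k : ℕ) (c : ℂ) :
    opJxPow k (fun x I => c * momentField f a b (r + k) x I) =
      fun x I => c * momentField f (a + k) b r x I := by
  induction k generalizing a with
  | zero => simp [opJxPow]
  | succ k ih =>
    change opJxPow k (opJx (fun x I => c * momentField f a b (r + k + 1) x I)) = _
    rw [opJx_const_mul, opJx_momentField, ih, Nat.add_right_comm, Nat.add_assoc]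

lemma opJPow_momentField {n m : ℕ} (f : 𝓢(Rn n, SymTensor n m)) (a b r k : ℕ) (c : ℂ) :
    opJPow k (fun x I => c * momentField f a b (r + 2 * k) x I) =
      fun x I => c * momentField f a b r x I := by
  induction k with
  | zero => simp [opJPow]
  | succ k ih =>
    change opJPow k (opJ (fun x I => c * momentField f a b (r + 2 * k + 2) x I)) = _
    rw [opJ_const_mul, opJ_momentField, ih]

lemma castRank_self {n a : ℕ} (g : Field n a) : castRank a g = g := by
  funext x I
  simp only [castRank, dif_pos]
  rfl

lemma castRank_momentField {n m : ℕ} (f : 𝓢(Rn n, SymTensor n m)) (a b : ℕ) {r s : ℕ} (h : r = s) :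
    castRank s (momentField f a b r) = momentField f a b s := by
  subst h; exact castRank_self _

lemma tensorEval_castRank {n a b : ℕ} (h : a = b) (g : Field n a) (x η : Rn n) :
    tensorEval (castRank b g x) η = tensorEval (g x) η := by
  subst h; rw [castRank_self]

/-- The derivative in the direction `η`. -/
def dirDeriv {n : ℕ} (η : Rn n) (h : Rn n → ℂ) : Rn n → ℂ := fun x => fderiv ℝ h x η

lemma contDiff_dirDeriv {n : ℕ} (η : Rn n) {h : Rn n → ℂ} (hh : ContDiff ℝ ∞ h) :
    ContDiff ℝ ∞ (dirDeriv η h) :=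
  (hh.fderiv_right (m := ∞) (by simp)).clm_apply contDiff_const

lemma dirDeriv_iterate_sum {n : ℕ} {ι : Type*} (s : Finset ι) (η : Rn n) (r : ℕ) (c : ι → ℂ)
    {h : ι → Rn n → ℂ} (hh : ∀ i ∈ s, ContDiff ℝ ∞ (h i)) :
    (dirDeriv η)^[r] (fun x => ∑ i ∈ s, c i * h i x) =
      fun x => ∑ i ∈ s, c i * (dirDeriv η)^[r] (h i) x := by
  induction r generalizing h with
  | zero => simp
  | succ r ih =>
    simp only [Function.iterate_succ, Function.comp_apply]
    rw [← ih fun i hi => contDiff_dirDeriv η (hh i hi)]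
    congr 1
    funext x
    have hd : ∀ i ∈ s, DifferentiableAt ℝ (h i) x := fun i hi =>
      (hh i hi).differentiable (by simp) x
    rw [dirDeriv, fderiv_fun_sum fun i hi => (hd i hi).const_mul (c i)]
    simp only [_root_.sum_apply, dirDeriv]
    refine Finset.sum_congr rfl fun i hi => ?_
    rw [fderiv_const_mul (hd i hi)]
    simp

lemma dirDeriv_iterate_const_mul {n : ℕ} (η : Rn n) (r : ℕ) (c : ℂ)
    {h : Rn n → ℂ} (hh : ContDiff ℝ ∞ h) :
    (dirDeriv η)^[r] (fun x => c * h x) = fun x => c * (dirDeriv η)^[r] h x := by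
  simpa using dirDeriv_iterate_sum (Finset.univ : Finset Unit) η r (fun _ => c)
    (h := fun _ => h) (fun _ _ => hh)

open LineDeriv in
lemma dirDeriv_iterate_rayIntegral {n : ℕ} (η : Rn n) (r : ℕ) {c : Sph n × ℝ → ℂ}
    (hc : IsRayWeight c) (ψ : 𝓢(Rn n, ℂ)) :
    (dirDeriv η)^[r] (rayIntegral 0 0 c ψ) =
      rayIntegral 0 0 c ((fun χ : 𝓢(Rn n, ℂ) => (∂_{η} χ : 𝓢(Rn n, ℂ)))^[r] ψ) := by
  induction r generalizing ψ with
  | zero => rfl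
  | succ r ih =>
    simp only [Function.iterate_succ, Function.comp_apply]
    rw [← ih]
    congr 1
    funext x
    rw [dirDeriv, fderiv_rayIntegral 0 0 hc]
    simp

lemma contDiff_pderiv {n m : ℕ} (j : Fin n) {g : Field n m} (hg : ContDiff ℝ ∞ g) :
    ContDiff ℝ ∞ (pderiv j g) :=
  contDiff_pi.2 fun I => ((contDiff_pi.1 hg I).fderiv_right (m := ∞) (by simp)).clm_apply
    contDiff_const

lemma contDiff_innerDeriv {n m : ℕ} {g : Field n m} (hg : ContDiff ℝ ∞ g) :
    ContDiff ℝ ∞ (innerDeriv g) :=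
  contDiff_pi.2 fun _ => contDiff_const.mul (ContDiff.sum fun _ _ =>
    contDiff_pi.1 (contDiff_pderiv _ hg) _)

lemma contDiff_innerDerivPow {n m : ℕ} {g : Field n m} (hg : ContDiff ℝ ∞ g) (r : ℕ) :
    ContDiff ℝ ∞ (innerDerivPow r g) := by
  induction r with
  | zero => exact hg
  | succ r ih => exact contDiff_innerDeriv ih

lemma contDiff_opI {n m : ℕ} {g : Field n m} (hg : ContDiff ℝ ∞ g) : ContDiff ℝ ∞ (opI g) :=
  contDiff_pi.2 fun _ => contDiff_const.mul (ContDiff.sum fun _ _ =>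
    (contDiff_pi.1 hg _).mul contDiff_const)

lemma contDiff_opIPow {n m : ℕ} {g : Field n m} (hg : ContDiff ℝ ∞ g) (r : ℕ) :
    ContDiff ℝ ∞ (opIPow r g) := by
  induction r with
  | zero => exact hg
  | succ r ih => exact contDiff_opI ih

lemma tensorEval_innerDeriv {n m : ℕ} {g : Field n m} (hg : ContDiff ℝ ∞ g) (x η : Rn n) :
    tensorEval (innerDeriv g x) η = dirDeriv η (fun y => tensorEval (g y) η) x := by
  have hd : ∀ I, DifferentiableAt ℝ (fun y => g y I) x := fun I =>
    (contDiff_pi.1 hg I).differentiable (by simp) x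
  unfold innerDeriv
  rw [tensorEval_symmetrize, dirDeriv]
  simp only [tensorEval]
  rw [fderiv_fun_sum fun I _ => (hd I).mul_const _, ← (Fin.snocEquiv fun _ => Fin n).sum_comp,
    Fintype.sum_prod_type, Finset.sum_comm]
  simp only [_root_.sum_apply]
  refine Finset.sum_congr rfl fun I _ => ?_
  rw [fderiv_mul_const (hd I)]
  conv_rhs => rw [← sum_smul_basisVec η]
  rw [map_sum]
  refine Finset.sum_congr rfl fun j _ => ?_
  simp only [Fin.snocEquiv, Equiv.coe_fn_mk, Fin.snoc_last, Fin.init_snoc, map_smul]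
  rw [vecPow_snoc, sum_smul_basisVec]
  simp [pderiv]
  ring

lemma tensorEval_innerDerivPow {n m : ℕ} {g : Field n m} (hg : ContDiff ℝ ∞ g) (η : Rn n) (r : ℕ) :
    (fun x => tensorEval (innerDerivPow r g x) η) =
      (dirDeriv η)^[r] (fun y => tensorEval (g y) η) := by
  induction r with
  | zero => rfl
  | succ r ih =>
    rw [Function.iterate_succ_apply', ← ih]
    funext x
    exact tensorEval_innerDeriv (contDiff_innerDerivPow hg r) x η

lemma tensorEval_opI {n m : ℕ} (g : Field n m) (x η : Rn n) :
    tensorEval (opI g x) η = ((‖η‖ ^ 2 : ℝ) : ℂ) * tensorEval (g x) η := by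
  rw [opI, symMul, tensorEval_symmetrize, tensorEval_tensorProd, mul_comm, ← sum_kronecker,
    tensorEval]
  simp only [mul_comm]

lemma tensorEval_opIPow {n m : ℕ} (g : Field n m) (x η : Rn n) (r : ℕ) :
    tensorEval (opIPow r g x) η = ((‖η‖ ^ 2 : ℝ) : ℂ) ^ r * tensorEval (g x) η := by
  induction r with
  | zero => simp [opIPow]
  | succ r ih =>
    rw [pow_succ', mul_assoc, ← ih]
    exact tensorEval_opI _ x η

/-- The weight `⟨ξ,η⟩^b ξ_J`. -/
def evalWeight {n m : ℕ} (η : Rn n) (b : ℕ) (J : Fin m → Fin n) (ξ : Rn n) : ℂ :=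
  ((inner ℝ ξ η : ℝ) : ℂ) ^ b * vecPow ξ J

lemma continuous_evalWeight {n m : ℕ} (η : Rn n) (b : ℕ) (J : Fin m → Fin n) :
    Continuous (evalWeight η b J) := by
  have := continuous_vecPow J
  unfold evalWeight
  fun_prop

lemma isRayWeight_evalWeight {n m : ℕ} (η : Rn n) (b : ℕ) (J : Fin m → Fin n) :
    IsRayWeight (fun p : Sph n × ℝ => evalWeight η b J p.1) :=
  isRayWeight_of_sphere (continuous_evalWeight η b J)

lemma tensorEval_momentField {n m : ℕ} (f : 𝓢(Rn n, SymTensor n m)) (a b r : ℕ) (x η : Rn n) :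
    tensorEval (momentField f a b r x) η =
      ∑ J, rayIntegral a b (fun p => evalWeight η r J p.1) (schwartzComp f J) x := by
  simp only [tensorEval, momentField, Finset.sum_mul]
  rw [Finset.sum_comm]
  refine Finset.sum_congr rfl fun J _ => ?_
  unfold rayIntegral
  simp only [← integral_mul_const]
  rw [← integral_finsetSum _ fun K _ =>
    (integrable_ray a b (isRayWeight_vecPow_mul _ J) _ x).mul_const _]
  refine integral_congr_ae (Filter.Eventually.of_forall fun p => ?_)
  simp only [rayWeight, evalWeight]
  rw [← sum_vecPow_mul_vecPow (p.1 : Rn n) η]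
  simp only [Finset.mul_sum, Finset.sum_mul]
  exact Finset.sum_congr rfl fun K _ => by ring

lemma tensorEval_termD_normalOp {n m : ℕ} (f : 𝓢(Rn n, SymTensor n m)) {k p q : ℕ}
    (h₁ : k + q ≤ p) (h₂ : p + q ≤ m) (x η : Rn n) :
    tensorEval (termD k p q (normalOp k (toField f)) x) η =
      (k ! : ℂ) * ((‖η‖ ^ 2 : ℝ) : ℂ) ^ q * ∑ J, (dirDeriv η)^[p - q]
        (rayIntegral (p - k - q) k (fun p' => evalWeight η (m - p - q) J p'.1)
          (schwartzComp f J)) x := by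
  have e1 : (divergencePow k (castRank ((m - p - q) + 2 * q + (p - k - q) + k)
      (normalOp k (toField f)))) = fun x I => (k ! : ℂ) *
        momentField f 0 k ((m - p - q) + 2 * q + (p - k - q)) x I := by
    rw [normalOp_eq_momentField, castRank_momentField f k k (by omega)]
    simpa using divergencePow_momentField f k ((m - p - q) + 2 * q + (p - k - q)) k 1
  unfold termD
  rw [tensorEval_castRank (by omega), e1, opJxPow_momentField, opJPow_momentField, zero_add]
  have hs : ContDiff ℝ ∞ (fun (x : Rn n) (I : Fin (m - p - q) → Fin n) =>
      (k ! : ℂ) * momentField f (p - k - q) k (m - p - q) x I) :=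
    contDiff_pi.2 fun I => contDiff_const.mul (contDiff_pi.1 (contDiff_momentField _ _ _ _) I)
  have e2 := congrFun (tensorEval_innerDerivPow (contDiff_opIPow hs q) η (p - q)) x
  refine e2.trans ?_
  have e3 : (fun y => tensorEval (opIPow q (fun (x : Rn n) (I : Fin (m - p - q) → Fin n) =>
      (k ! : ℂ) * momentField f (p - k - q) k (m - p - q) x I) y) η) =
      fun y => ∑ J, ((k ! : ℂ) * ((‖η‖ ^ 2 : ℝ) : ℂ) ^ q) * rayIntegral (p - k - q) k
        (fun p' => evalWeight η (m - p - q) J p'.1) (schwartzComp f J) y := by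
    funext y
    rw [tensorEval_opIPow, ← Finset.mul_sum, ← tensorEval_momentField]
    simp only [tensorEval, mul_assoc, ← Finset.mul_sum]
    ring
  rw [e3, dirDeriv_iterate_sum _ _ _ _ fun J _ =>
    contDiff_rayIntegral _ _ (isRayWeight_evalWeight η _ J) _, Finset.mul_sum]

lemma sum_opD_index (m : ℕ) (X : ℕ → ℕ → ℕ → ℂ) :
    ∑ k ∈ Finset.range (m + 1), ∑ p ∈ Finset.Icc k m,
      ∑ q ∈ Finset.range (min p (min (m - p) (p - k)) + 1), X k p q =
    ∑ a ∈ Finset.range (m + 1), ∑ q ∈ Finset.range ((m - a) / 2 + 1),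
      ∑ k ∈ Finset.range (a + 1), X k (a + q) q := by
  simp only [Finset.sum_sigma']
  refine Finset.sum_nbij' (fun z => ⟨z.2.1 - z.2.2, z.2.2, z.1⟩)
    (fun z => ⟨z.2.2, z.1 + z.2.1, z.2.1⟩) ?_ ?_ ?_ ?_ ?_
  · rintro ⟨k, p, q⟩ h
    simp only [Finset.mem_sigma, Finset.mem_range, Finset.mem_Icc] at h ⊢
    omega
  · rintro ⟨a, q, k⟩ h
    simp only [Finset.mem_sigma, Finset.mem_range, Finset.mem_Icc] at h ⊢
    omega
  · rintro ⟨k, p, q⟩ h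
    simp only [Finset.mem_sigma, Finset.mem_range, Finset.mem_Icc] at h
    have : p - q + q = p := by omega
    simp only [this]
  · rintro ⟨a, q, k⟩ h
    simp
  · rintro ⟨k, p, q⟩ h
    simp only [Finset.mem_sigma, Finset.mem_range, Finset.mem_Icc] at h
    have : p - q + q = p := by omega
    simp only [this]

/-- The binomial theorem for the weights `⟨x,ξ⟩^{a-k} (t + ⟨x,ξ⟩)^k`. -/
lemma sum_rayIntegral_binomial {n : ℕ} (a : ℕ) {c : Sph n × ℝ → ℂ} (hc : IsRayWeight c)
    (ψ : 𝓢(Rn n, ℂ)) (x : Rn n) :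
    ∑ k ∈ Finset.range (a + 1), ((-1) ^ k / ((k ! : ℂ) * ((a - k)! : ℂ))) *
      rayIntegral (a - k) k c ψ x =
    (a ! : ℂ)⁻¹ * rayIntegral 0 0 (fun p => (-(p.2 : ℂ)) ^ a * c p) ψ x := by
  unfold rayIntegral
  simp only [← integral_const_mul]
  rw [← integral_finsetSum _ fun k _ => (integrable_ray (a - k) k hc ψ x).const_mul _]
  refine integral_congr_ae (Filter.Eventually.of_forall fun p => ?_)
  simp only [rayWeight, pow_zero, one_mul]
  have h1 : -(p.2 : ℂ) = -((p.2 : ℂ) + ((inner ℝ x (p.1 : Rn n) : ℝ) : ℂ)) +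
    ((inner ℝ x (p.1 : Rn n) : ℝ) : ℂ) := by ring
  rw [h1, add_pow]
  simp only [Finset.mul_sum, Finset.sum_mul]
  refine Finset.sum_congr rfl fun k hk => ?_
  rw [Nat.cast_choose ℂ (Nat.lt_succ_iff.1 (Finset.mem_range.1 hk)),
    neg_pow ((p.2 : ℂ) + ((inner ℝ x (p.1 : Rn n) : ℝ) : ℂ))]
  have h2 : (a ! : ℂ) ≠ 0 := by exact_mod_cast (Nat.factorial_pos a).ne'
  field_simp

/-- The factor `(-1)^k (k!)² c_{m,n}^k`, which does not depend on `k`. -/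
def coeffC₀ (m n : ℕ) : ℝ :=
  (2 : ℝ) ^ ((m : ℤ) - 2) * Real.Gamma ((2 * (m : ℝ) + n - 1) / 2) /
    (Real.pi ^ (((n : ℝ) + 1) / 2) * ((n + 2 * m - 3)‼ : ℕ))

/-- The field `∑_k D_{m,n}^k N_m^k f`. -/
def sumField {n m : ℕ} (f : 𝓢(Rn n, SymTensor n m)) : Field n m := fun x I =>
  ∑ k ∈ Finset.range (m + 1), opD m n k (normalOp k (toField f)) x I

open LineDeriv in
/-- The derivative in the direction `η` of a Schwartz function. -/
abbrev schwartzDeriv {n : ℕ} (η : Rn n) (χ : 𝓢(Rn n, ℂ)) : 𝓢(Rn n, ℂ) := ∂_{η} χ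

lemma tensorEval_sumField {n m : ℕ} (f : 𝓢(Rn n, SymTensor n m)) (x η : Rn n) :
    tensorEval (sumField f x) η =
      (coeffC₀ m n : ℂ) * ∑ a ∈ Finset.range (m + 1), ∑ q ∈ Finset.range ((m - a) / 2 + 1),
        (((n + 2 * (m - a - q) - 3)‼ : ℕ) : ℂ) * ((-1) ^ q /
          (2 ^ q * (q ! : ℂ) * ((m - a - 2 * q)! : ℂ) * (a ! : ℂ))) * ((‖η‖ ^ 2 : ℝ) : ℂ) ^ q *
        ∑ J, rayIntegral 0 0 (fun p => (-(p.2 : ℂ)) ^ a * evalWeight η (m - a - 2 * q) J p.1)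
          ((schwartzDeriv η)^[a] (schwartzComp f J)) x := by
  have h1 : tensorEval (sumField f x) η = ∑ k ∈ Finset.range (m + 1), ∑ p ∈ Finset.Icc k m,
      ∑ q ∈ Finset.range (min p (min (m - p) (p - k)) + 1), (coeffC m n k : ℂ) *
        (((n + 2 * m - 2 * p - 3)‼ : ℕ) : ℂ) * ((-1 : ℂ) ^ q /
        (2 ^ q * (q ! : ℂ) * ((m - p - q)! : ℂ) * ((p - k - q)! : ℂ))) *
        tensorEval (termD k p q (normalOp k (toField f)) x) η := by
    simp only [tensorEval, sumField, opD, Finset.sum_mul, Finset.mul_sum]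
    rw [Finset.sum_comm]
    refine Finset.sum_congr rfl fun k _ => ?_
    rw [Finset.sum_comm]
    refine Finset.sum_congr rfl fun p _ => ?_
    rw [Finset.sum_comm]
    refine Finset.sum_congr rfl fun q _ => Finset.sum_congr rfl fun I _ => ?_
    ring
  rw [h1, sum_opD_index m (fun k p q => (coeffC m n k : ℂ) *
        (((n + 2 * m - 2 * p - 3)‼ : ℕ) : ℂ) * ((-1 : ℂ) ^ q /
        (2 ^ q * (q ! : ℂ) * ((m - p - q)! : ℂ) * ((p - k - q)! : ℂ))) *
        tensorEval (termD k p q (normalOp k (toField f)) x) η), Finset.mul_sum]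
  refine Finset.sum_congr rfl fun a ha => ?_
  rw [Finset.mul_sum]
  refine Finset.sum_congr rfl fun q hq => ?_
  rw [Finset.mem_range] at ha hq
  have hk : ∀ k ∈ Finset.range (a + 1), (coeffC m n k : ℂ) *
        (((n + 2 * m - 2 * (a + q) - 3)‼ : ℕ) : ℂ) * ((-1 : ℂ) ^ q /
        (2 ^ q * (q ! : ℂ) * ((m - (a + q) - q)! : ℂ) * ((a + q - k - q)! : ℂ))) *
        tensorEval (termD k (a + q) q (normalOp k (toField f)) x) η =
      ((coeffC₀ m n : ℂ) * ((((n + 2 * (m - a - q) - 3)‼ : ℕ) : ℂ) * ((-1) ^ q /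
          (2 ^ q * (q ! : ℂ) * ((m - a - 2 * q)! : ℂ))) * ((‖η‖ ^ 2 : ℝ) : ℂ) ^ q)) *
        ∑ J, (-1) ^ k / ((k ! : ℂ) * ((a - k)! : ℂ)) * (dirDeriv η)^[a] (rayIntegral (a - k) k
          (fun p => evalWeight η (m - a - 2 * q) J p.1) (schwartzComp f J)) x := fun k hk => by
    rw [Finset.mem_range] at hk
    rw [tensorEval_termD_normalOp f (by omega) (by omega), ← Finset.mul_sum]
    have e1 : a + q - q = a := by omega
    have e2 : a + q - k - q = a - k := by omega
    have e3 : m - (a + q) - q = m - a - 2 * q := by omega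
    have e4 : n + 2 * m - 2 * (a + q) - 3 = n + 2 * (m - a - q) - 3 := by omega
    have e5 : (coeffC m n k : ℂ) = (-1) ^ k / (k ! : ℂ) ^ 2 * (coeffC₀ m n : ℂ) := by
      simp [coeffC, coeffC₀]
    rw [e1, e2, e3, e4, e5]
    have h2 : (k ! : ℂ) ≠ 0 := by exact_mod_cast (Nat.factorial_pos k).ne'
    have h3 : ((a - k)! : ℂ) ≠ 0 := by exact_mod_cast (Nat.factorial_pos _).ne'
    field_simp
  rw [Finset.sum_congr rfl hk, ← Finset.mul_sum, Finset.sum_comm]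
  have hJ : ∀ J, ∑ k ∈ Finset.range (a + 1), (-1) ^ k / ((k ! : ℂ) * ((a - k)! : ℂ)) *
      (dirDeriv η)^[a] (rayIntegral (a - k) k
          (fun p => evalWeight η (m - a - 2 * q) J p.1) (schwartzComp f J)) x =
      (a ! : ℂ)⁻¹ * rayIntegral 0 0 (fun p => (-(p.2 : ℂ)) ^ a * evalWeight η (m - a - 2 * q) J p.1)
          ((schwartzDeriv η)^[a] (schwartzComp f J)) x := fun J => by
    have hw := isRayWeight_evalWeight η (m - a - 2 * q) J
    have h4 := dirDeriv_iterate_sum (Finset.range (a + 1)) η a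
      (fun k => (-1) ^ k / ((k ! : ℂ) * ((a - k)! : ℂ))) (h := fun k => rayIntegral (a - k) k
          (fun p => evalWeight η (m - a - 2 * q) J p.1) (schwartzComp f J))
      fun k _ => contDiff_rayIntegral _ _ hw _
    rw [← congrFun h4 x]
    simp only [sum_rayIntegral_binomial a hw]
    rw [dirDeriv_iterate_const_mul _ _ _ (contDiff_rayIntegral _ _ ((isRayWeight_pow a).mul hw) _),
      dirDeriv_iterate_rayIntegral _ _ ((isRayWeight_pow a).mul hw)]
  simp only [hJ]
  rw [← Finset.mul_sum]
  have h2 : (a ! : ℂ) ≠ 0 := by exact_mod_cast (Nat.factorial_pos a).ne'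
  field_simp

/-! ### Polar coordinates -/

lemma polar_half {n : ℕ} [Nontrivial (Rn n)] (V : Rn n → ℂ) :
    (Integrable V ↔ Integrable (fun p : Sph n × ℝ => |p.2| ^ (n - 1) • V (p.2 • (p.1 : Rn n)))
      ((volume : Measure (Rn n)).toSphere.prod (volume.restrict (Set.Ioi 0)))) ∧
    ∫ z, V z = ∫ p : Sph n × ℝ, |p.2| ^ (n - 1) • V (p.2 • (p.1 : Rn n))
      ∂((volume : Measure (Rn n)).toSphere.prod (volume.restrict (Set.Ioi 0))) := by
  set τ := (volume : Measure (Rn n)).toSphere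
  have hdim : Module.finrank ℝ (Rn n) = n := by simp
  have hmp := (volume : Measure (Rn n)).measurePreserving_homeomorphUnitSphereProd
  rw [hdim] at hmp
  have hemb := (homeomorphUnitSphereProd (Rn n)).measurableEmbedding
  have hval : MeasurePreserving (Subtype.val : Set.Ioi (0 : ℝ) → ℝ)
      (Measure.comap Subtype.val volume) (volume.restrict (Set.Ioi 0)) :=
    measurePreserving_subtype_coe measurableSet_Ioi
  have hSF : SigmaFinite (Measure.comap (Subtype.val : Set.Ioi (0 : ℝ) → ℝ) volume) := by
    refine @SigmaFinite.of_map _ _ _ _ _ Subtype.val measurable_subtype_coe.aemeasurable ?_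
    rw [hval.map_eq]
    infer_instance
  have hι : MeasurePreserving (Prod.map id Subtype.val : Sph n × Set.Ioi (0 : ℝ) → Sph n × ℝ)
      (τ.prod (Measure.comap Subtype.val volume)) (τ.prod (volume.restrict (Set.Ioi 0))) :=
    (MeasurePreserving.id τ).prod hval
  have hιe : MeasurableEmbedding (Prod.map id Subtype.val : Sph n × Set.Ioi (0 : ℝ) → Sph n × ℝ) :=
    MeasurableEmbedding.id.prodMap (MeasurableEmbedding.subtype_coe measurableSet_Ioi)
  have hden : τ.prod (Measure.volumeIoiPow (n - 1)) =
      (τ.prod (Measure.comap (Subtype.val : Set.Ioi (0 : ℝ) → ℝ) volume)).withDensity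
        (fun p => ((Real.toNNReal (p.2.1 ^ (n - 1)) : NNReal) : ENNReal)) := by
    rw [Measure.volumeIoiPow, prod_withDensity_right (by fun_prop)]
    rfl
  have hmeas : Measurable (fun p : Sph n × Set.Ioi (0 : ℝ) => Real.toNNReal (p.2.1 ^ (n - 1))) := by
    fun_prop
  let G : Sph n × Set.Ioi (0 : ℝ) → ℂ := fun p => V (p.2.1 • (p.1 : Rn n))
  have hG : ∀ z : ({0}ᶜ : Set (Rn n)), G (homeomorphUnitSphereProd (Rn n) z) = V z := fun z => by
    have := congrArg Subtype.val ((homeomorphUnitSphereProd (Rn n)).symm_apply_apply z)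
    rw [homeomorphUnitSphereProd_symm_apply_coe] at this
    simp only [G]
    rw [this]
  have hsm : ∀ p : Sph n × Set.Ioi (0 : ℝ), Real.toNNReal (p.2.1 ^ (n - 1)) • G p =
      |(Prod.map id Subtype.val p : Sph n × ℝ).2| ^ (n - 1) •
        V ((Prod.map id Subtype.val p : Sph n × ℝ).2 • ((Prod.map id Subtype.val p :
          Sph n × ℝ).1 : Rn n)) := fun p => by
    have hp : 0 < p.2.1 := p.2.2
    rw [NNReal.smul_def, Real.coe_toNNReal _ (by positivity)]
    simp only [Prod.map_snd, Prod.map_fst, abs_of_pos hp, G]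
    rfl
  constructor
  · calc Integrable V ↔ Integrable (fun z : ({0}ᶜ : Set (Rn n)) => V z)
          (Measure.comap Subtype.val volume) := by
          change _ ↔ Integrable (V ∘ Subtype.val) _
          rw [← integrableOn_iff_comap_subtypeVal (measurableSet_singleton (0 : Rn n)).compl,
            IntegrableOn, restrict_compl_singleton]
      _ ↔ Integrable G (τ.prod (Measure.volumeIoiPow (n - 1))) := by
          rw [← hmp.integrable_comp_emb hemb]
          simp only [Function.comp_def, hG]
      _ ↔ Integrable (fun p : Sph n × ℝ => |p.2| ^ (n - 1) • V (p.2 • (p.1 : Rn n)))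
          (τ.prod (volume.restrict (Set.Ioi 0))) := by
          rw [hden, integrable_withDensity_iff_integrable_smul hmeas, ← hι.integrable_comp_emb hιe]
          simp only [Function.comp_def, hsm]
  · calc ∫ z, V z = ∫ z : ({0}ᶜ : Set (Rn n)), V z ∂(Measure.comap Subtype.val volume) := by
          rw [integral_subtype_comap (measurableSet_singleton _).compl V, restrict_compl_singleton]
      _ = ∫ p, G p ∂(τ.prod (Measure.volumeIoiPow (n - 1))) := by
          rw [← hmp.integral_comp hemb]
          simp only [hG]
      _ = _ := by
          rw [hden, integral_withDensity_eq_integral_smul hmeas, ← hι.integral_comp hιe]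
          simp only [hsm]

/-- Polar coordinates over full lines: every `z ≠ 0` is `tξ` for two pairs `(ξ, t)`. -/
lemma polar_line {n : ℕ} [Nontrivial (Rn n)] (V : Rn n → ℂ)
    (hV : Integrable (fun p : Sph n × ℝ => |p.2| ^ (n - 1) • V (p.2 • (p.1 : Rn n)))
      (rayMeasure n)) :
    Integrable V ∧ ∫ p : Sph n × ℝ, |p.2| ^ (n - 1) • V (p.2 • (p.1 : Rn n)) ∂(rayMeasure n) =
      2 * ∫ z, V z := by
  set τ := (volume : Measure (Rn n)).toSphere with hτ
  have hr : ∀ s : Set ℝ, (rayMeasure n).restrict (Set.univ ×ˢ s) = τ.prod (volume.restrict s) :=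
    fun s => by rw [rayMeasure, ← Measure.prod_restrict, Measure.restrict_univ]
  have hV1 : Integrable V := by
    rw [(polar_half V).1, ← hτ, ← hr]
    exact hV.restrict
  refine ⟨hV1, ?_⟩
  have hs : MeasurableSet ((Set.univ : Set (Sph n)) ×ˢ Set.Ioi (0 : ℝ)) :=
    MeasurableSet.univ.prod measurableSet_Ioi
  have hc : ((Set.univ : Set (Sph n)) ×ˢ Set.Ioi (0 : ℝ))ᶜ = Set.univ ×ˢ Set.Iic 0 := by
    ext p; simp
  rw [← integral_add_compl hs hV, hc, hr, hr, ← (polar_half V).2]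
  have hneg : MeasurePreserving (Prod.map id Neg.neg : Sph n × ℝ → Sph n × ℝ)
      (τ.prod (volume.restrict (Set.Ioi 0))) (τ.prod (volume.restrict (Set.Iic 0))) := by
    refine (MeasurePreserving.id τ).prod ?_
    have h1 := (Measure.measurePreserving_neg (volume : Measure ℝ)).restrict_preimage
      (measurableSet_Iic (a := (0 : ℝ)))
    have h2 : (Neg.neg ⁻¹' Set.Iic (0 : ℝ)) = Set.Ici 0 := by ext; simp
    rwa [h2, ← Measure.restrict_congr_set Ioi_ae_eq_Ici] at h1
  have hnegE : MeasurableEmbedding (Prod.map id Neg.neg : Sph n × ℝ → Sph n × ℝ) :=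
    MeasurableEmbedding.id.prodMap (MeasurableEquiv.neg ℝ).measurableEmbedding
  rw [← hneg.integral_comp hnegE]
  have h3 := (polar_half (fun z => V (-z))).2
  rw [integral_neg_eq_self (fun z => V z)] at h3
  simp only [Prod.map_snd, Prod.map_fst, abs_neg, neg_smul, id]
  rw [← hτ] at h3
  rw [← h3]
  ring

/-! ### Gaussian superpositions -/

/-- The Gaussian `e^{-λ|z|²}` as a complex function. -/
def gauss {n : ℕ} (l : ℝ) (z : Rn n) : ℂ := ((Real.exp (-(l * ‖z‖ ^ 2)) : ℝ) : ℂ)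

lemma continuous_gauss {n : ℕ} (l : ℝ) : Continuous (gauss (n := n) l) := by
  unfold gauss; fun_prop

lemma norm_gauss_le {n : ℕ} {l : ℝ} (hl : 0 ≤ l) (z : Rn n) : ‖gauss l z‖ ≤ 1 := by
  rw [gauss, Complex.norm_real, Real.norm_eq_abs, Real.abs_exp, Real.exp_le_one_iff]
  have : 0 ≤ l * ‖z‖ ^ 2 := by positivity
  linarith

lemma integrableOn_rpow_mul_exp {s r : ℝ} (hs : 0 < s) (hr : 0 < r) :
    IntegrableOn (fun l : ℝ => l ^ (s - 1) * Real.exp (-(l * r))) (Set.Ioi 0) := by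
  have := integrableOn_rpow_mul_exp_neg_mul_rpow (s := s - 1) (p := 1) (b := r) (by linarith)
    zero_lt_one hr
  refine this.congr_fun (fun l _ => ?_) measurableSet_Ioi
  simp only [Real.rpow_one]
  congr 2
  ring

lemma integral_rpow_mul_exp {s r : ℝ} (hs : 0 < s) (hr : 0 < r) :
    ∫ l in Set.Ioi (0 : ℝ), l ^ (s - 1) * Real.exp (-(l * r)) = Real.Gamma s * r ^ (-s) := by
  have := Real.integral_rpow_mul_exp_neg_mul_Ioi hs hr
  simp only [mul_comm r] at this
  rw [this, Real.rpow_neg hr.le, Real.div_rpow zero_le_one hr.le, Real.one_rpow, mul_comm, one_div]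

/-- Integration against `|z|^{-2s}` is a superposition of integrals against Gaussians. -/
lemma gauss_superposition {n : ℕ} [Nontrivial (Rn n)] {s : ℝ} (hs : 0 < s) {E : Rn n → ℂ}
    (hE : Continuous E) (hi : Integrable (fun z => (‖z‖ ^ 2) ^ (-s) • E z)) :
    IntegrableOn (fun l : ℝ => ((l ^ (s - 1) : ℝ) : ℂ) * ∫ z, gauss l z * E z) (Set.Ioi 0) ∧
    ∫ l in Set.Ioi (0 : ℝ), ((l ^ (s - 1) : ℝ) : ℂ) * ∫ z, gauss l z * E z =
      (Real.Gamma s : ℂ) * ∫ z, (‖z‖ ^ 2) ^ (-s) • E z := by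
  let H : ℝ × Rn n → ℂ := fun p => ((p.1 ^ (s - 1) * Real.exp (-(p.1 * ‖p.2‖ ^ 2)) : ℝ) : ℂ) * E p.2
  have hz : ∀ᵐ z : Rn n, 0 < ‖z‖ ^ 2 := by
    filter_upwards [(measure_eq_zero_iff_ae_notMem.1 (measure_singleton (0 : Rn n)))] with z hz
    have : z ≠ 0 := hz
    positivity
  have hmeas : Measurable H := by
    have := hE.measurable
    refine Measurable.mul ?_ (this.comp measurable_snd)
    fun_prop
  have hH : Integrable H ((volume.restrict (Set.Ioi (0 : ℝ))).prod volume) := by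
    rw [integrable_prod_iff' hmeas.aestronglyMeasurable]
    constructor
    · filter_upwards [hz] with z hz
      exact (integrableOn_rpow_mul_exp hs hz).ofReal.mul_const (E z)
    · refine (hi.norm.const_mul (Real.Gamma s)).congr ?_
      filter_upwards [hz] with z hz
      have h1 : ∀ l ∈ Set.Ioi (0 : ℝ), ‖H (l, z)‖ =
          l ^ (s - 1) * Real.exp (-(l * ‖z‖ ^ 2)) * ‖E z‖ := fun l hl => by
        have hl : 0 < l := hl
        simp only [H, norm_mul, Complex.norm_real, Real.norm_eq_abs]
        rw [abs_of_nonneg (by positivity), abs_of_nonneg (by positivity)]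
      rw [setIntegral_congr_fun measurableSet_Ioi h1, integral_mul_const,
        integral_rpow_mul_exp hs hz, norm_smul, Real.norm_eq_abs, abs_of_nonneg (by positivity)]
      ring
  have h2 : ∀ l : ℝ, ∫ z, H (l, z) = ((l ^ (s - 1) : ℝ) : ℂ) * ∫ z, gauss l z * E z := fun l => by
    rw [← integral_const_mul]
    refine integral_congr_ae (Filter.Eventually.of_forall fun z => ?_)
    simp only [H, gauss]
    push_cast
    ring
  constructor
  · have := hH.integral_prod_left
    simp only [h2] at this
    exact this
  · simp only [← h2]
    rw [integral_integral_swap hH, ← integral_const_mul]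
    refine integral_congr_ae ?_
    filter_upwards [hz] with z hz
    simp only [H]
    rw [integral_mul_const, integral_complex_ofReal, integral_rpow_mul_exp hs hz, Complex.real_smul]
    push_cast
    ring

/-! ### Hermite-type polynomials -/

/-- The polynomial `∑_{b+2q=r} X^b (-Y)^q / (b! q!)`, the coefficient of `τ^r` in `e^{Xτ - Yτ²}`. -/
def hermiteSum (r : ℕ) (X Y : ℂ) : ℂ :=
  ∑ q ∈ Finset.range (r / 2 + 1), (-1) ^ q * X ^ (r - 2 * q) * Y ^ q / ((q ! : ℂ) * ((r - 2 * q)! : ℂ))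

lemma hermiteSum_eq (r N : ℕ) (hN : r / 2 + 1 ≤ N) (X Y : ℂ) :
    hermiteSum r X Y = ∑ q ∈ Finset.range N, if 2 * q ≤ r then
      (-1) ^ q * X ^ (r - 2 * q) * Y ^ q / ((q ! : ℂ) * ((r - 2 * q)! : ℂ)) else 0 := by
  rw [hermiteSum, ← Finset.sum_filter]
  refine Finset.sum_congr ?_ fun _ _ => rfl
  ext q
  simp only [Finset.mem_range, Finset.mem_filter]
  omega

lemma hermiteSum_zero (X Y : ℂ) : hermiteSum 0 X Y = 1 := by simp [hermiteSum]

lemma hermiteSum_one (X Y : ℂ) : hermiteSum 1 X Y = X := by simp [hermiteSum]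

lemma hermiteSum_succ_succ (r : ℕ) (X Y : ℂ) :
    (r + 2) * hermiteSum (r + 2) X Y = X * hermiteSum (r + 1) X Y - 2 * Y * hermiteSum r X Y := by
  have key : (∑ q ∈ Finset.range (r + 3), (2 * q : ℂ) * if 2 * q ≤ r + 2 then
      (-1) ^ q * X ^ (r + 2 - 2 * q) * Y ^ q / ((q ! : ℂ) * ((r + 2 - 2 * q)! : ℂ)) else 0) =
      - (2 * Y * hermiteSum r X Y) := by
    rw [Finset.sum_range_succ', hermiteSum_eq r (r + 2) (by omega), Finset.mul_sum,
      ← Finset.sum_neg_distrib]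
    simp only [Nat.cast_zero, mul_zero, zero_mul, add_zero]
    refine Finset.sum_congr rfl fun q _ => ?_
    have h0 : (2 * (q + 1) ≤ r + 2) = (2 * q ≤ r) := propext ⟨by omega, by omega⟩
    have h1 : r + 2 - 2 * (q + 1) = r - 2 * q := by omega
    simp only [h0, h1]
    split_ifs
    · have h2 : (q ! : ℂ) ≠ 0 := by exact_mod_cast (Nat.factorial_pos q).ne'
      have h3 : ((r - 2 * q)! : ℂ) ≠ 0 := by exact_mod_cast (Nat.factorial_pos _).ne'
      have h4 : ((q : ℂ) + 1) ≠ 0 := by exact_mod_cast (Nat.succ_ne_zero q)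
      rw [Nat.factorial_succ]
      push_cast
      field_simp
      ring
    · simp
  rw [sub_eq_add_neg, ← key, hermiteSum_eq (r + 2) (r + 3) (by omega),
    hermiteSum_eq (r + 1) (r + 3) (by omega), Finset.mul_sum, Finset.mul_sum,
    ← Finset.sum_add_distrib]
  refine Finset.sum_congr rfl fun q _ => ?_
  by_cases h : 2 * q ≤ r + 1
  · obtain ⟨c, hc⟩ : ∃ c, r + 1 = 2 * q + c := ⟨r + 1 - 2 * q, by omega⟩
    have e1 : r + 2 - 2 * q = c + 1 := by omega
    have e2 : r + 1 - 2 * q = c := by omega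
    have e3 : (r : ℂ) + 2 = 2 * q + (c + 1) := by
      have : ((r + 1 : ℕ) : ℂ) = ((2 * q + c : ℕ) : ℂ) := by rw [hc]
      push_cast at this
      linear_combination this
    rw [if_pos h, if_pos (by omega), e1, e2, e3, Nat.factorial_succ]
    have h2 : (q ! : ℂ) ≠ 0 := by exact_mod_cast (Nat.factorial_pos q).ne'
    have h3 : (c ! : ℂ) ≠ 0 := by exact_mod_cast (Nat.factorial_pos c).ne'
    have h4 : ((c : ℂ) + 1) ≠ 0 := by exact_mod_cast (Nat.succ_ne_zero c)
    push_cast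
    field_simp
    ring
  · rw [if_neg h]
    by_cases h' : 2 * q ≤ r + 2
    · have : (r : ℂ) + 2 = 2 * q := by
        have : r + 2 = 2 * q := by omega
        exact_mod_cast this
      rw [this]; simp
    · rw [if_neg h']; simp

lemma hasDerivAt_hermiteSum (r : ℕ) (X Y : ℂ) :
    HasDerivAt (fun X => hermiteSum (r + 1) X Y) (hermiteSum r X Y) X := by
  have e1 : (fun X => hermiteSum (r + 1) X Y) = fun X => ∑ q ∈ Finset.range (r + 2),
      if 2 * q ≤ r + 1 then (-1) ^ q * X ^ (r + 1 - 2 * q) * Y ^ q /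
        ((q ! : ℂ) * ((r + 1 - 2 * q)! : ℂ)) else 0 :=
    funext fun X => hermiteSum_eq (r + 1) (r + 2) (by omega) X Y
  rw [e1, hermiteSum_eq r (r + 2) (by omega)]
  refine HasDerivAt.fun_sum fun q _ => ?_
  by_cases h : 2 * q ≤ r
  · obtain ⟨c, hc⟩ : ∃ c, r = 2 * q + c := ⟨r - 2 * q, by omega⟩
    have e1 : r + 1 - 2 * q = c + 1 := by omega
    have e2 : r - 2 * q = c := by omega
    simp only [if_pos h, if_pos (show 2 * q ≤ r + 1 by omega), e1, e2]
    have h1 := (((hasDerivAt_pow (c + 1) X).const_mul ((-1) ^ q)).mul_const (Y ^ q)).div_const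
      ((q ! : ℂ) * ((c + 1)! : ℂ))
    convert! h1 using 1
    rw [Nat.factorial_succ]
    have h4 : ((c : ℂ) + 1) ≠ 0 := by exact_mod_cast (Nat.succ_ne_zero c)
    push_cast
    field_simp
  · simp only [if_neg h]
    by_cases h' : 2 * q ≤ r + 1
    · have e3 : r + 1 - 2 * q = 0 := by omega
      simp only [if_pos h', e3, pow_zero]
      exact hasDerivAt_const _ _
    · simp only [if_neg h']
      exact hasDerivAt_const _ _

/-! ### Integration by parts against Gaussians -/

lemma integrable_gauss_mul {n : ℕ} {l : ℝ} (hl : 0 ≤ l) {p : Rn n → ℂ}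
    (hp : p.HasTemperateGrowth) (ψ : 𝓢(Rn n, ℂ)) :
    Integrable (fun z => gauss l z * p z * ψ z) := by
  have h1 := (SchwartzMap.smulLeftCLM ℂ p ψ).integrable (μ := volume)
  have h2 := h1.bdd_mul (c := 1) (continuous_gauss l).aestronglyMeasurable
    (Filter.Eventually.of_forall (norm_gauss_le hl))
  refine h2.congr (Filter.Eventually.of_forall fun z => ?_)
  simp only [SchwartzMap.smulLeftCLM_apply_apply hp, smul_eq_mul, mul_assoc]

/-- The polynomial `K_r(z)` with `K_r G = (-D_η)^r G / r!` for the Gaussian `G = e^{-λ|z|²}`. -/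
def hermiteField {n : ℕ} (l : ℝ) (η : Rn n) (r : ℕ) (z : Rn n) : ℂ :=
  hermiteSum r (2 * l * ((inner ℝ z η : ℝ) : ℂ)) (l * ((‖η‖ ^ 2 : ℝ) : ℂ))

lemma hasTemperateGrowth_inner {n : ℕ} (η : Rn n) :
    (fun z : Rn n => ((inner ℝ z η : ℝ) : ℂ)).HasTemperateGrowth := by
  simpa only [← innerCLM_apply] using (innerCLM η).hasTemperateGrowth

lemma hasTemperateGrowth_hermiteField {n : ℕ} (l : ℝ) (η : Rn n) (r : ℕ) :
    (hermiteField l η r).HasTemperateGrowth := by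
  have h := hasTemperateGrowth_inner η
  unfold hermiteField hermiteSum
  simp only [div_eq_mul_inv]
  fun_prop

lemma hasLineDerivAt_inner {n : ℕ} (η z : Rn n) :
    HasLineDerivAt ℝ (fun z : Rn n => ((inner ℝ z η : ℝ) : ℂ)) ((‖η‖ ^ 2 : ℝ) : ℂ) z η := by
  have h := (innerCLM η).hasFDerivAt (x := z) |>.hasLineDerivAt η
  rw [innerCLM_apply, real_inner_self_eq_norm_sq] at h
  rwa [show (innerCLM η : Rn n → ℂ) = fun z => ((inner ℝ z η : ℝ) : ℂ) from
    funext fun z => innerCLM_apply η z] at h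

lemma hasLineDerivAt_gauss {n : ℕ} (l : ℝ) (η z : Rn n) :
    HasLineDerivAt ℝ (gauss l) (-(2 * l * ((inner ℝ z η : ℝ) : ℂ)) * gauss l z) z η := by
  have h1 : ∀ t : ℝ, ‖z + t • η‖ ^ 2 = ‖z‖ ^ 2 + 2 * (inner ℝ z η * t) + ‖η‖ ^ 2 * t ^ 2 := fun t => by
    rw [norm_add_sq_real, norm_smul, inner_smul_right, Real.norm_eq_abs, mul_pow, sq_abs]
    ring
  have h2 : HasDerivAt (fun t : ℝ => -(l * ‖z + t • η‖ ^ 2)) (-(l * (2 * inner ℝ z η))) 0 := by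
    simp only [h1]
    have a1 := (((hasDerivAt_id (0 : ℝ)).const_mul (inner ℝ z η)).const_mul 2).const_add (‖z‖ ^ 2)
    have a2 := ((hasDerivAt_pow 2 (0 : ℝ)).const_mul (‖η‖ ^ 2))
    have a3 := ((a1.add a2).const_mul l).neg
    convert! a3 using 1
    simp
  have h3 := h2.exp.ofReal_comp
  unfold HasLineDerivAt
  convert! h3 using 1
  simp only [gauss, zero_smul, add_zero]
  push_cast
  ring

lemma hasLineDerivAt_gauss_mul_hermiteField {n : ℕ} (l : ℝ) (η : Rn n) (r : ℕ) (z : Rn n) :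
    HasLineDerivAt ℝ (fun z => gauss l z * hermiteField l η r z)
      (-((r + 1) * (gauss l z * hermiteField l η (r + 1) z))) z η := by
  have hX : HasDerivAt (fun t : ℝ => 2 * (l : ℂ) * ((inner ℝ (z + t • η) η : ℝ) : ℂ))
      (2 * l * ((‖η‖ ^ 2 : ℝ) : ℂ)) 0 :=
    HasDerivAt.const_mul _ (hasLineDerivAt_inner η z)
  have hG : HasDerivAt (fun t : ℝ => gauss l (z + t • η))
    (-(2 * l * ((inner ℝ z η : ℝ) : ℂ)) * gauss l z) 0 := hasLineDerivAt_gauss l η z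
  unfold HasLineDerivAt
  cases r with
  | zero =>
    simp only [hermiteField, hermiteSum_zero, mul_one, zero_add, hermiteSum_one, Nat.cast_zero,
      one_mul]
    convert! hG using 1
    ring
  | succ r =>
    have hK : HasDerivAt (fun t : ℝ => hermiteField l η (r + 1) (z + t • η))
        (hermiteField l η r z * (2 * l * ((‖η‖ ^ 2 : ℝ) : ℂ))) 0 := by
      have h0 := hasDerivAt_hermiteSum r (2 * l * ((inner ℝ (z + (0 : ℝ) • η) η : ℝ) : ℂ))
        (l * ((‖η‖ ^ 2 : ℝ) : ℂ))
      have h1 := HasDerivAt.comp (0 : ℝ) h0 hX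
      simp only [zero_smul, add_zero] at h1
      exact h1
    have h2 := hG.mul hK
    convert! h2 using 1
    simp only [zero_smul, add_zero]
    have h3 := hermiteSum_succ_succ r (2 * l * ((inner ℝ z η : ℝ) : ℂ)) (l * ((‖η‖ ^ 2 : ℝ) : ℂ))
    simp only [hermiteField]
    push_cast at h3 ⊢
    linear_combination (-gauss l z) * h3

lemma gauss_parts {n : ℕ} {l : ℝ} (hl : 0 ≤ l) (η : Rn n) (r : ℕ) {p p' : Rn n → ℂ}
    (hp : p.HasTemperateGrowth) (hp' : p'.HasTemperateGrowth)
    (hpp : ∀ z, HasLineDerivAt ℝ p (p' z) z η) (ψ : 𝓢(Rn n, ℂ)) :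
    (r + 1) * ∫ z, gauss l z * (hermiteField l η (r + 1) z * p z) * ψ z =
      (∫ z, gauss l z * (hermiteField l η r z * p' z) * ψ z) +
      ∫ z, gauss l z * (hermiteField l η r z * p z) * schwartzDeriv η ψ z := by
  have hK := hasTemperateGrowth_hermiteField l η r
  have hK' := hasTemperateGrowth_hermiteField l η (r + 1)
  have i1 := integrable_gauss_mul hl (hK'.mul hp) ψ
  have i2 := integrable_gauss_mul hl (hK.mul hp') ψ
  have i3 := integrable_gauss_mul hl (hK.mul hp) (schwartzDeriv η ψ)
  have i4 := integrable_gauss_mul hl (hK.mul hp) ψ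
  have hd : ∀ z, HasLineDerivAt ℝ (fun z => p z * ψ z)
      (p' z * ψ z + p z * schwartzDeriv η ψ z) z η := fun z => by
    have h1 : HasDerivAt (fun t : ℝ => ψ (z + t • η)) (schwartzDeriv η ψ z) 0 := by
      rw [SchwartzMap.lineDerivOp_apply_eq_fderiv]
      exact (ψ.hasFDerivAt z).hasLineDerivAt η
    have h2 := HasDerivAt.mul (hpp z) h1
    simp only [zero_smul, add_zero] at h2
    exact h2
  have key := integral_bilinear_hasLineDerivAt_right_eq_neg_left_of_integrable
    (B := ContinuousLinearMap.mul ℝ ℂ) (μ := (volume : Measure (Rn n))) (v := η)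
    (f := fun z => gauss l z * hermiteField l η r z)
    (f' := fun z => -((r + 1) * (gauss l z * hermiteField l η (r + 1) z)))
    (g := fun z => p z * ψ z) (g' := fun z => p' z * ψ z + p z * schwartzDeriv η ψ z)
    ((i1.const_mul (-((r : ℂ) + 1))).congr (Filter.Eventually.of_forall fun z => by
      simp only [ContinuousLinearMap.mul_apply', Pi.mul_apply]; ring))
    ((i2.add i3).congr (Filter.Eventually.of_forall fun z => by
      simp only [ContinuousLinearMap.mul_apply', Pi.add_apply, Pi.mul_apply]; ring))
    (i4.congr (Filter.Eventually.of_forall fun z => by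
      simp only [ContinuousLinearMap.mul_apply', Pi.mul_apply]; ring))
    (fun z _ => hasLineDerivAt_gauss_mul_hermiteField l η r z) (fun z _ => hd z)
  simp only [ContinuousLinearMap.mul_apply'] at key
  simp only [Pi.mul_apply] at i1 i2 i3
  rw [← integral_const_mul, ← integral_add i2 i3]
  rw [← integral_neg] at key
  refine Eq.trans ?_ (key.symm.trans ?_) <;>
  · refine integral_congr_ae (Filter.Eventually.of_forall fun z => ?_)
    simp only
    ring

/-- The sum `∑_{a+r=m} (-1)^a/a! ∫ K_r G p D_η^a ψ`. -/
def gaussSum {n : ℕ} (l : ℝ) (η : Rn n) (ψ : 𝓢(Rn n, ℂ)) (m : ℕ) (p : Rn n → ℂ) : ℂ :=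
  ∑ a ∈ Finset.range (m + 1), (-1) ^ a / (a ! : ℂ) *
    ∫ z, gauss l z * (hermiteField l η (m - a) z * p z) * (schwartzDeriv η)^[a] ψ z

lemma gaussSum_succ {n : ℕ} {l : ℝ} (hl : 0 ≤ l) (η : Rn n) (ψ : 𝓢(Rn n, ℂ)) (m : ℕ)
    {p p' : Rn n → ℂ} (hp : p.HasTemperateGrowth) (hp' : p'.HasTemperateGrowth)
    (hpp : ∀ z, HasLineDerivAt ℝ p (p' z) z η) :
    (m + 1) * gaussSum l η ψ (m + 1) p = gaussSum l η ψ m p' := by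
  set e : ℕ → ℕ → ℂ := fun r a =>
    ∫ z, gauss l z * (hermiteField l η r z * p z) * (schwartzDeriv η)^[a] ψ z with he
  set e' : ℕ → ℕ → ℂ := fun r a =>
    ∫ z, gauss l z * (hermiteField l η r z * p' z) * (schwartzDeriv η)^[a] ψ z with he'
  have hrec : ∀ r a, (r + 1) * e (r + 1) a = e' r a + e r (a + 1) := fun r a => by
    have := gauss_parts hl η r hp hp' hpp ((schwartzDeriv η)^[a] ψ)
    rw [← Function.iterate_succ_apply' (schwartzDeriv η) a ψ] at this
    exact this
  have h1 : (m + 1 : ℂ) * gaussSum l η ψ (m + 1) p =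
      (∑ a ∈ Finset.range (m + 2), (-1) ^ a / (a ! : ℂ) * (((m + 1 - a : ℕ) : ℂ) * e (m + 1 - a) a)) +
      ∑ a ∈ Finset.range (m + 2), (-1) ^ a / (a ! : ℂ) * ((a : ℂ) * e (m + 1 - a) a) := by
    rw [← Finset.sum_add_distrib, gaussSum, Finset.mul_sum]
    refine Finset.sum_congr rfl fun a ha => ?_
    rw [Finset.mem_range] at ha
    rw [Nat.cast_sub (by omega)]
    push_cast
    ring
  rw [h1, Finset.sum_range_succ, Finset.sum_range_succ' _ (m + 1)]
  simp only [Nat.sub_self, Nat.cast_zero, zero_mul, mul_zero, add_zero]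
  rw [← Finset.sum_add_distrib, gaussSum]
  refine Finset.sum_congr rfl fun a ha => ?_
  rw [Finset.mem_range] at ha
  have e1 : m + 1 - a = (m - a) + 1 := by omega
  have e2 : m + 1 - (a + 1) = m - a := by omega
  have e3 := hrec (m - a) a
  change _ = (-1) ^ a / (a ! : ℂ) * e' (m - a) a
  rw [e1, e2, Nat.cast_succ, e3, Nat.factorial_succ]
  have h2 : (a ! : ℂ) ≠ 0 := by exact_mod_cast (Nat.factorial_pos a).ne'
  have h4 : ((a : ℂ) + 1) ≠ 0 := by exact_mod_cast (Nat.succ_ne_zero a)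
  push_cast
  field_simp
  ring

lemma gaussSum_sum {n : ℕ} {ι : Type*} (s : Finset ι) {l : ℝ} (hl : 0 ≤ l) (η : Rn n)
    (ψ : 𝓢(Rn n, ℂ)) (m : ℕ) (c : ι → ℂ) {p : ι → Rn n → ℂ}
    (hp : ∀ i, (p i).HasTemperateGrowth) :
    gaussSum l η ψ m (fun z => ∑ i ∈ s, c i * p i z) = ∑ i ∈ s, c i * gaussSum l η ψ m (p i) := by
  simp only [gaussSum, Finset.mul_sum]
  rw [Finset.sum_comm]
  refine Finset.sum_congr rfl fun a _ => ?_
  have hK := hasTemperateGrowth_hermiteField l η (m - a)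
  have hi : ∀ i ∈ s, Integrable (fun z => c i * (gauss l z * (hermiteField l η (m - a) z * p i z) *
      (schwartzDeriv η)^[a] ψ z)) := fun i _ =>
    (integrable_gauss_mul hl (hK.mul (hp i)) ((schwartzDeriv η)^[a] ψ)).const_mul (c i)
  simp only [mul_left_comm (c _) ((-1) ^ a / (a ! : ℂ)), ← Finset.mul_sum]
  congr 1
  simp only [← integral_const_mul]
  rw [← integral_finsetSum _ hi]
  refine integral_congr_ae (Filter.Eventually.of_forall fun z => ?_)
  simp only [Finset.mul_sum, Finset.sum_mul]
  exact Finset.sum_congr rfl fun i _ => by ring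

lemma hasTemperateGrowth_coord_prod {n : ℕ} {ι : Type*} (s : Finset ι) (J : ι → Fin n) :
    (fun z : Rn n => ∏ i ∈ s, (z (J i) : ℂ)).HasTemperateGrowth := by
  classical
  induction s using Finset.induction_on with
  | empty => simp only [Finset.prod_empty]; fun_prop
  | insert i s hi ih =>
    simp only [Finset.prod_insert hi]
    have h := hasTemperateGrowth_inner (basisVec (J i))
    simp only [real_inner_comm (basisVec (J i)), inner_basisVec_left] at h
    exact h.mul ih

lemma gaussSum_coord_prod {n : ℕ} {ι : Type*} (s : Finset ι) (J : ι → Fin n) {l : ℝ} (hl : 0 ≤ l)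
    (η : Rn n) (ψ : 𝓢(Rn n, ℂ)) :
    gaussSum l η ψ s.card (fun z => ∏ i ∈ s, (z (J i) : ℂ)) =
      (∏ i ∈ s, (η (J i) : ℂ)) * ∫ z, gauss l z * ψ z := by
  classical
  induction hm : s.card generalizing s with
  | zero =>
    rw [Finset.card_eq_zero] at hm
    simp [hm, gaussSum, hermiteField, hermiteSum_zero]
  | succ m ih =>
    have hd : ∀ z : Rn n, HasLineDerivAt ℝ (fun z : Rn n => ∏ i ∈ s, (z (J i) : ℂ))
        (∑ i ∈ s, (η (J i) : ℂ) * ∏ j ∈ s.erase i, (z (J j) : ℂ)) z η := fun z => by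
      have h1 : ∀ i ∈ s, HasDerivAt (fun t : ℝ => (((z + t • η) (J i) : ℝ) : ℂ)) (η (J i) : ℂ) 0 :=
        fun i _ => by
          have : HasDerivAt (fun t : ℝ => (z + t • η) (J i)) (η (J i)) 0 := by
            simpa using ((hasDerivAt_id (0 : ℝ)).mul_const (η (J i))).const_add (z (J i))
          exact this.ofReal_comp
      have h2 := HasDerivAt.fun_finsetProd h1
      unfold HasLineDerivAt
      convert! h2 using 1
      refine Finset.sum_congr rfl fun i _ => ?_
      simp [mul_comm]
    have hd' : (fun z : Rn n => ∑ i ∈ s, (η (J i) : ℂ) * ∏ j ∈ s.erase i,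
        (z (J j) : ℂ)).HasTemperateGrowth := Function.HasTemperateGrowth.sum fun i _ =>
      (Function.HasTemperateGrowth.const (η (J i) : ℂ)).mul
        (hasTemperateGrowth_coord_prod (s.erase i) J)
    have h3 := gaussSum_succ hl η ψ m (hasTemperateGrowth_coord_prod s J) hd' hd
    rw [gaussSum_sum s hl η ψ m _ fun i => hasTemperateGrowth_coord_prod (s.erase i) J] at h3
    have h4 : ∀ i ∈ s, (η (J i) : ℂ) * gaussSum l η ψ m
        (fun z => ∏ j ∈ s.erase i, (z (J j) : ℂ)) =
        (∏ i ∈ s, (η (J i) : ℂ)) * ∫ z, gauss l z * ψ z := fun i hi => by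
      rw [ih (s.erase i) (by rw [Finset.card_erase_of_mem hi, hm]; rfl), ← mul_assoc,
        Finset.mul_prod_erase s (fun i => (η (J i) : ℂ)) hi]
    rw [Finset.sum_congr rfl h4, Finset.sum_const, hm, nsmul_eq_mul] at h3
    have h5 : ((m : ℂ) + 1) ≠ 0 := by exact_mod_cast (Nat.succ_ne_zero m)
    push_cast at h3
    exact mul_left_cancel₀ h5 h3

/-! ### The sum `∑ D_{m,n}^k N_m^k f` as a Riesz potential -/

/-- The number `(n - 1) / 2`. -/
def halfDim (n : ℕ) : ℝ := ((n : ℝ) - 1) / 2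

lemma halfDim_pos {n : ℕ} (hn : 2 ≤ n) : 0 < halfDim n := by
  have : (2 : ℝ) ≤ n := by exact_mod_cast hn
  unfold halfDim; linarith

lemma doubleFactorial_eq_Gamma {n : ℕ} (hn : 2 ≤ n) (j : ℕ) :
    (((n + 2 * j - 3)‼ : ℕ) : ℝ) =
      ((n - 3)‼ : ℕ) / Real.Gamma (halfDim n) * 2 ^ j * Real.Gamma (halfDim n + j) := by
  have hG := (Real.Gamma_pos_of_pos (halfDim_pos hn)).ne'
  induction j with
  | zero => simp; field_simp
  | succ j ih =>
    have h1 : (n + 2 * (j + 1) - 3)‼ = (n + 2 * j - 1) * (n + 2 * j - 3)‼ := by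
      rcases Nat.lt_or_ge (n + 2 * j) 3 with h | h
      · have hn2 : n = 2 := by omega
        have hj : j = 0 := by omega
        subst hn2 hj; decide
      · obtain ⟨c, hc⟩ : ∃ c, n + 2 * j = c + 3 := ⟨n + 2 * j - 3, by omega⟩
        have e1 : n + 2 * (j + 1) - 3 = c + 2 := by omega
        have e2 : n + 2 * j - 3 = c := by omega
        have e3 : n + 2 * j - 1 = c + 2 := by omega
        rw [e1, e2, e3, Nat.doubleFactorial_add_two]
    have h2 : Real.Gamma (halfDim n + (j + 1 : ℕ)) =
        (halfDim n + j) * Real.Gamma (halfDim n + j) := by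
      push_cast
      rw [← add_assoc, Real.Gamma_add_one]
      have := halfDim_pos hn
      positivity
    rw [h1, h2, Nat.cast_mul, ih, Nat.cast_sub (by omega)]
    unfold halfDim
    push_cast
    ring

lemma coeffC₀_eq {n : ℕ} (hn : 2 ≤ n) (m : ℕ) :
    2 * coeffC₀ m n * (((n - 3)‼ : ℕ) / Real.Gamma (halfDim n)) =
      (2 * Real.pi ^ (((n : ℝ) + 1) / 2))⁻¹ := by
  have hp := halfDim_pos hn
  have h0 : (((n - 3)‼ : ℕ) : ℝ) ≠ 0 := by exact_mod_cast (Nat.doubleFactorial_pos _).ne'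
  have h1 := (Real.Gamma_pos_of_pos hp).ne'
  have h2 : Real.Gamma (halfDim n + m) ≠ 0 := (Real.Gamma_pos_of_pos (by positivity)).ne'
  have h3 : Real.pi ^ (((n : ℝ) + 1) / 2) ≠ 0 := (Real.rpow_pos_of_pos Real.pi_pos _).ne'
  have e1 : (2 * (m : ℝ) + n - 1) / 2 = halfDim n + m := by unfold halfDim; ring
  have e2 : (2 : ℝ) ^ ((m : ℤ) - 2) = 2 ^ m / 4 := by
    rw [zpow_sub₀ two_ne_zero]; norm_num
  rw [coeffC₀, doubleFactorial_eq_Gamma hn, e1, e2]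
  field_simp
  norm_num

lemma rayMeasure_ae_ne_zero (n : ℕ) : ∀ᵐ p ∂(rayMeasure n), p.2 ≠ 0 := by
  have h : rayMeasure n (Set.univ ×ˢ {(0 : ℝ)}) = 0 := by
    rw [rayMeasure, Measure.prod_prod]; simp
  filter_upwards [measure_eq_zero_iff_ae_notMem.1 h] with p hp h0
  exact hp ⟨Set.mem_univ _, h0⟩

lemma abs_pow_mul_rpow {n : ℕ} (hn : 1 ≤ n) (j : ℕ) {t : ℝ} (ht : t ≠ 0) :
    |t| ^ (n - 1) * (t ^ 2) ^ (-(halfDim n + j)) = ((t ^ 2) ^ j)⁻¹ := by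
  have h0 : 0 < |t| := abs_pos.2 ht
  have h1 : 0 < t ^ 2 := by positivity
  have h2 : |t| ^ (n - 1) = (t ^ 2) ^ (halfDim n) := by
    rw [← sq_abs, ← Real.rpow_natCast |t| 2, ← Real.rpow_mul h0.le, ← Real.rpow_natCast,
      Nat.cast_sub hn]
    congr 1
    unfold halfDim
    push_cast
    ring
  rw [h2, ← Real.rpow_add h1, ← Real.rpow_natCast (t ^ 2) j, ← Real.rpow_neg h1.le]
  congr 1
  ring

lemma rayIntegral_eq_polar {n m : ℕ} (hn : 2 ≤ n) {a b q : ℕ} (h : a + b + 2 * q = m)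
    (J : Fin m → Fin n) (η : Rn n) (ψ : 𝓢(Rn n, ℂ)) (x : Rn n) :
    Integrable (fun z => (‖z‖ ^ 2) ^ (-(halfDim n + (b + q : ℕ))) •
      (evalWeight η b J z * ψ (z + x))) ∧
    rayIntegral 0 0 (fun p => (-(p.2 : ℂ)) ^ a * evalWeight η b J p.1) ψ x =
      2 * (-1) ^ a * ∫ z, (‖z‖ ^ 2) ^ (-(halfDim n + (b + q : ℕ))) •
        (evalWeight η b J z * ψ (z + x)) := by
  have : Nontrivial (Rn n) := by
    have : Nonempty (Fin n) := ⟨⟨0, by omega⟩⟩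
    infer_instance
  let V : Rn n → ℂ := fun z => (-1) ^ a * ((‖z‖ ^ 2) ^ (-(halfDim n + (b + q : ℕ))) •
      (evalWeight η b J z * ψ (z + x)))
  have hW := integrable_ray 0 0 ((isRayWeight_pow a).mul (isRayWeight_evalWeight η b J)) ψ x
  have hEq : (fun p : Sph n × ℝ => rayWeight 0 0 (fun p => (-(p.2 : ℂ)) ^ a *
      evalWeight η b J p.1) x p * ψ (x + p.2 • (p.1 : Rn n))) =ᵐ[rayMeasure n]
      fun p => |p.2| ^ (n - 1) • V (p.2 • (p.1 : Rn n)) := by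
    filter_upwards [rayMeasure_ae_ne_zero n] with p hp
    have h1 : ‖p.2 • (p.1 : Rn n)‖ ^ 2 = p.2 ^ 2 := by
      rw [norm_smul]; simp
    have h2 : evalWeight η b J (p.2 • (p.1 : Rn n)) =
        (p.2 : ℂ) ^ (b + m) * evalWeight η b J p.1 := by
      rw [evalWeight, evalWeight, vecPow_smul, inner_smul_left]
      simp only [conj_trivial]
      push_cast
      ring
    have h3 := abs_pow_mul_rpow (n := n) (by omega) (b + q) hp
    have h4 : (p.2 : ℂ) ≠ 0 := by exact_mod_cast hp
    simp only [V]
    rw [h1, h2, mul_smul_comm, smul_smul, h3, Complex.real_smul]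
    simp only [rayWeight, pow_zero, one_mul]
    have h5 : (p.2 : ℂ) ^ (b + m) = ((p.2 : ℂ) ^ 2) ^ (b + q) * (p.2 : ℂ) ^ a := by
      rw [← pow_mul, ← pow_add]
      congr 1
      omega
    rw [h5, neg_pow, add_comm x]
    push_cast
    field_simp
  obtain ⟨hV1, hV2⟩ := polar_line V (hW.congr hEq)
  have hs : ((-1 : ℂ) ^ a) * (-1) ^ a = 1 := by rw [← mul_pow]; simp
  constructor
  · refine (hV1.const_mul ((-1) ^ a)).congr (Filter.Eventually.of_forall fun z => ?_)
    simp only [V]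
    rw [← mul_assoc, hs, one_mul]
  · rw [rayIntegral, integral_congr_ae hEq, hV2]
    simp only [V]
    rw [integral_const_mul]
    ring

/-- The translate `z ↦ ψ(z + x)`. -/
def schwartzShift {n : ℕ} (x : Rn n) (ψ : 𝓢(Rn n, ℂ)) : 𝓢(Rn n, ℂ) :=
  SchwartzMap.compSubConstCLM ℂ (-x) ψ

lemma schwartzShift_apply {n : ℕ} (x : Rn n) (ψ : 𝓢(Rn n, ℂ)) (z : Rn n) :
    schwartzShift x ψ z = ψ (z + x) := by
  simp [schwartzShift]

lemma schwartzDeriv_iterate_shift {n : ℕ} (η x : Rn n) (ψ : 𝓢(Rn n, ℂ)) (a : ℕ) :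
    (schwartzDeriv η)^[a] (schwartzShift x ψ) = schwartzShift x ((schwartzDeriv η)^[a] ψ) := by
  induction a generalizing ψ with
  | zero => rfl
  | succ a ih =>
    rw [Function.iterate_succ_apply, Function.iterate_succ_apply, ← ih]
    congr 1
    ext z
    rw [schwartzShift_apply, SchwartzMap.lineDerivOp_apply_eq_fderiv,
      SchwartzMap.lineDerivOp_apply_eq_fderiv]
    rw [show (schwartzShift x ψ : Rn n → ℂ) = fun z => ψ (z + x) from
      funext (schwartzShift_apply x ψ), fderiv_comp_add_right]

lemma hasTemperateGrowth_evalWeight {n m : ℕ} (η : Rn n) (b : ℕ) (J : Fin m → Fin n) :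
    (evalWeight η b J).HasTemperateGrowth :=
  ((hasTemperateGrowth_inner η).pow b).mul (hasTemperateGrowth_coord_prod Finset.univ J)

lemma gaussSum_vecPow_expand {n m : ℕ} {l : ℝ} (hl : 0 ≤ l) (η : Rn n) (ψ : 𝓢(Rn n, ℂ))
    (J : Fin m → Fin n) :
    gaussSum l η ψ m (fun z => vecPow z J) =
      ∑ a ∈ Finset.range (m + 1), ∑ q ∈ Finset.range ((m - a) / 2 + 1),
        ((-1) ^ a * (-1) ^ q * 2 ^ (m - a - 2 * q) * (l : ℂ) ^ (m - a - 2 * q + q) *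
          ((‖η‖ ^ 2 : ℝ) : ℂ) ^ q / ((q ! : ℂ) * ((m - a - 2 * q)! : ℂ) * (a ! : ℂ))) *
        ∫ z, gauss l z * (evalWeight η (m - a - 2 * q) J z * (schwartzDeriv η)^[a] ψ z) := by
  unfold gaussSum
  refine Finset.sum_congr rfl fun a _ => ?_
  simp only [← integral_const_mul]
  rw [← integral_finsetSum]
  · refine integral_congr_ae (Filter.Eventually.of_forall fun z => ?_)
    simp only [hermiteField, hermiteSum, Finset.mul_sum, Finset.sum_mul]
    refine Finset.sum_congr rfl fun q _ => ?_
    simp only [evalWeight]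
    generalize m - a - 2 * q = b
    rw [mul_pow, mul_pow, mul_pow, pow_add]
    simp only [div_eq_mul_inv, mul_inv]
    ring
  · intro q _
    have := (integrable_gauss_mul hl (hasTemperateGrowth_evalWeight η (m - a - 2 * q) J)
      ((schwartzDeriv η)^[a] ψ))
    simp only [mul_assoc] at this
    exact this.const_mul _

/-- The superposition `∫_0^∞ λ^{(n-3)/2} ∫ e^{-λ|z|²} ψ(z + x) dz dλ`. -/
def gaussPotential {n : ℕ} (ψ : 𝓢(Rn n, ℂ)) (x : Rn n) : ℂ :=
  ∫ l in Set.Ioi (0 : ℝ), ((l ^ (halfDim n - 1) : ℝ) : ℂ) * ∫ z, gauss l z * ψ (z + x)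

lemma sum_rayIntegral_eq_gaussPotential {n m : ℕ} (hn : 2 ≤ n) (J : Fin m → Fin n) (η : Rn n)
    (ψ : 𝓢(Rn n, ℂ)) (x : Rn n) :
    ∑ a ∈ Finset.range (m + 1), ∑ q ∈ Finset.range ((m - a) / 2 + 1),
        (((n + 2 * (m - a - q) - 3)‼ : ℕ) : ℂ) * ((-1) ^ q /
          (2 ^ q * (q ! : ℂ) * ((m - a - 2 * q)! : ℂ) * (a ! : ℂ))) * ((‖η‖ ^ 2 : ℝ) : ℂ) ^ q *
        rayIntegral 0 0 (fun p => (-(p.2 : ℂ)) ^ a * evalWeight η (m - a - 2 * q) J p.1)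
          ((schwartzDeriv η)^[a] ψ) x =
    2 * ((((n - 3)‼ : ℕ) / Real.Gamma (halfDim n) : ℝ) : ℂ) *
      (vecPow η J * gaussPotential ψ x) := by
  have : Nontrivial (Rn n) := by
    have : Nonempty (Fin n) := ⟨⟨0, by omega⟩⟩
    infer_instance
  have hp := halfDim_pos hn
  set κ : ℂ := 2 * ((((n - 3)‼ : ℕ) / Real.Gamma (halfDim n) : ℝ) : ℂ) with hκ
  let c : ℕ → ℕ → ℂ := fun a q => (-1) ^ a * (-1) ^ q * 2 ^ (m - a - 2 * q) *
    ((‖η‖ ^ 2 : ℝ) : ℂ) ^ q / ((q ! : ℂ) * ((m - a - 2 * q)! : ℂ) * (a ! : ℂ))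
  let E : ℕ → ℕ → Rn n → ℂ := fun a q z =>
    evalWeight η (m - a - 2 * q) J z * (schwartzDeriv η)^[a] ψ (z + x)
  let s : ℕ → ℕ → ℝ := fun a q => halfDim n + (m - a - 2 * q + q : ℕ)
  have hE : ∀ a q, Continuous (E a q) := fun a q => by
    have h1 := continuous_evalWeight η (m - a - 2 * q) J
    have h2 := ((schwartzDeriv η)^[a] ψ).continuous
    fun_prop
  have hs : ∀ a q, 0 < s a q := fun a q => by positivity
  have hpol : ∀ a ∈ Finset.range (m + 1), ∀ q ∈ Finset.range ((m - a) / 2 + 1), _ :=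
    fun a ha q hq => rayIntegral_eq_polar hn (a := a) (b := m - a - 2 * q) (q := q) (by
      rw [Finset.mem_range] at ha hq; omega) J η ((schwartzDeriv η)^[a] ψ) x
  have hsup : ∀ a ∈ Finset.range (m + 1), ∀ q ∈ Finset.range ((m - a) / 2 + 1), _ :=
    fun a ha q hq => gauss_superposition (hs a q) (hE a q) (hpol a ha q hq).1
  have hterm : ∀ a ∈ Finset.range (m + 1), ∀ q ∈ Finset.range ((m - a) / 2 + 1),
      (((n + 2 * (m - a - q) - 3)‼ : ℕ) : ℂ) * ((-1) ^ q /
          (2 ^ q * (q ! : ℂ) * ((m - a - 2 * q)! : ℂ) * (a ! : ℂ))) * ((‖η‖ ^ 2 : ℝ) : ℂ) ^ q *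
        rayIntegral 0 0 (fun p => (-(p.2 : ℂ)) ^ a * evalWeight η (m - a - 2 * q) J p.1)
          ((schwartzDeriv η)^[a] ψ) x =
      κ * ∫ l in Set.Ioi (0 : ℝ), c a q * (((l ^ (s a q - 1) : ℝ) : ℂ) * ∫ z, gauss l z * E a q z) :=
    fun a ha q hq => by
      rw [integral_const_mul, (hsup a ha q hq).2, (hpol a ha q hq).2]
      rw [Finset.mem_range] at ha hq
      have e1 : m - a - q = m - a - 2 * q + q := by omega
      have e2 := doubleFactorial_eq_Gamma hn (m - a - 2 * q + q)
      have e3 : (((n + 2 * (m - a - q) - 3)‼ : ℕ) : ℂ) =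
          ((((n - 3)‼ : ℕ) / Real.Gamma (halfDim n) : ℝ) : ℂ) * 2 ^ (m - a - 2 * q + q) *
            (Real.Gamma (halfDim n + (m - a - 2 * q + q : ℕ)) : ℂ) := by
        rw [e1]
        exact_mod_cast congrArg (fun r : ℝ => (r : ℂ)) e2
      rw [e3, hκ, pow_add]
      simp only [c, s, E]
      field_simp
  rw [Finset.sum_congr rfl fun a ha => Finset.sum_congr rfl (hterm a ha)]
  simp only [← Finset.mul_sum]
  congr 1
  have h_int : ∀ a ∈ Finset.range (m + 1), ∀ q ∈ Finset.range ((m - a) / 2 + 1),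
      Integrable (fun l : ℝ => c a q * (((l ^ (s a q - 1) : ℝ) : ℂ) * ∫ z, gauss l z * E a q z))
        (volume.restrict (Set.Ioi 0)) := fun a ha q hq => (hsup a ha q hq).1.const_mul _
  rw [Finset.sum_congr rfl fun a ha => (integral_finsetSum _ (h_int a ha)).symm,
    ← integral_finsetSum _ fun a ha => integrable_finsetSum _ (h_int a ha), gaussPotential,
    ← integral_const_mul]
  refine setIntegral_congr_fun measurableSet_Ioi fun l hl => ?_
  have hl' : 0 < l := hl
  have hg := gaussSum_coord_prod (Finset.univ : Finset (Fin m)) J hl'.le η (schwartzShift x ψ)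
  rw [Finset.card_univ, Fintype.card_fin] at hg
  have hg2 := gaussSum_vecPow_expand hl'.le η (schwartzShift x ψ) J
  simp only [schwartzDeriv_iterate_shift, schwartzShift_apply] at hg hg2
  change _ = vecPow η J * _ at hg
  have hg3 := hg2.symm.trans hg
  rw [mul_left_comm, ← hg3]
  simp only [Finset.mul_sum]
  refine Finset.sum_congr rfl fun a _ => Finset.sum_congr rfl fun q _ => ?_
  have hpow : ((l ^ (s a q - 1) : ℝ) : ℂ) = ((l ^ (halfDim n - 1) : ℝ) : ℂ) *
      (l : ℂ) ^ (m - a - 2 * q + q) := by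
    rw [← Complex.ofReal_pow, ← Complex.ofReal_mul, ← Real.rpow_natCast, ← Real.rpow_add hl']
    congr 2
    simp only [s]
    ring
  rw [hpow]
  simp only [c, E]
  ring

lemma tensorEval_sumField_eq_gaussPotential {n m : ℕ} (hn : 2 ≤ n) (f : 𝓢(Rn n, SymTensor n m))
    (x η : Rn n) :
    tensorEval (sumField f x) η = (((2 * Real.pi ^ (((n : ℝ) + 1) / 2))⁻¹ : ℝ) : ℂ) *
      ∑ J, gaussPotential (schwartzComp f J) x * vecPow η J := by
  rw [tensorEval_sumField, ← coeffC₀_eq hn m]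
  simp only [Finset.mul_sum]
  have : ∀ J, ∑ a ∈ Finset.range (m + 1), ∑ q ∈ Finset.range ((m - a) / 2 + 1), _ = _ := fun J =>
    sum_rayIntegral_eq_gaussPotential hn J η (schwartzComp f J) x
  rw [Finset.sum_congr rfl fun a _ => Finset.sum_comm, Finset.sum_comm]
  refine Finset.sum_congr rfl fun J _ => ?_
  simp only [← Finset.mul_sum]
  rw [this J]
  push_cast
  ring

/-! ### The Fourier transform of Schwartz functions -/

lemma integrable_wave_mul {n : ℕ} {h : Rn n → ℂ} (hh : Integrable h) (x : Rn n) :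
    Integrable (fun y => Complex.exp (Complex.I * ((inner ℝ x y : ℝ) : ℂ)) * h y) := by
  refine hh.bdd_mul (c := 1) (Continuous.aestronglyMeasurable (by fun_prop))
    (Filter.Eventually.of_forall fun y => ?_)
  rw [mul_comm, Complex.norm_exp_ofReal_mul_I]

lemma integral_mul_integral_wave {n : ℕ} {a b : Rn n → ℂ} (ha : Integrable a) (hb : Integrable b) :
    ∫ x, a x * ∫ y, Complex.exp (Complex.I * ((inner ℝ x y : ℝ) : ℂ)) * b y =
      ∫ y, b y * ∫ x, Complex.exp (Complex.I * ((inner ℝ y x : ℝ) : ℂ)) * a x := by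
  simp only [← integral_const_mul]
  rw [integral_integral_swap]
  · refine integral_congr_ae (Filter.Eventually.of_forall fun y => integral_congr_ae
      (Filter.Eventually.of_forall fun x => ?_))
    simp only [real_inner_comm x y]
    ring
  · have h := (ha.mul_prod hb).bdd_mul (c := 1)
      (f := fun p : Rn n × Rn n => Complex.exp (Complex.I * ((inner ℝ p.1 p.2 : ℝ) : ℂ)))
      (Continuous.aestronglyMeasurable (by fun_prop))
      (Filter.Eventually.of_forall fun p => by rw [mul_comm, Complex.norm_exp_ofReal_mul_I])
    refine h.congr (Filter.Eventually.of_forall fun p => ?_)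
    simp only [Function.uncurry_def]
    ring

lemma fourierT_eq {n : ℕ} (χ : Rn n → ℂ) (y : Rn n) :
    fourierT χ y = (((2 * Real.pi) ^ (-(n : ℝ) / 2) : ℝ) : ℂ) *
      FourierTransform.fourier χ ((2 * Real.pi)⁻¹ • y) := by
  rw [fourierT, Real.fourier_eq']
  congr 2
  ext x
  rw [smul_eq_mul, real_inner_smul_right, real_inner_comm]
  congr 2
  push_cast
  have : (Real.pi : ℂ) ≠ 0 := by exact_mod_cast Real.pi_ne_zero
  field_simp

/-- The Fourier transform `fourierT` as a Schwartz function. -/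
def schwartzFourier {n : ℕ} (χ : 𝓢(Rn n, ℂ)) : 𝓢(Rn n, ℂ) :=
  (((2 * Real.pi) ^ (-(n : ℝ) / 2) : ℝ) : ℂ) •
    SchwartzMap.compCLMOfContinuousLinearEquiv ℂ
      (ContinuousLinearEquiv.smulLeft (Units.mk0 (2 * Real.pi)⁻¹ (by positivity)) :
        Rn n ≃L[ℝ] Rn n) (FourierTransform.fourier χ)

lemma coe_schwartzFourier {n : ℕ} (χ : 𝓢(Rn n, ℂ)) : ⇑(schwartzFourier χ) = fourierT χ := by
  ext y
  rw [fourierT_eq]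
  rfl

lemma fourierTInv_fourierT {n : ℕ} (χ : 𝓢(Rn n, ℂ)) (x : Rn n) :
    fourierTInv (fourierT χ) x = χ x := by
  have hpi : (0 : ℝ) < 2 * Real.pi := by positivity
  have h := congrFun (χ.continuous.fourierInv_fourier_eq χ.integrable
    (FourierTransform.fourier χ).integrable) x
  rw [← h, Real.fourierInv_eq', fourierTInv]
  have h1 := Measure.integral_comp_inv_smul (volume : Measure (Rn n)) (fun v : Rn n =>
    Complex.exp (((2 * Real.pi * inner ℝ v x : ℝ) : ℂ) * Complex.I) •
      FourierTransform.fourier (χ : Rn n → ℂ) v) (2 * Real.pi)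
  rw [finrank_euclideanSpace_fin, abs_of_pos (by positivity)] at h1
  have h2 : ∀ y, Complex.exp (Complex.I * ((inner ℝ x y : ℝ) : ℂ)) * fourierT χ y =
      (((2 * Real.pi) ^ (-(n : ℝ) / 2) : ℝ) : ℂ) *
      (Complex.exp (((2 * Real.pi * inner ℝ ((2 * Real.pi)⁻¹ • y) x : ℝ) : ℂ) * Complex.I) •
      FourierTransform.fourier (χ : Rn n → ℂ) ((2 * Real.pi)⁻¹ • y)) := fun y => by
    rw [fourierT_eq, real_inner_smul_left, mul_inv_cancel_left₀ hpi.ne', real_inner_comm,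
      smul_eq_mul, mul_comm Complex.I]
    ring
  simp only [h2]
  rw [integral_const_mul, h1, Complex.real_smul, ← mul_assoc, ← mul_assoc, ← Complex.ofReal_mul,
    ← Complex.ofReal_mul, ← Real.rpow_natCast, ← Real.rpow_add hpi, ← Real.rpow_add hpi]
  have h3 : -(n : ℝ) / 2 + -(n : ℝ) / 2 + n = 0 := by ring
  rw [h3]
  simp

lemma integrable_gauss {n : ℕ} {l : ℝ} (hl : 0 < l) : Integrable (gauss (n := n) l) := by
  have := GaussianFourier.integrable_cexp_neg_mul_sq_norm_add (V := Rn n) (b := l) (by simpa) 0 0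
  refine this.congr (Filter.Eventually.of_forall fun z => ?_)
  simp [gauss]

lemma integral_wave_mul_gauss {n : ℕ} {l : ℝ} (hl : 0 < l) (y : Rn n) :
    ∫ z, Complex.exp (Complex.I * ((inner ℝ y z : ℝ) : ℂ)) * gauss l z =
      (((Real.pi / l) ^ ((n : ℝ) / 2) : ℝ) : ℂ) * gauss (4 * l)⁻¹ y := by
  have h := GaussianFourier.integral_cexp_neg_mul_sq_norm_add_of_euclideanSpace (ι := Fin n)
    (b := l) (by simpa) Complex.I y
  rw [Fintype.card_fin] at h
  rw [Complex.ofReal_cpow (by positivity)]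
  convert h using 1
  · congr 1
    ext z
    rw [gauss, Complex.ofReal_exp, ← Complex.exp_add]
    congr 1
    push_cast
    ring
  · rw [gauss, Complex.ofReal_exp, Complex.I_sq]
    push_cast
    congr 2
    field_simp

/-- The Gaussian means of `ψ` in terms of its Fourier transform. -/
lemma integral_gauss_mul_shift {n : ℕ} {l : ℝ} (hl : 0 < l) (ψ : 𝓢(Rn n, ℂ)) (x : Rn n) :
    ∫ z, gauss l z * ψ (z + x) = (((2 * Real.pi) ^ (-(n : ℝ) / 2) : ℝ) : ℂ) *
      ((((Real.pi / l) ^ ((n : ℝ) / 2) : ℝ) : ℂ) * ∫ y, gauss (4 * l)⁻¹ y *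
        (Complex.exp (Complex.I * ((inner ℝ x y : ℝ) : ℂ)) * fourierT ψ y)) := by
  have hi : Integrable (fourierT ψ) := by
    rw [← coe_schwartzFourier]; exact (schwartzFourier ψ).integrable
  have h1 : ∀ z, gauss l z * ψ (z + x) = (((2 * Real.pi) ^ (-(n : ℝ) / 2) : ℝ) : ℂ) *
      (gauss l z * ∫ y, Complex.exp (Complex.I * ((inner ℝ z y : ℝ) : ℂ)) *
        (Complex.exp (Complex.I * ((inner ℝ x y : ℝ) : ℂ)) * fourierT ψ y)) := fun z => by
    rw [← fourierTInv_fourierT, fourierTInv, mul_left_comm]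
    congr 3
    ext y
    rw [inner_add_left, ← mul_assoc, ← Complex.exp_add]
    congr 2
    push_cast
    ring
  simp only [h1]
  rw [integral_const_mul, integral_mul_integral_wave (integrable_gauss hl)
    (integrable_wave_mul hi x)]
  simp only [integral_wave_mul_gauss hl]
  congr 1
  rw [← integral_const_mul]
  refine integral_congr_ae (Filter.Eventually.of_forall fun y => ?_)
  ring

lemma isRayWeight_abs_pow {n : ℕ} (a : ℕ) :
    IsRayWeight (fun p : Sph n × ℝ => ((|p.2| ^ a : ℝ) : ℂ)) := by
  refine ⟨by fun_prop, 1, a, zero_le_one, fun p => ?_⟩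
  rw [Complex.norm_real, Real.norm_eq_abs, abs_of_nonneg (by positivity), one_mul]
  gcongr
  linarith

lemma integrable_norm_inv_mul {n : ℕ} (hn : 2 ≤ n) (χ : 𝓢(Rn n, ℂ)) :
    Integrable (fun y => ((‖y‖⁻¹ : ℝ) : ℂ) * χ y) := by
  have : Nontrivial (Rn n) := by
    have : Nonempty (Fin n) := ⟨⟨0, by omega⟩⟩
    infer_instance
  refine (polar_line _ ?_).1
  refine (integrable_ray 0 0 (isRayWeight_abs_pow (n - 2)) χ 0).congr ?_
  filter_upwards [rayMeasure_ae_ne_zero n] with p hp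
  have e : n - 1 = n - 2 + 1 := by omega
  have hp' : |p.2| ≠ 0 := abs_ne_zero.2 hp
  simp only [rayWeight, pow_zero, one_mul, zero_add, e, pow_succ, norm_smul, Real.norm_eq_abs,
    norm_eq_of_mem_sphere, mul_one, Complex.real_smul]
  rw [← mul_assoc, ← Complex.ofReal_mul, mul_assoc, mul_inv_cancel₀ hp', mul_one]

lemma gaussPotential_eq {n : ℕ} (hn : 2 ≤ n) (ψ : 𝓢(Rn n, ℂ)) (x : Rn n) :
    gaussPotential ψ x = ((2 * Real.pi ^ (((n : ℝ) + 1) / 2) : ℝ) : ℂ) *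
      fourierTInv (fun y => ((‖y‖⁻¹ : ℝ) : ℂ) * fourierT ψ y) x := by
  have : Nontrivial (Rn n) := by
    have : Nonempty (Fin n) := ⟨⟨0, by omega⟩⟩
    infer_instance
  have hpi := Real.pi_pos
  set E : Rn n → ℂ := fun y => Complex.exp (Complex.I * ((inner ℝ x y : ℝ) : ℂ)) * fourierT ψ y
    with hE
  set K : ℝ → ℂ := fun v => ∫ y, gauss v y * E y with hK
  have hnorm : ∀ y : Rn n, (‖y‖ ^ 2) ^ (-(1 / 2 : ℝ)) = ‖y‖⁻¹ := fun y => by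
    rw [← Real.rpow_natCast, ← Real.rpow_mul (norm_nonneg y), ← Real.rpow_neg_one]
    norm_num
  have hsup := (gauss_superposition (n := n) (s := 1 / 2) (by norm_num) (E := E)
    (by
      have := (schwartzFourier ψ).continuous
      rw [coe_schwartzFourier] at this
      fun_prop)
    (by
      have h := integrable_wave_mul (integrable_norm_inv_mul hn (schwartzFourier ψ)) x
      rw [coe_schwartzFourier] at h
      refine h.congr (Filter.Eventually.of_forall fun y => ?_)
      simp only [hE, hnorm, Complex.real_smul]
      ring)).2
  have hs1 := integral_comp_rpow_Ioi (fun v : ℝ => ((v ^ (-(1 / 2) : ℝ) : ℝ) : ℂ) * K (v / 4))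
    (p := -1) (by norm_num)
  have hs2 := integral_comp_mul_left_Ioi (fun v : ℝ => ((v ^ (-(1 / 2) : ℝ) : ℝ) : ℂ) * K (v / 4))
    0 (b := 4) (by norm_num)
  have h4 : (4 : ℝ) ^ (-(1 / 2) : ℝ) = 2⁻¹ := by
    rw [show (4 : ℝ) = 2 ^ (2 : ℝ) by norm_num, ← Real.rpow_mul (by norm_num)]
    norm_num
  have hs3 : ∫ v in Set.Ioi (0 : ℝ), (((4 * v) ^ (-(1 / 2) : ℝ) : ℝ) : ℂ) * K (4 * v / 4) =
      2⁻¹ * ∫ v in Set.Ioi (0 : ℝ), ((v ^ (1 / 2 - 1 : ℝ) : ℝ) : ℂ) * K v := by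
    rw [← integral_const_mul]
    refine setIntegral_congr_fun measurableSet_Ioi fun v hv => ?_
    have hv : 0 < v := hv
    rw [Real.mul_rpow (by norm_num) hv.le, h4, mul_div_cancel_left₀ _ (by norm_num),
      show (1 / 2 - 1 : ℝ) = -(1 / 2) by norm_num]
    push_cast
    ring
  have hs4 : gaussPotential ψ x = (((2 * Real.pi) ^ (-(n : ℝ) / 2) * Real.pi ^ ((n : ℝ) / 2) : ℝ) : ℂ)
      * ∫ l in Set.Ioi (0 : ℝ), (|(-1 : ℝ)| * l ^ (-1 - 1 : ℝ)) •
        ((((l ^ (-1 : ℝ)) ^ (-(1 / 2) : ℝ) : ℝ) : ℂ) * K (l ^ (-1 : ℝ) / 4)) := by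
    rw [gaussPotential, ← integral_const_mul]
    refine setIntegral_congr_fun measurableSet_Ioi fun l hl => ?_
    have hl : 0 < l := hl
    rw [integral_gauss_mul_shift hl, Real.div_rpow hpi.le hl.le, Complex.real_smul,
      Real.rpow_neg_one, show l⁻¹ / 4 = (4 * l)⁻¹ by rw [mul_inv]; ring, abs_neg, abs_one, one_mul]
    have e : l ^ (halfDim n - 1) / l ^ ((n : ℝ) / 2) = l ^ (-1 - 1 : ℝ) * l⁻¹ ^ (-(1 / 2) : ℝ) := by
      rw [← Real.rpow_neg_one, ← Real.rpow_mul hl.le, ← Real.rpow_add hl, ← Real.rpow_sub hl]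
      congr 1
      unfold halfDim
      ring
    have e' : ((l ^ (halfDim n - 1) : ℝ) : ℂ) * ((Real.pi ^ ((n : ℝ) / 2) / l ^ ((n : ℝ) / 2) : ℝ) : ℂ)
        = ((Real.pi ^ ((n : ℝ) / 2) : ℝ) : ℂ) *
          (((l ^ (-1 - 1 : ℝ) : ℝ) : ℂ) * ((l⁻¹ ^ (-(1 / 2) : ℝ) : ℝ) : ℂ)) := by
      rw [← Complex.ofReal_mul, ← Complex.ofReal_mul, ← Complex.ofReal_mul, ← e]
      congr 1
      ring
    rw [Complex.ofReal_mul]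
    linear_combination (((2 * Real.pi) ^ (-(n : ℝ) / 2) : ℝ) : ℂ) * K (4 * l)⁻¹ * e'
  rw [hs4, hs1]
  rw [hs3, hsup, mul_zero] at hs2
  have hs5 : ∫ v in Set.Ioi (0 : ℝ), ((v ^ (-(1 / 2) : ℝ) : ℝ) : ℂ) * K (v / 4) =
      2 * ((Real.Gamma (1 / 2) : ℂ) * ∫ z, (‖z‖ ^ 2) ^ (-(1 / 2 : ℝ)) • E z) := by
    rw [Complex.real_smul] at hs2
    push_cast at hs2 ⊢
    linear_combination (-4) * hs2
  rw [hs5, Real.Gamma_one_half_eq, fourierTInv]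
  have hpw : Real.pi ^ (((n : ℝ) + 1) / 2) = Real.pi ^ ((n : ℝ) / 2) * Real.sqrt Real.pi := by
    rw [Real.sqrt_eq_rpow, ← Real.rpow_add hpi]
    congr 1
    ring
  have h_int : ∫ z, (‖z‖ ^ 2) ^ (-(1 / 2 : ℝ)) • E z = ∫ y, Complex.exp (Complex.I *
      ((inner ℝ x y : ℝ) : ℂ)) * (((‖y‖⁻¹ : ℝ) : ℂ) * fourierT ψ y) := by
    congr 1
    ext y
    simp only [hE, hnorm, Complex.real_smul]
    ring
  rw [h_int, hpw]
  push_cast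
  ring

lemma norm_fourierTInv_le {n : ℕ} (h : Rn n → ℂ) (x : Rn n) :
    ‖fourierTInv h x‖ ≤ (2 * Real.pi) ^ (-(n : ℝ) / 2) * ∫ y, ‖h y‖ := by
  have hpi : (0 : ℝ) < 2 * Real.pi := by positivity
  rw [fourierTInv, norm_mul, Complex.norm_real, Real.norm_eq_abs, abs_of_pos (by positivity)]
  gcongr
  refine (norm_integral_le_integral_norm _).trans_eq ?_
  congr 1
  ext y
  rw [norm_mul, mul_comm Complex.I, Complex.norm_exp_ofReal_mul_I, one_mul]

lemma continuous_fourierTInv {n : ℕ} {h : Rn n → ℂ} (hh : Integrable h) :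
    Continuous (fourierTInv h) := by
  refine continuous_const.mul (continuous_of_dominated (bound := fun y => ‖h y‖) (fun x => ?_)
    (fun x => Filter.Eventually.of_forall fun y => ?_) hh.norm
    (Filter.Eventually.of_forall fun y => by fun_prop))
  · exact (integrable_wave_mul hh x).aestronglyMeasurable
  · rw [norm_mul, mul_comm Complex.I, Complex.norm_exp_ofReal_mul_I, one_mul]

lemma hasFourier_fourierTInv {n : ℕ} {h : Rn n → ℂ} (hh : Integrable h) :
    HasFourier (fourierTInv h) h := by
  refine ⟨⟨n + 1, ?_⟩, ⟨0, by simpa using hh⟩, fun χ => ?_⟩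
  · have hd : Integrable (fun x : Rn n => ((1 + ‖x‖) ^ (n + 1))⁻¹) := by
      have := integrable_one_add_norm (E := Rn n) (μ := volume) (r := n + 1) (by simp)
      refine this.congr (Filter.Eventually.of_forall fun x => ?_)
      simp only
      rw [Real.rpow_neg (by positivity)]
      norm_cast
    refine (hd.mul_const ((2 * Real.pi) ^ (-(n : ℝ) / 2) * ∫ y, ‖h y‖)).mono' ?_
      (Filter.Eventually.of_forall fun x => ?_)
    · exact hd.aestronglyMeasurable.smul (continuous_fourierTInv hh).aestronglyMeasurable
    · rw [norm_smul, Real.norm_eq_abs, abs_of_nonneg (by positivity)]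
      gcongr
      exact norm_fourierTInv_le h x
  · have hi : Integrable (fourierT χ) := by
      rw [← coe_schwartzFourier]; exact (schwartzFourier χ).integrable
    have h1 := integral_mul_integral_wave hi hh
    have h2 : ∀ x, fourierTInv h x * fourierT χ x = (((2 * Real.pi) ^ (-(n : ℝ) / 2) : ℝ) : ℂ) *
        (fourierT χ x * ∫ y, Complex.exp (Complex.I * ((inner ℝ x y : ℝ) : ℂ)) * h y) := fun x => by
      rw [fourierTInv]; ring
    simp only [h2]
    rw [integral_const_mul, h1, ← integral_const_mul]
    refine integral_congr_ae (Filter.Eventually.of_forall fun y => ?_)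
    simp only
    rw [mul_left_comm, ← fourierTInv_fourierT χ y, fourierTInv]

lemma hasSqrtNegLaplacian_riesz {n : ℕ} (hn : 2 ≤ n) (ψ : 𝓢(Rn n, ℂ)) :
    HasSqrtNegLaplacian (fourierTInv (fun y => ((‖y‖⁻¹ : ℝ) : ℂ) * fourierT ψ y)) ψ := by
  have : Nontrivial (Rn n) := by
    have : Nonempty (Fin n) := ⟨⟨0, by omega⟩⟩
    infer_instance
  have hi := integrable_norm_inv_mul hn (schwartzFourier ψ)
  rw [coe_schwartzFourier] at hi
  have hae : (fun y : Rn n => (‖y‖ : ℂ) * (((‖y‖⁻¹ : ℝ) : ℂ) * fourierT ψ y)) =ᵐ[volume]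
      fourierT ψ := by
    filter_upwards [(measure_eq_zero_iff_ae_notMem.1 (measure_singleton (0 : Rn n)))] with y hy
    have hy : ‖y‖ ≠ 0 := norm_ne_zero_iff.2 hy
    rw [← mul_assoc, ← Complex.ofReal_mul, mul_inv_cancel₀ hy, Complex.ofReal_one, one_mul]
  refine ⟨_, hasFourier_fourierTInv hi, ?_, fun x => ?_⟩
  · refine Integrable.congr ?_ hae.symm
    rw [← coe_schwartzFourier]; exact (schwartzFourier ψ).integrable
  · rw [← fourierTInv_fourierT ψ x, fourierTInv, fourierTInv]
    congr 1
    refine integral_congr_ae ?_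
    filter_upwards [hae] with y hy
    rw [hy]

/-- A symmetric `sumField` is the componentwise Riesz potential of `f`. -/
lemma sumField_eq {n m : ℕ} (hn : 2 ≤ n) (f : 𝓢(Rn n, SymTensor n m))
    (hsym : ∀ x, sumField f x ∈ SymTensor n m) (I : Fin m → Fin n) :
    (fun x => sumField f x I) =
      fourierTInv (fun y => ((‖y‖⁻¹ : ℝ) : ℂ) * fourierT (schwartzComp f I) y) := by
  ext x
  have hpi := Real.pi_pos
  let v : Tensor n m := fun J =>
    fourierTInv (fun y => ((‖y‖⁻¹ : ℝ) : ℂ) * fourierT (schwartzComp f J) y) x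
  have hv : v ∈ SymTensor n m := fun π J => by
    have : schwartzComp f (J ∘ π) = schwartzComp f J := by
      ext y
      exact (f y).2 π J
    simp only [v, this]
  have h := eq_zero_of_tensorEval_eq_zero ((SymTensor n m).sub_mem (hsym x) hv) fun η => by
    have h1 := tensorEval_sumField_eq_gaussPotential hn f x η
    have h2 : tensorEval (sumField f x - v) η = tensorEval (sumField f x) η - tensorEval v η := by
      simp [tensorEval, sub_mul]
    rw [h2, h1, sub_eq_zero, tensorEval, Finset.mul_sum]
    refine Finset.sum_congr rfl fun J _ => ?_
    rw [gaussPotential_eq hn, ← mul_assoc, ← mul_assoc, ← Complex.ofReal_mul,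
      inv_mul_cancel₀ (by positivity), Complex.ofReal_one, one_mul]
  exact sub_eq_zero.1 (congrFun h I)

lemma hasSqrtNegLaplacian_sumField {n m : ℕ} (hn : 2 ≤ n) (f : 𝓢(Rn n, SymTensor n m))
    (hsym : ∀ x, sumField f x ∈ SymTensor n m) (I : Fin m → Fin n) :
    HasSqrtNegLaplacian (fun x => sumField f x I) (fun x => toField f x I) := by
  rw [sumField_eq hn f hsym I]
  exact hasSqrtNegLaplacian_riesz hn (schwartzComp f I)

/-! ### Scalar differential operators on tensor fields -/

lemma fderiv_iteratedFDeriv_apply {n s : ℕ} {h : Rn n → ℂ} (hh : ContDiff ℝ ∞ h)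
    (v : Fin s → Rn n) (x w : Rn n) :
    fderiv ℝ (fun y => iteratedFDeriv ℝ s h y v) x w =
      iteratedFDeriv ℝ (s + 1) h x (Fin.cons w v) := by
  rw [iteratedFDeriv_succ_apply_left, Fin.cons_zero, Fin.tail_cons]
  have hd : DifferentiableAt ℝ (iteratedFDeriv ℝ s h) x :=
    hh.differentiable_iteratedFDeriv (by exact_mod_cast WithTop.coe_lt_top s) x
  rw [fderiv_continuousMultilinear_apply_const_apply hd]

lemma contDiff_iteratedFDeriv_apply {n s : ℕ} {h : Rn n → ℂ} (hh : ContDiff ℝ ∞ h)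
    (v : Fin s → Rn n) : ContDiff ℝ ∞ (fun y => iteratedFDeriv ℝ s h y v) := by
  have h1 : ContDiff ℝ ∞ (iteratedFDeriv ℝ s h) :=
    hh.iteratedFDeriv_right (m := ∞) (i := s) (by norm_cast)
  exact (ContinuousMultilinearMap.apply ℝ (fun _ : Fin s => Rn n) ℂ v).contDiff.comp h1

/-- Scalar linear differential operators of order at most `r` on smooth tensor fields. -/
inductive IsScalarDiffOp {n a : ℕ} (r : ℕ) : (Field n a → Rn n → ℂ) → Prop
  | monomial {s : ℕ} (hs : s ≤ r) (α : Fin s → Fin n) (J : Fin a → Fin n) {c : Rn n → ℂ}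
      (hc : ContDiff ℝ ∞ c) : IsScalarDiffOp r fun g x =>
        c x * iteratedFDeriv ℝ s (fun y => g y J) x (fun l => basisVec (α l))
  | zero : IsScalarDiffOp r fun _ _ => 0
  | add {T U : Field n a → Rn n → ℂ} :
      IsScalarDiffOp r T → IsScalarDiffOp r U → IsScalarDiffOp r fun g x => T g x + U g x
  | congr {T U : Field n a → Rn n → ℂ} :
      IsScalarDiffOp r T → (∀ g, ContDiff ℝ ∞ g → U g = T g) → IsScalarDiffOp r U

namespace IsScalarDiffOp

variable {n a r : ℕ} {T : Field n a → Rn n → ℂ}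

lemma contDiff (hT : IsScalarDiffOp r T) {g : Field n a} (hg : ContDiff ℝ ∞ g) :
    ContDiff ℝ ∞ (T g) := by
  induction hT with
  | monomial hs α J hc => exact hc.mul (contDiff_iteratedFDeriv_apply (contDiff_pi.1 hg J) _)
  | zero => exact contDiff_const
  | add _ _ h₁ h₂ => exact h₁.add h₂
  | congr _ h h₁ => rw [h g hg]; exact h₁

lemma mono (hT : IsScalarDiffOp r T) {r' : ℕ} (hr : r ≤ r') : IsScalarDiffOp r' T := by
  induction hT with
  | monomial hs α J hc => exact monomial (hs.trans hr) α J hc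
  | zero => exact zero
  | add _ _ h₁ h₂ => exact h₁.add h₂
  | congr _ h h₁ => exact h₁.congr h

lemma mul (hT : IsScalarDiffOp r T) {d : Rn n → ℂ} (hd : ContDiff ℝ ∞ d) :
    IsScalarDiffOp r fun g x => d x * T g x := by
  induction hT with
  | monomial hs α J hc =>
    exact (monomial hs α J (hd.mul hc)).congr fun g _ => by funext x; ring
  | zero => exact zero.congr fun g _ => by funext x; ring
  | add _ _ h₁ h₂ => exact (h₁.add h₂).congr fun g _ => by funext x; ring
  | congr _ h h₁ => exact h₁.congr fun g hg => by funext x; rw [h g hg]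

lemma sum {ι : Type*} (s : Finset ι) {T : ι → Field n a → Rn n → ℂ}
    (hT : ∀ i ∈ s, IsScalarDiffOp r (T i)) : IsScalarDiffOp r fun g x => ∑ i ∈ s, T i g x := by
  classical
  induction s using Finset.induction_on with
  | empty => simpa using zero (r := r)
  | insert i s hi ih =>
    simp only [Finset.sum_insert hi]
    exact (hT i (Finset.mem_insert_self i s)).add
      (ih fun j hj => hT j (Finset.mem_insert_of_mem hj))

lemma fderiv (hT : IsScalarDiffOp r T) (j : Fin n) :
    IsScalarDiffOp (r + 1) fun g x => fderiv ℝ (T g) x (basisVec j) := by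
  induction hT with
  | @monomial s hs α J c hc =>
    have h1 : ContDiff ℝ ∞ (fun x => _root_.fderiv ℝ c x (basisVec j)) :=
      contDiff_dirDeriv (basisVec j) hc
    refine ((monomial (hs.trans r.le_succ) α J h1).add
      (monomial (Nat.succ_le_succ hs) (Fin.cons j α) J hc)).congr fun g hg => ?_
    funext x
    have hg' := contDiff_pi.1 hg J
    have hd := contDiff_iteratedFDeriv_apply hg' (fun l => basisVec (α l))
    rw [fderiv_fun_mul (hc.differentiable (by simp) x) (hd.differentiable (by simp) x)]
    have e : (fun l => basisVec ((Fin.cons j α : Fin (s + 1) → Fin n) l)) =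
        (Fin.cons (basisVec j) (fun l => basisVec (α l)) : Fin (s + 1) → Rn n) := by
      funext l
      refine Fin.cases ?_ (fun l => ?_) l <;> simp
    rw [e, ← fderiv_iteratedFDeriv_apply hg']
    simp only [_root_.add_apply, _root_.smul_apply, smul_eq_mul]
    ring
  | zero => exact zero.congr fun g _ => by funext x; simp
  | add hT hU h₁ h₂ =>
    refine (h₁.add h₂).congr fun g hg => ?_
    funext x
    rw [fderiv_fun_add ((hT.contDiff hg).differentiable (by simp) x)
      ((hU.contDiff hg).differentiable (by simp) x), _root_.add_apply]
  | congr _ h h₁ => exact h₁.congr fun g hg => by funext x; rw [h g hg]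

lemma exists_coeff (hT : IsScalarDiffOp r T) :
    ∃ c : (s : ℕ) → (Fin s → Fin n) → (Fin a → Fin n) → Rn n → ℂ,
      (∀ s α J, ContDiff ℝ ∞ (c s α J)) ∧ ∀ g, ContDiff ℝ ∞ g → ∀ x,
        T g x = ∑ s ∈ Finset.range (r + 1), ∑ α : Fin s → Fin n, ∑ J : Fin a → Fin n,
          c s α J x * iteratedFDeriv ℝ s (fun y => g y J) x (fun l => basisVec (α l)) := by
  classical
  induction hT with
  | @monomial s hs α J c hc =>
    refine ⟨fun s' β K x => if h : s' = s then (if β = α ∘ Fin.cast h ∧ K = J then c x else 0)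
      else 0, fun s' β K => ?_, fun g _ x => ?_⟩
    · beta_reduce
      split_ifs
      · exact hc
      · exact contDiff_const
      · exact contDiff_const
    · rw [Finset.sum_eq_single s, Finset.sum_eq_single α, Finset.sum_eq_single J]
      · simp
      · intro K _ hK; simp [hK]
      · simp
      · intro β _ hβ
        refine Finset.sum_eq_zero fun K _ => ?_
        have : ¬ (β = α ∘ Fin.cast rfl ∧ K = J) := fun h => hβ h.1
        simp [hβ]
      · simp
      · intro s' _ hs'
        simp [hs']
      · intro h; exact absurd (Finset.mem_range.2 (by omega)) h
  | zero => exact ⟨fun _ _ _ _ => 0, fun _ _ _ => contDiff_const, by simp⟩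
  | add _ _ h₁ h₂ =>
    obtain ⟨c, hc, h⟩ := h₁
    obtain ⟨d, hd, h'⟩ := h₂
    refine ⟨fun s α J x => c s α J x + d s α J x, fun s α J => (hc s α J).add (hd s α J),
      fun g hg x => ?_⟩
    simp only [h g hg, h' g hg]
    simp only [add_mul, Finset.sum_add_distrib]
  | congr _ h h₁ =>
    obtain ⟨c, hc, h'⟩ := h₁
    exact ⟨c, hc, fun g hg x => by rw [h g hg, h' g hg]⟩

end IsScalarDiffOp

/-- Linear differential operators of order at most `r` between smooth tensor fields. -/
def IsFieldDiffOp {n a b : ℕ} (r : ℕ) (P : Field n a → Field n b) : Prop :=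
  ∀ I, IsScalarDiffOp r fun g x => P g x I

namespace IsFieldDiffOp

variable {n a b r : ℕ}

lemma mono {P : Field n a → Field n b} (hP : IsFieldDiffOp r P) {r' : ℕ} (hr : r ≤ r') :
    IsFieldDiffOp r' P := fun I => (hP I).mono hr

lemma id : IsFieldDiffOp 0 (fun g : Field n a => g) := fun I =>
  (IsScalarDiffOp.monomial le_rfl Fin.elim0 I (contDiff_const (c := 1))).congr fun g _ => by
    funext x; simp

lemma castRank {P : Field n a → Field n b} (hP : IsFieldDiffOp r P) (b' : ℕ) :
    IsFieldDiffOp r fun g => castRank b' (P g) := fun I => by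
  unfold MomentumRay.castRank
  by_cases h : b = b'
  · simp only [h, dite_true]
    exact hP _
  · simpa only [h, dite_false] using IsScalarDiffOp.zero

lemma innerDeriv {P : Field n a → Field n b} (hP : IsFieldDiffOp r P) :
    IsFieldDiffOp (r + 1) fun g => innerDeriv (P g) := fun _ =>
  (IsScalarDiffOp.sum _ fun _ _ => (hP _).fderiv _).mul contDiff_const

lemma innerDerivPow {P : Field n a → Field n b} (hP : IsFieldDiffOp r P) (k : ℕ) :
    IsFieldDiffOp (r + k) fun g => innerDerivPow k (P g) := by
  induction k with
  | zero => exact hP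
  | succ k ih => exact ih.innerDeriv

lemma opI {P : Field n a → Field n b} (hP : IsFieldDiffOp r P) :
    IsFieldDiffOp r fun g => opI (P g) := fun _ =>
  (IsScalarDiffOp.sum _ fun _ _ => ((hP _).mul (contDiff_const (c := kronecker n _))).congr
    fun g _ => by funext x; exact mul_comm _ _).mul contDiff_const

lemma opIPow {P : Field n a → Field n b} (hP : IsFieldDiffOp r P) (k : ℕ) :
    IsFieldDiffOp r fun g => opIPow k (P g) := by
  induction k with
  | zero => exact hP
  | succ k ih => exact ih.opI

lemma divergence {P : Field n a → Field n (b + 1)} (hP : IsFieldDiffOp r P) :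
    IsFieldDiffOp (r + 1) fun g => divergence (P g) := fun _ =>
  IsScalarDiffOp.sum _ fun _ _ => (hP _).fderiv _

lemma divergencePow {k : ℕ} {P : Field n a → Field n (b + k)} (hP : IsFieldDiffOp r P) :
    IsFieldDiffOp (r + k) fun g => divergencePow k (P g) := by
  induction k generalizing r with
  | zero => exact hP
  | succ k ih => exact (ih (P := fun g => MomentumRay.divergence (P g)) hP.divergence).mono (by omega)

lemma contract {c : ℕ} {P : Field n a → Field n (b + c)} (hP : IsFieldDiffOp r P)
    {u : Rn n → Tensor n c} (hu : ∀ J, ContDiff ℝ ∞ fun x => u x J) :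
    IsFieldDiffOp r fun g x => contract (u x) (P g x) := fun _ =>
  IsScalarDiffOp.sum _ fun J _ => ((hP _).mul (hu J)).congr
    fun g _ => by funext x; exact mul_comm _ _

lemma opJ {P : Field n a → Field n (b + 2)} (hP : IsFieldDiffOp r P) :
    IsFieldDiffOp r fun g => opJ (P g) := hP.contract fun _ => contDiff_const

lemma opJx {P : Field n a → Field n (b + 1)} (hP : IsFieldDiffOp r P) :
    IsFieldDiffOp r fun g => opJx (P g) := hP.contract fun J => by
  unfold vecTensor
  exact Complex.ofRealCLM.contDiff.comp (EuclideanSpace.proj (𝕜 := ℝ) (J 0)).contDiff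

lemma opJPow {k : ℕ} {P : Field n a → Field n (b + 2 * k)} (hP : IsFieldDiffOp r P) :
    IsFieldDiffOp r fun g => opJPow k (P g) := by
  induction k with
  | zero => exact hP
  | succ k ih => exact ih (P := fun g => MomentumRay.opJ (P g)) hP.opJ

lemma opJxPow {k : ℕ} {P : Field n a → Field n (b + k)} (hP : IsFieldDiffOp r P) :
    IsFieldDiffOp r fun g => opJxPow k (P g) := by
  induction k with
  | zero => exact hP
  | succ k ih => exact ih (P := fun g => MomentumRay.opJx (P g)) hP.opJx

end IsFieldDiffOp

lemma isFieldDiffOp_termD {n m k p q : ℕ} (hp : p ≤ m) :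
    IsFieldDiffOp (m + k) (termD (n := n) (m := m) k p q) :=
  ((((((IsFieldDiffOp.id.castRank _).divergencePow).opJxPow).opJPow).opIPow q).innerDerivPow
    (p - q)).castRank m |>.mono (by omega)

lemma isFieldDiffOp_opD (m n k : ℕ) : IsFieldDiffOp (m + k) (opD m n k) := fun I =>
  (IsScalarDiffOp.sum _ fun _ hp => (IsScalarDiffOp.sum _ fun _ _ =>
    (isFieldDiffOp_termD (Finset.mem_Icc.1 hp).2 I).mul contDiff_const).mul contDiff_const).mul
      contDiff_const

/-! ### Symmetry of the fields `D_{m,n}^k g` -/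

lemma exists_perm_append {n a b : ℕ} (π : Equiv.Perm (Fin a)) (I : Fin a → Fin n)
    (J : Fin b → Fin n) :
    ∃ ρ : Equiv.Perm (Fin (a + b)), Fin.append (I ∘ π) J = Fin.append I J ∘ ρ := by
  refine ⟨finSumFinEquiv.permCongr (Equiv.sumCongr π (Equiv.refl _)), ?_⟩
  funext l
  refine Fin.addCases (fun i => ?_) (fun i => ?_) l <;>
  simp [Equiv.permCongr_apply]

lemma contract_mem {n a b : ℕ} (u : Tensor n b) {v : Tensor n (a + b)}
    (hv : v ∈ SymTensor n (a + b)) : contract u v ∈ SymTensor n a := fun π I => by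
  refine Finset.sum_congr rfl fun J _ => ?_
  obtain ⟨ρ, h⟩ := exists_perm_append π I J
  rw [h, hv ρ]

lemma divergence_mem {n a : ℕ} {g : Field n (a + 1)} (hg : ∀ x, g x ∈ SymTensor n (a + 1))
    (x : Rn n) : divergence g x ∈ SymTensor n a := fun π I => by
  refine Finset.sum_congr rfl fun j _ => ?_
  obtain ⟨ρ, h⟩ := exists_perm_append π I (fun _ : Fin 1 => j)
  simp only [Fin.append_right_eq_snoc] at h
  unfold pderiv
  rw [h]
  simp only [hg _ ρ _]

lemma castRank_mem {n a b : ℕ} {g : Field n a} (hg : ∀ x, g x ∈ SymTensor n a) (x : Rn n) :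
    castRank b g x ∈ SymTensor n b := by
  by_cases h : a = b
  · subst h; rw [castRank_self]; exact hg x
  · have : castRank b g x = 0 := by funext I; simp [castRank, h]
    rw [this]; exact Submodule.zero_mem _

lemma divergencePow_mem {n a k : ℕ} {g : Field n (a + k)} (hg : ∀ x, g x ∈ SymTensor n (a + k)) :
    ∀ x, divergencePow k g x ∈ SymTensor n a := by
  induction k with
  | zero => exact hg
  | succ k ih => exact ih (divergence_mem hg)

lemma opJPow_mem {n a k : ℕ} {g : Field n (a + 2 * k)} (hg : ∀ x, g x ∈ SymTensor n (a + 2 * k)) :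
    ∀ x, opJPow k g x ∈ SymTensor n a := by
  induction k with
  | zero => exact hg
  | succ k ih => exact ih fun x => contract_mem _ (hg x)

lemma opJxPow_mem {n a k : ℕ} {g : Field n (a + k)} (hg : ∀ x, g x ∈ SymTensor n (a + k)) :
    ∀ x, opJxPow k g x ∈ SymTensor n a := by
  induction k with
  | zero => exact hg
  | succ k ih => exact ih fun x => contract_mem _ (hg x)

lemma opIPow_mem {n a k : ℕ} {g : Field n a} (hg : ∀ x, g x ∈ SymTensor n a) :
    ∀ x, opIPow k g x ∈ SymTensor n (a + 2 * k) := by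
  cases k with
  | zero => exact hg
  | succ k => exact fun x => symmetrize_mem _

lemma innerDerivPow_mem {n a k : ℕ} {g : Field n a} (hg : ∀ x, g x ∈ SymTensor n a) :
    ∀ x, innerDerivPow k g x ∈ SymTensor n (a + k) := by
  cases k with
  | zero => exact hg
  | succ k =>
    intro x
    change innerDeriv (innerDerivPow k g) x ∈ SymTensor n (a + k + 1)
    unfold innerDeriv
    exact symmetrize_mem _

lemma opD_mem {m n k : ℕ} {g : Field n m} (hg : ∀ x, g x ∈ SymTensor n m) (x : Rn n) :
    opD m n k g x ∈ SymTensor n m := fun π I => by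
  have h : ∀ p q, termD k p q g x (I ∘ π) = termD k p q g x I := fun p q =>
    castRank_mem (innerDerivPow_mem (opIPow_mem (opJPow_mem (opJxPow_mem (divergencePow_mem
      (castRank_mem hg)))))) x π I
  simp only [opD, h]

lemma isSmoothSym_opD {m n k : ℕ} {g : Field n m} (hg : IsSmoothSym g) :
    IsSmoothSym (opD m n k g) :=
  ⟨contDiff_pi.2 fun I => (isFieldDiffOp_opD m n k I).contDiff hg.1, opD_mem hg.2⟩

lemma isDiffOpOfOrderLE_opD (m n k : ℕ) : IsDiffOpOfOrderLE (opD m n k) (m + k) := by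
  refine ⟨fun g hg => isSmoothSym_opD hg, ?_⟩
  choose c hc h using fun I => (isFieldDiffOp_opD m n k I).exists_coeff
  exact ⟨fun s α J I => c I s α J, fun s α J I => hc I s α J, fun g hg x I => h I g hg.1 x⟩

lemma sumField_mem {n m : ℕ} (f : 𝓢(Rn n, SymTensor n m)) (x : Rn n) :
    sumField f x ∈ SymTensor n m := fun π I =>
  Finset.sum_congr rfl fun k _ => opD_mem (isSmoothSym_normalOp f k).2 x π I

/-! ### The order of `D_{m,n}^k` is exactly `m + k` -/

/-- The tensor field `P(x_i) e_i ⊗ ⋯ ⊗ e_i` for a polynomial `P`. -/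
def polyField {n : ℕ} (m : ℕ) (i : Fin n) (P : Polynomial ℂ) : Field n m := fun x I =>
  P.eval (x i : ℂ) * vecPow (basisVec i) I

lemma hasFDerivAt_polynomial_coord {n : ℕ} (i : Fin n) (P : Polynomial ℂ) (x : Rn n) :
    HasFDerivAt (fun y : Rn n => P.eval (y i : ℂ))
      (P.derivative.eval (x i : ℂ) • Complex.ofRealCLM.comp (EuclideanSpace.proj (𝕜 := ℝ) i)) x := by
  have h1 : HasFDerivAt (fun y : Rn n => (y i : ℂ))
      (Complex.ofRealCLM.comp (EuclideanSpace.proj (𝕜 := ℝ) i)) x :=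
    (Complex.ofRealCLM.comp (EuclideanSpace.proj (𝕜 := ℝ) i)).hasFDerivAt
  exact (P.hasDerivAt (x i : ℂ)).comp_hasFDerivAt x h1

lemma contDiff_polynomial_coord {n : ℕ} (i : Fin n) (P : Polynomial ℂ) :
    ContDiff ℝ ∞ (fun y : Rn n => P.eval (y i : ℂ)) := by
  have h1 : ContDiff ℝ ∞ (fun y : Rn n => (y i : ℂ)) :=
    (Complex.ofRealCLM.comp (EuclideanSpace.proj (𝕜 := ℝ) i)).contDiff
  have h2 : ContDiff ℝ ∞ (fun z : ℂ => P.eval z) := by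
    simpa using (P.contDiff_aeval (𝕜 := ℂ) (n := ∞)).restrict_scalars ℝ
  exact h2.comp h1

lemma fderiv_polynomial_coord {n : ℕ} (i : Fin n) (P : Polynomial ℂ) (x w : Rn n) :
    fderiv ℝ (fun y : Rn n => P.eval (y i : ℂ)) x w = P.derivative.eval (x i : ℂ) * (w i : ℂ) := by
  rw [(hasFDerivAt_polynomial_coord i P x).fderiv]
  simp

lemma iteratedFDeriv_polynomial_coord {n s : ℕ} (i : Fin n) (P : Polynomial ℂ) (x : Rn n)
    (v : Fin s → Rn n) :
    iteratedFDeriv ℝ s (fun y : Rn n => P.eval (y i : ℂ)) x v =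
      (Polynomial.derivative^[s] P).eval (x i : ℂ) * ∏ l, (v l i : ℂ) := by
  induction s generalizing x with
  | zero => simp
  | succ s ih =>
    rw [← Fin.cons_self_tail v, ← fderiv_iteratedFDeriv_apply (contDiff_polynomial_coord i P)]
    simp only [ih]
    rw [fderiv_mul_const (hasFDerivAt_polynomial_coord i _ x).differentiableAt]
    simp only [_root_.smul_apply, fderiv_polynomial_coord, smul_eq_mul,
      Function.iterate_succ_apply', Fin.prod_univ_succ, Fin.cons_zero, Fin.cons_succ]
    ring

lemma isSmoothSym_polyField {n : ℕ} (m : ℕ) (i : Fin n) (P : Polynomial ℂ) :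
    IsSmoothSym (polyField m i P) :=
  ⟨contDiff_pi.2 fun _ => (contDiff_polynomial_coord i P).mul contDiff_const,
    fun x π I => by simp only [polyField, vecPow_perm]⟩

lemma castRank_polyField {n a b : ℕ} (h : a = b) (i : Fin n) (P : Polynomial ℂ) :
    castRank b (polyField a i P) = polyField b i P := by
  subst h; exact castRank_self _

lemma divergence_polyField {n m : ℕ} (i : Fin n) (P : Polynomial ℂ) :
    divergence (polyField (m + 1) i P) = polyField m i P.derivative := by
  funext x I
  simp only [divergence, pderiv, polyField, vecPow_snoc]
  rw [Finset.sum_eq_single i]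
  · rw [fderiv_mul_const (hasFDerivAt_polynomial_coord i P x).differentiableAt]
    simp only [_root_.smul_apply, fderiv_polynomial_coord, smul_eq_mul, basisVec_apply]
    simp
    ring
  · intro j _ hj
    simp [basisVec_apply, hj]
  · simp

lemma divergencePow_polyField {n m k : ℕ} (i : Fin n) (P : Polynomial ℂ) :
    divergencePow k (polyField (m + k) i P) = polyField m i (Polynomial.derivative^[k] P) := by
  induction k generalizing P with
  | zero => rfl
  | succ k ih =>
    change divergencePow k (divergence (polyField (m + k + 1) i P)) = _
    rw [divergence_polyField, ih, Function.iterate_succ_apply]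

lemma opJx_polyField {n m : ℕ} (i : Fin n) (P : Polynomial ℂ) :
    opJx (polyField (m + 1) i P) = polyField m i (Polynomial.X * P) := by
  funext x I
  simp only [opJx, contract, polyField, vecPow_append]
  have h := sum_vecTensor x (basisVec i)
  rw [real_inner_comm, inner_basisVec_left] at h
  rw [Polynomial.eval_mul, Polynomial.eval_X, ← h]
  simp only [Finset.sum_mul]
  exact Finset.sum_congr rfl fun _ _ => by ring

lemma opJxPow_polyField {n m k : ℕ} (i : Fin n) (P : Polynomial ℂ) :
    opJxPow k (polyField (m + k) i P) = polyField m i (Polynomial.X ^ k * P) := by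
  induction k generalizing P with
  | zero => simp [opJxPow]
  | succ k ih =>
    change opJxPow k (opJx (polyField (m + k + 1) i P)) = _
    rw [opJx_polyField, ih, pow_succ, mul_assoc]

lemma norm_basisVec {n : ℕ} (i : Fin n) : ‖(basisVec i : Rn n)‖ = 1 := by simp [basisVec]

lemma opJ_polyField {n m : ℕ} (i : Fin n) (P : Polynomial ℂ) :
    opJ (polyField (m + 2) i P) = polyField m i P := by
  funext x I
  simp only [opJ, contract, polyField, vecPow_append]
  have h := sum_kronecker (basisVec i)
  rw [norm_basisVec] at h
  simp only [mul_assoc, ← Finset.mul_sum, h]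
  simp

lemma opJPow_polyField {n m k : ℕ} (i : Fin n) (P : Polynomial ℂ) :
    opJPow k (polyField (m + 2 * k) i P) = polyField m i P := by
  induction k with
  | zero => rfl
  | succ k ih =>
    change opJPow k (opJ (polyField (m + 2 * k + 2) i P)) = _
    rw [opJ_polyField, ih]

lemma tensorEval_basisVec {n m : ℕ} (u : Tensor n m) (i : Fin n) :
    tensorEval u (basisVec i) = u (fun _ => i) := by
  rw [tensorEval, Finset.sum_eq_single (fun _ => i)]
  · simp [vecPow, basisVec_apply]
  · intro I _ hI
    obtain ⟨l, hl⟩ := Function.ne_iff.1 hI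
    have : vecPow (basisVec i) I = 0 :=
      Finset.prod_eq_zero (Finset.mem_univ l) (by simp [basisVec_apply, hl])
    rw [this, mul_zero]
  · simp

lemma dirDeriv_iterate_polynomial {n : ℕ} (i : Fin n) (P : Polynomial ℂ) (r : ℕ) :
    (dirDeriv (basisVec i))^[r] (fun y : Rn n => P.eval (y i : ℂ)) =
      fun y => (Polynomial.derivative^[r] P).eval (y i : ℂ) := by
  induction r generalizing P with
  | zero => rfl
  | succ r ih =>
    rw [Function.iterate_succ_apply, Function.iterate_succ_apply, ← ih]
    congr 1
    funext y
    rw [dirDeriv, fderiv_polynomial_coord]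
    simp [basisVec_apply]

lemma termD_polyField {n m k p q : ℕ} (h₁ : k + q ≤ p) (h₂ : p + q ≤ m) (i : Fin n)
    (P : Polynomial ℂ) (x : Rn n) :
    termD k p q (polyField m i P) x (fun _ => i) = (Polynomial.derivative^[p - q]
      (Polynomial.X ^ (p - k - q) * Polynomial.derivative^[k] P)).eval (x i : ℂ) := by
  rw [← tensorEval_basisVec (termD k p q _ x), termD, tensorEval_castRank (by omega),
    castRank_polyField (by omega), divergencePow_polyField, opJxPow_polyField, opJPow_polyField]
  have hs := (isSmoothSym_polyField (m - p - q) i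
    (Polynomial.X ^ (p - k - q) * Polynomial.derivative^[k] P)).1
  refine (congrFun (tensorEval_innerDerivPow (contDiff_opIPow hs q) (basisVec i) (p - q)) x).trans ?_
  refine Eq.trans (congrArg (fun h => (dirDeriv (basisVec i))^[p - q] h x) ?_)
    (congrFun (dirDeriv_iterate_polynomial i _ (p - q)) x)
  funext y
  rw [tensorEval_opIPow, tensorEval_basisVec, norm_basisVec]
  simp [polyField, vecPow, basisVec_apply]

lemma eval_iterate_derivative_termD {m k a j : ℕ} (hj : j ≤ m) :
    (Polynomial.derivative^[j] (Polynomial.X ^ a * Polynomial.derivative^[k]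
      ((Polynomial.X - Polynomial.C (1 : ℂ)) ^ (m + k)))).eval 1 =
      if j = m then ((m ! : ℕ) : ℂ) * ((m + k).descFactorial k : ℂ) else 0 := by
  rw [Polynomial.iterate_derivative_X_sub_pow, Nat.add_sub_cancel]
  have hp : (Polynomial.X ^ a * (m + k).descFactorial k • (Polynomial.X - Polynomial.C (1 : ℂ)) ^ m
      ).map (algebraMap ℂ ℂ) = (Polynomial.X - Polynomial.C (1 : ℂ)) ^ m *
        (((m + k).descFactorial k : Polynomial ℂ) * Polynomial.X ^ a) := by
    rw [Algebra.algebraMap_self, Polynomial.map_id, nsmul_eq_mul]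
    ring
  split_ifs with h
  · subst h
    have := Polynomial.aeval_iterate_derivative_self _ j (1 : ℂ) hp
    rw [Polynomial.coe_aeval_eq_eval] at this
    rw [this]
    simp
  · have := Polynomial.aeval_iterate_derivative_of_lt _ m (1 : ℂ) hp (lt_of_le_of_ne hj h)
    rwa [Polynomial.coe_aeval_eq_eval] at this

lemma coeffC_ne_zero {m n : ℕ} (hn : 2 ≤ n) (k : ℕ) : coeffC m n k ≠ 0 := by
  have hn' : (2 : ℝ) ≤ n := by exact_mod_cast hn
  have h1 : Real.Gamma ((2 * (m : ℝ) + n - 1) / 2) ≠ 0 :=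
    (Real.Gamma_pos_of_pos (by have : (0 : ℝ) ≤ m := m.cast_nonneg; linarith)).ne'
  have h2 : (((n + 2 * m - 3)‼ : ℕ) : ℝ) ≠ 0 := by
    exact_mod_cast (Nat.doubleFactorial_pos _).ne'
  have h3 : Real.pi ^ (((n : ℝ) + 1) / 2) ≠ 0 := (Real.rpow_pos_of_pos Real.pi_pos _).ne'
  have h4 : (k ! : ℝ) ≠ 0 := by exact_mod_cast k.factorial_ne_zero
  have h5 : ((-1 : ℝ)) ^ k ≠ 0 := pow_ne_zero _ (by norm_num)
  have h6 : (2 : ℝ) ^ ((m : ℤ) - 2) ≠ 0 := zpow_ne_zero _ (by norm_num)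
  unfold coeffC
  positivity

lemma opD_polyField_ne_zero {m n k : ℕ} (hn : 2 ≤ n) (hk : k ≤ m) (i : Fin n) :
    opD m n k (polyField m i ((Polynomial.X - Polynomial.C 1) ^ (m + k))) (basisVec i)
      (fun _ => i) ≠ 0 := by
  have ht : ∀ p ∈ Finset.Icc k m, ∀ q ∈ Finset.range (min p (min (m - p) (p - k)) + 1),
      termD k p q (polyField m i ((Polynomial.X - Polynomial.C 1) ^ (m + k))) (basisVec i)
        (fun _ => i) =
      if p - q = m then ((m ! : ℕ) : ℂ) * ((m + k).descFactorial k : ℂ) else 0 := fun p hp q hq => by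
    rw [Finset.mem_Icc] at hp
    rw [Finset.mem_range] at hq
    rw [termD_polyField (by omega) (by omega), basisVec_apply, if_pos rfl, Complex.ofReal_one,
      eval_iterate_derivative_termD (by omega)]
  unfold opD
  refine mul_ne_zero (Complex.ofReal_ne_zero.2 (coeffC_ne_zero hn k)) ?_
  rw [Finset.sum_eq_single m]
  · refine mul_ne_zero (by exact_mod_cast (Nat.doubleFactorial_pos _).ne') ?_
    have hr : Finset.range (min m (min (m - m) (m - k)) + 1) = {0} := by simp
    rw [hr, Finset.sum_singleton, ht m (Finset.mem_Icc.2 ⟨hk, le_rfl⟩) 0 (by simp)]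
    have h1 : (((m - k)! : ℕ) : ℂ) ≠ 0 := by exact_mod_cast (m - k).factorial_ne_zero
    have h2 : ((m ! : ℕ) : ℂ) ≠ 0 := by exact_mod_cast m.factorial_ne_zero
    have h3 : ((m + k).descFactorial k : ℂ) ≠ 0 := by
      exact_mod_cast (Nat.descFactorial_pos.2 (by omega)).ne'
    simp [h1, h2, h3]
  · intro p hp hpm
    refine mul_eq_zero_of_right _ (Finset.sum_eq_zero fun q hq => ?_)
    rw [ht p hp q hq, if_neg, mul_zero]
    rw [Finset.mem_Icc] at hp
    omega
  · intro h
    exact absurd (Finset.mem_Icc.2 ⟨hk, le_rfl⟩) h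

lemma isDiffOpOfOrder_opD {m n k : ℕ} (hn : 2 ≤ n) (hk : k ≤ m) :
    IsDiffOpOfOrder (opD m n k) (m + k) := by
  refine ⟨isDiffOpOfOrderLE_opD m n k, fun r' hr' ⟨_, c, _, h⟩ => ?_⟩
  let i : Fin n := ⟨0, by omega⟩
  refine opD_polyField_ne_zero hn hk i ?_
  rw [h _ (isSmoothSym_polyField m i _)]
  refine Finset.sum_eq_zero fun s hs => Finset.sum_eq_zero fun α _ => Finset.sum_eq_zero fun J _ => ?_
  rw [Finset.mem_range] at hs
  have hd : iteratedFDeriv ℝ s (fun y => polyField m i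
      ((Polynomial.X - Polynomial.C 1) ^ (m + k)) y J) (basisVec i)
      (fun l => basisVec (α l)) = 0 := by
    have e : (fun y => polyField m i ((Polynomial.X - Polynomial.C 1) ^ (m + k)) y J) =
        fun y => ((Polynomial.C (vecPow (basisVec i) J)) *
          (Polynomial.X - Polynomial.C 1) ^ (m + k)).eval (y i : ℂ) := by
      funext y
      simp [polyField, mul_comm]
    rw [e, iteratedFDeriv_polynomial_coord, Polynomial.iterate_derivative_C_mul,
      Polynomial.iterate_derivative_X_sub_pow, basisVec_apply, if_pos rfl]
    have : m + k - s ≠ 0 := by omega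
    simp [this]
  rw [hd, mul_zero]

/-! ### The formal adjoint of the ray transform -/

lemma integral_orthogonal_line {n : ℕ} (ξ : Sph n) {F : Rn n → ℂ} (hF : Integrable F) :
    ∫ x : (Submodule.span ℝ {(ξ : Rn n)})ᗮ, ∫ t : ℝ, F (x + t • (ξ : Rn n)) = ∫ y, F y := by
  set K := Submodule.span ℝ {(ξ : Rn n)} with hK
  let u : ℝ ≃ₗᵢ[ℝ] K := LinearIsometryEquiv.toSpanUnitSingleton (ξ : Rn n) (norm_eq_of_mem_sphere ξ)
  let e : ℝ × Kᗮ ≃ᵐ Rn n :=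
    ((MeasurableEquiv.prodCongr u.toHomeomorph.toMeasurableEquiv (MeasurableEquiv.refl Kᗮ)).trans
      (MeasurableEquiv.toLp 2 (K × Kᗮ))).trans
      K.orthogonalDecomposition.symm.toHomeomorph.toMeasurableEquiv
  have he : MeasurePreserving e := by
    have h1 : MeasurePreserving (Prod.map u id : ℝ × Kᗮ → K × Kᗮ)
        ((volume : Measure ℝ).prod volume) ((volume : Measure K).prod volume) :=
      u.measurePreserving.prod (MeasurePreserving.id _)
    exact K.orthogonalDecomposition.symm.measurePreserving.comp
      ((WithLp.volume_preserving_toLp K Kᗮ).comp h1)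
  have hap : ∀ p, e p = (p.2 : Rn n) + p.1 • (ξ : Rn n) := fun p => by
    have : e p = K.orthogonalDecomposition.symm (WithLp.toLp 2 (u p.1, p.2)) := rfl
    rw [this, add_comm]
    simp only [Submodule.orthogonalDecomposition_symm_apply]
    rfl
  rw [← he.integral_comp', Measure.volume_eq_prod, integral_prod_symm]
  · simp only [hap]
  · exact (he.integrable_comp_emb e.measurableEmbedding).2 hF

/-- The integrand of the two `L²`-products in the duality between `I_m^k` and its adjoint. -/
def adjointKernel {n m : ℕ} (k : ℕ) (f : 𝓢(Rn n, SymTensor n m)) (χ : 𝓢(Rn n × Rn n, ℂ))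
    (I : Fin m → Fin n) (ξ y : Rn n) : ℂ :=
  ((inner ℝ y ξ : ℝ) : ℂ) ^ k * vecPow ξ I * conj (χ (y - (inner ℝ y ξ : ℝ) • ξ, ξ)) *
    schwartzComp f I y

lemma continuous_adjointKernel {n m : ℕ} (k : ℕ) (f : 𝓢(Rn n, SymTensor n m))
    (χ : 𝓢(Rn n × Rn n, ℂ)) (I : Fin m → Fin n) :
    Continuous (fun p : Rn n × Rn n => adjointKernel k f χ I p.1 p.2) := by
  have h1 := (continuous_vecPow (n := n) I).comp (continuous_fst (X := Rn n) (Y := Rn n))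
  have h2 := χ.continuous
  have h3 := (schwartzComp f I).continuous
  have h4 : Continuous fun p : Rn n × Rn n =>
      conj (χ (p.2 - (inner ℝ p.2 p.1 : ℝ) • p.1, p.1)) :=
    Complex.continuous_conj.comp (h2.comp (by fun_prop))
  unfold adjointKernel
  exact (((by fun_prop : Continuous fun p : Rn n × Rn n =>
    ((inner ℝ p.2 p.1 : ℝ) : ℂ) ^ k).mul h1).mul h4).mul (h3.comp continuous_snd)

lemma exists_adjointKernel_bound {n m : ℕ} (k : ℕ) (f : 𝓢(Rn n, SymTensor n m))
    (χ : 𝓢(Rn n × Rn n, ℂ)) (I : Fin m → Fin n) :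
    ∃ B : Rn n → ℝ, Integrable B ∧ ∀ (ξ : Sph n) y, ‖adjointKernel k f χ I ξ y‖ ≤ B y := by
  refine ⟨fun y => SchwartzMap.seminorm ℝ 0 0 χ * (‖y‖ ^ k * ‖schwartzComp f I y‖),
    ((schwartzComp f I).integrable_pow_mul volume k).const_mul _, fun ξ y => ?_⟩
  have hξ : ‖(ξ : Rn n)‖ = 1 := norm_eq_of_mem_sphere ξ
  have h1 : ‖((inner ℝ y (ξ : Rn n) : ℝ) : ℂ)‖ ≤ ‖y‖ := by
    rw [Complex.norm_real]
    simpa [hξ] using norm_inner_le_norm (𝕜 := ℝ) y (ξ : Rn n)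
  have h2 : ‖vecPow (ξ : Rn n) I‖ ≤ 1 := by simpa [hξ] using norm_vecPow_le (ξ : Rn n) I
  rw [adjointKernel, norm_mul, norm_mul, norm_mul, norm_pow, RCLike.norm_conj]
  calc _ ≤ ‖y‖ ^ k * 1 * SchwartzMap.seminorm ℝ 0 0 χ * ‖schwartzComp f I y‖ := by
        gcongr
        exact SchwartzMap.norm_le_seminorm ℝ χ _
    _ = _ := by ring

lemma integrable_adjointKernel {n m : ℕ} (k : ℕ) (f : 𝓢(Rn n, SymTensor n m))
    (χ : 𝓢(Rn n × Rn n, ℂ)) (I : Fin m → Fin n) :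
    Integrable (fun p : Sph n × Rn n => adjointKernel k f χ I p.1 p.2)
      ((volume : Measure (Rn n)).toSphere.prod volume) := by
  obtain ⟨B, hB, h⟩ := exists_adjointKernel_bound k f χ I
  refine (hB.comp_snd (volume : Measure (Rn n)).toSphere).mono' ?_
    (Filter.Eventually.of_forall fun p => h p.1 p.2)
  exact ((continuous_adjointKernel k f χ I).comp (by fun_prop :
    Continuous fun p : Sph n × Rn n => ((p.1 : Rn n), p.2))).aestronglyMeasurable

lemma integrable_adjointKernel_right {n m : ℕ} (k : ℕ) (f : 𝓢(Rn n, SymTensor n m))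
    (χ : 𝓢(Rn n × Rn n, ℂ)) (I : Fin m → Fin n) (ξ : Sph n) :
    Integrable (adjointKernel k f χ I ξ) := by
  obtain ⟨B, hB, h⟩ := exists_adjointKernel_bound k f χ I
  refine hB.mono' ?_ (Filter.Eventually.of_forall fun y => h ξ y)
  exact ((continuous_adjointKernel k f χ I).comp (by fun_prop :
    Continuous fun y : Rn n => ((ξ : Rn n), y))).aestronglyMeasurable

lemma integrable_adjointKernel_left {n m : ℕ} (k : ℕ) (f : 𝓢(Rn n, SymTensor n m))
    (χ : 𝓢(Rn n × Rn n, ℂ)) (I : Fin m → Fin n) (y : Rn n) :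
    Integrable (fun ξ : Sph n => adjointKernel k f χ I ξ y)
      (volume : Measure (Rn n)).toSphere := by
  obtain ⟨B, -, h⟩ := exists_adjointKernel_bound k f χ I
  refine (integrable_const (B y)).mono' ?_ (Filter.Eventually.of_forall fun ξ => h ξ y)
  exact ((continuous_adjointKernel k f χ I).comp (by fun_prop :
    Continuous fun ξ : Sph n => ((ξ : Rn n), y))).aestronglyMeasurable

lemma rayTransform_mul_conj {n m : ℕ} (k : ℕ) (f : 𝓢(Rn n, SymTensor n m))
    (χ : 𝓢(Rn n × Rn n, ℂ)) (ξ : Sph n) (x : (Submodule.span ℝ {(ξ : Rn n)})ᗮ) :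
    rayTransform k (toField f) x ξ * conj (χ ((x : Rn n), (ξ : Rn n))) =
      ∫ t : ℝ, ∑ I, adjointKernel k f χ I ξ (x + t • (ξ : Rn n)) := by
  have hx : inner ℝ (x : Rn n) (ξ : Rn n) = 0 :=
    (Submodule.mem_orthogonal' _ _).1 x.2 _ (Submodule.mem_span_singleton_self _)
  have hin : ∀ t : ℝ, inner ℝ ((x : Rn n) + t • (ξ : Rn n)) (ξ : Rn n) = t := fun t => by
    rw [inner_add_left, hx, real_inner_smul_left, real_inner_self_eq_norm_sq,
      norm_eq_of_mem_sphere]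
    ring
  rw [rayTransform, ← integral_mul_const]
  refine integral_congr_ae (Filter.Eventually.of_forall fun t => ?_)
  simp only [adjointKernel, hin, add_sub_cancel_right, schwartzComp_apply, Finset.mul_sum,
    Finset.sum_mul]
  exact Finset.sum_congr rfl fun I _ => by ring

lemma mul_conj_rayAdjoint {n m : ℕ} (k : ℕ) (f : 𝓢(Rn n, SymTensor n m))
    (χ : 𝓢(Rn n × Rn n, ℂ)) (I : Fin m → Fin n) (y : Rn n) :
    toField f y I * conj (rayAdjoint m k (fun x ξ => χ (x, ξ)) y I) =
      ∫ ξ : Sph n, adjointKernel k f χ I ξ y ∂(volume : Measure (Rn n)).toSphere := by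
  rw [rayAdjoint, ← integral_conj, ← integral_const_mul]
  refine integral_congr_ae (Filter.Eventually.of_forall fun ξ => ?_)
  simp only [adjointKernel, vecPow, map_mul, map_pow, map_prod, Complex.conj_ofReal,
    schwartzComp_apply]
  ring

lemma isFormalAdjoint_rayAdjoint (n m k : ℕ) : IsFormalAdjoint n m k := fun f χ => by
  unfold l2TangentSphere l2Field
  simp only [mul_conj_rayAdjoint, rayTransform_mul_conj]
  have h1 : ∀ ξ : Sph n, ∫ x : (Submodule.span ℝ {(ξ : Rn n)})ᗮ, ∫ t : ℝ,
      ∑ I, adjointKernel k f χ I ξ (x + t • (ξ : Rn n)) =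
      ∫ y, ∑ I, adjointKernel k f χ I ξ y := fun ξ =>
    integral_orthogonal_line ξ (F := fun y => ∑ I, adjointKernel k f χ I ξ y)
      (integrable_finsetSum _ fun I _ => integrable_adjointKernel_right k f χ I ξ)
  simp only [h1]
  rw [integral_integral_swap]
  · refine integral_congr_ae (Filter.Eventually.of_forall fun y => ?_)
    exact integral_finsetSum _ fun I _ => integrable_adjointKernel_left k f χ I y
  · exact integrable_finsetSum _ fun I _ => integrable_adjointKernel k f χ I

end MomentumRay

end

open MomentumRay
open scoped SchwartzMap

theorem theorem3p1 (m n : ℕ) (hn : 2 ≤ n) :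
    (∀ k ≤ m, IsFormalAdjoint n m k) ∧
    (∀ k ≤ m, IsDiffOpOfOrder (opD m n k) (m + k)) ∧
    ∀ f : 𝓢(Rn n, SymTensor n m),
      (∀ k ≤ m, IsSmoothSym (normalOp k (toField f))) ∧
      ∀ I : Fin m → Fin n,
        HasSqrtNegLaplacian
          (fun x => ∑ k ∈ Finset.range (m + 1), opD m n k (normalOp k (toField f)) x I)
          (fun x => toField f x I) := by
  refine ⟨fun k _ => isFormalAdjoint_rayAdjoint n m k, fun k hk => isDiffOpOfOrder_opD hn hk,
    fun f => ⟨fun k _ => isSmoothSym_normalOp f k, fun I => ?_⟩⟩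
  exact hasSqrtNegLaplacian_sumField hn f (sumField_mem f) I
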